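/- **Setting.** $G=(V,E)$ is a directed graph with $n=|V|\ge 2$ nodes and $m=|E|$ edges, with the triggering model: every node $v$ independently draws a triggering set $T_v$ from a distribution $D_v$ on the sets of in-neighbours of $v$; a node becomes active one step after some node of its triggering set is active; $\sigma(S)$ is the expected number of nodes that are ever active when the seed set is $S$. An RR set $R$ is the random set of the nodes that reach a uniformly random root in the graph with the edges $(w,u)$, $w\in T_u$; put $\nu^{(j)}=\mathbb E|R|^j$. Strategy mixes are points of a convex set $\mathcal D\subseteq\mathbb R_+^d$. The strategy activation functions $h_v$ are defined, $[0,1]$-valued, monotone and DR-submodular on a region $\prod_i[0,u_i]$, $u_i\in[0,\infty]$, that contains $\mathcal D$ (for instance $\mathbb R^d_+$ or $[0,1]^d$), and are $L_h$-Lipschitz and $\beta_h$-smooth on $\mathcal D$, $L_h>0$, $\beta_h\ge0$. The cost $c\ge0$ is convex and $L_c$-Lipschitz on $\mathcal D$; $k$ is the budget, $\lambda\ge 0$ the balance parameter, $s(x)=\lambda(k-c(x))$, $\mathcal P=\{x\in\mathcal D: c(x)\le k\}$ has diameter at most $\Delta$, $\Delta>0$, and $g(x)=\sum_{S\subseteq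 V}\sigma(S)\prod_{u\in S}h_u(x)\prod_{v\notin S}(1-h_v(x))$. The maximum $\mathrm{OPT}_{g+s}$ of $g+s$ on $\mathcal P$ is attained. $\mathcal N(\mathcal P,r)$ is the least number of closed Euclidean balls of radius $r$ that cover $\mathcal P$. For RR sets $\mathcal R=(R_1,\dots,R_\theta)$ let $\hat g_{\mathcal R}(x)=\frac n\theta\sum_{R\in\mathcal R}\bigl(1-\prod_{v\in R}(1-h_v(x))\bigr)$, let $\nu^{(j)}(\mathcal R)$ be the average of $|R|^j$ over $\mathcal R$, and $\hat\beta(\mathcal R)=\nu^{(1)}(\mathcal R)n\beta_h+\nu^{(2)}(\mathcal R)nL_h^2$. **Algorithm** (ProxGrad-RIS, revised by resampling the RR sets in each round), for $0<\varepsilon<\frac12$ and $\ell$. $\mathcal A(\mathcal R,a)$ starts at a given point of $\mathcal P$, performs $\lceil 3\hat\beta(\mathcal R)\Delta^2/(4a)\rceil$ proximal gradient steps $x\mapsto\arg\min_{y\in\mathcal P}\bigl(-\eta s(y)+\frac12\|x+\eta\nabla\hat g_{\mathcal R}(x)-y\|^2\bigr)$ with $\eta=1/\hat\beta(\mathcal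 R)$, and returns the iterate with the largest value of $\hat g_{\mathcal R}+s$. Put $\varepsilon'=\sqrt2\varepsilon/3$, $L=n^2L_h+\lambda L_c$, $x_i=(n+\lambda k)/2^i$ and $$\theta_i=\Bigl\lceil \tfrac{n(2+\frac23\varepsilon')\left(\ln\mathcal N(\mathcal P,\frac{\varepsilon/3}{L}x_i)+\ell\ln n+\ln2+\ln\log_2(n+\lambda k)\right)}{\varepsilon'^2x_i}\Bigr\rceil .$$ For $i=1,\dots,\lfloor\log_2(n+\lambda k)-1\rfloor$ draw $\theta_i$ new RR sets $\mathcal R_i$, let $y_i=\mathcal A(\mathcal R_i,\varepsilon x_i/3)$, and if $(\hat g_{\mathcal R_i}+s)(y_i)\ge(1+\varepsilon'+\varepsilon/3)x_i$ put $LB=(\hat g_{\mathcal R_i}+s)(y_i)/(1+\varepsilon'+\varepsilon/3)$ and leave the loop; if this never happens, $LB=1$. Finally draw $\lceil\max\{\theta^{(1)},\theta^{(2)}\}\rceil$ new RR sets $\mathcal R$ and return $\mathcal A(\mathcal R,\varepsilon LB)$, where, with $\alpha=\frac12$ and $\alpha'=\alpha-\varepsilon/3$, $$\theta^{(1)}=\tfrac{8n\ln(4n^\ell)}{LB\,\alpha'^2\varepsilon^2/9},\qquad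 \theta^{(2)}=\tfrac{2\alpha' n\ln\left(4n^\ell\mathcal N(\mathcal P,\frac{\varepsilon/3}{2L}LB)\right)}{(\varepsilon/3-\frac14\alpha'^2\varepsilon/3)^2LB}.$$ **Running time.** A triggering set of $v$ is sampled in time at most $\kappa\,|N^-(v)|$, where $|N^-(v)|$ is the in-degree of $v$, and RR sets are generated by reverse search; $h_v(x)$ and $\nabla h_v(x)$ are computed in time at most $T_h$, $c(x)$ in time at most $T_c$, a proximal step in time at most $T_{prox}$ (each oracle spends at least one step per coordinate that it writes: every nonzero coordinate of $\nabla h_v(x)$, all $d$ coordinates of a proximal step). An arithmetic operation on real numbers takes one step, and an operation on vectors one step per coordinate that it touches. **Theorem.** Assume in addition that $\max_{x\in\mathcal P}g(x)\ge\max_{v\in V}\sigma(\{v\})$, $\lambda k\le n$ and $n+\lambda k\le n^\ell$. Then the expected running time is at most $$C\Bigl(\tfrac{n^2(\nu^{(2)}\beta_h+\nu^{(3)}L_h^2)\ln\left(n^\ell\mathcal N(\mathcal P,r)\right)}{\varepsilon^3\,\mathrm{OPT}_{g+s}}(1+T_h)+\tfrac{\nu^{(1)}n\beta_h+\nu^{(2)}nL_h^2}{\varepsilon}\log_2(n+\lambda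 k)(T_c+T_{prox})+\tfrac{(m+n)\ln\left(n^\ell\mathcal N(\mathcal P,r)\right)}{\varepsilon^2}\Bigr)$$ (a) with $r=\frac{\varepsilon}{3(2n^2L_h+2\lambda L_c)}$ and a constant $C$ that depends only on $\kappa$, an upper bound of $\Delta$ and a positive lower bound of $\beta_h+L_h^2$; and (b) with $r=\frac{\varepsilon}{2n^2L_h+2\lambda L_c}$ and a constant $C$ that depends only on these and on the dimension $d$. -/

import Mathlib

open scoped ENNReal NNReal

noncomputable section

namespace CIMBS

/-! ### Programs with a step count -/

/-- The result of a deterministic computation together with the number of steps it takes. -/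
structure Timed (α : Type) where
  val : α
  time : ℕ

instance : Monad Timed where
  pure a := ⟨a, 0⟩
  bind x f := ⟨(f x.val).val, x.time + (f x.val).time⟩

/-- Spend `n` steps. -/
def tick (n : ℕ) : Timed Unit := ⟨(), n⟩

/-- A randomized program: the joint law of its result and of the number of steps it takes. -/
def Prog (α : Type) : Type := PMF (α × ℕ)

instance : Monad Prog where
  pure a := PMF.pure (a, 0)
  bind p f := PMF.bind p fun x => PMF.map (fun y => (y.1, x.2 + y.2)) (f x.1)

/-- A deterministic computation as a randomized program. -/
def Prog.ofTimed {α : Type} (t : Timed α) : Prog α := PMF.pure (t.val, t.time)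

/-- The expected running time (possibly infinite) of a randomized program. -/
def Prog.expTime {α : Type} (p : Prog α) : ℝ≥0∞ :=
  ∑' x : α × ℕ, (show PMF (α × ℕ) from p) x * (x.2 : ℝ≥0∞)

/-! ### The triggering model -/

/-- A triggering model: a directed graph and, for every node `v`, a distribution `D v` on the sets
of in-neighbours of `v`. -/
structure TriggeringModel (V : Type) where
  G : Digraph V
  D : V → PMF (Finset V)
  D_subset : ∀ v, ∀ S ∈ (D v).support, ∀ u ∈ S, G.Adj u v

namespace TriggeringModel

variable {V : Type} [Fintype V] [DecidableEq V] (M : TriggeringModel V)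

open Classical in
/-- The number of in-neighbours of `v`. -/
def inDegree (v : V) : ℕ := (Finset.univ.filter fun u => M.G.Adj u v).card

/-- The number of edges. -/
def numEdges : ℕ := ∑ v, M.inDegree v

/-- The law of the profile of all triggering sets, which are drawn independently. -/
def profile : PMF (V → Finset V) :=
  PMF.ofFintype (fun T => ∏ v, M.D v (T v)) (by
    rw [← Fintype.piFinset_univ, ← Finset.prod_univ_sum]
    refine Finset.prod_eq_one fun v _ => ?_
    rw [← tsum_fintype (L := .unconditional _)]
    exact (M.D v).tsum_coe)

/-- The active nodes at time `t`, when the seed set is `S` and the triggering sets are `T`. -/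
def active (T : V → Finset V) (S : Finset V) : ℕ → Finset V
  | 0 => S
  | t + 1 => active T S t ∪ Finset.univ.filter fun v => ∃ u ∈ T v, u ∈ active T S t

open Classical in
/-- The nodes that are activated at some time. -/
def finalActive (T : V → Finset V) (S : Finset V) : Finset V :=
  Finset.univ.filter fun v => ∃ t, v ∈ active T S t

/-- The influence spread `σ(S)`. -/
def spread (S : Finset V) : ℝ :=
  ∑ T : V → Finset V, (M.profile T).toReal * ((finalActive T S).card : ℝ)

open Classical in
/-- The nodes that reach `v` in the live-edge graph with the edges `(w, u)`, `w ∈ T u`. -/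
def rrSet (T : V → Finset V) (v : V) : Finset V :=
  Finset.univ.filter fun u => Relation.ReflTransGen (fun a b => a ∈ T b) u v

/-- The `j`-th moment `𝔼 |R| ^ j` of the size of an RR set whose root is uniformly random. -/
def rrMoment (j : ℕ) : ℝ :=
  ∑ v : V, (1 / (Fintype.card V : ℝ)) *
    ∑ T : V → Finset V, (M.profile T).toReal * ((rrSet T v).card : ℝ) ^ j

end TriggeringModel

/-! ### Continuous influence maximization with budget saving -/

/-- Strategy mixes, with the Euclidean norm. -/
abbrev Mix (d : ℕ) : Type := EuclideanSpace ℝ (Fin d)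

/-- The region `∏ i, [0, u i]`; it is the nonnegative orthant if every `u i` is `∞`. -/
def box {d : ℕ} (u : Fin d → ℝ≥0∞) : Set (Mix d) :=
  {x | ∀ i, 0 ≤ x i ∧ ENNReal.ofReal (x i) ≤ u i}

/-- Monotonicity on `X` for the coordinatewise order. -/
def MonotoneOnMix {d : ℕ} (f : Mix d → ℝ) (X : Set (Mix d)) : Prop :=
  ∀ x ∈ X, ∀ y ∈ X, (∀ i, x i ≤ y i) → f x ≤ f y

/-- DR-submodularity on `X`. -/
def DRSubmodularOn {d : ℕ} (f : Mix d → ℝ) (X : Set (Mix d)) : Prop :=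
  ∀ x ∈ X, ∀ y ∈ X, (∀ i, x i ≤ y i) → ∀ (i : Fin d) (δ : ℝ), 0 < δ →
    x + EuclideanSpace.single i δ ∈ X → y + EuclideanSpace.single i δ ∈ X →
    f (y + EuclideanSpace.single i δ) - f y ≤ f (x + EuclideanSpace.single i δ) - f x

/-- `f` is `L`-Lipschitz on `X` for the Euclidean norm. -/
def LipschitzOnMix {d : ℕ} (L : ℝ) (f : Mix d → ℝ) (X : Set (Mix d)) : Prop :=
  ∀ x ∈ X, ∀ y ∈ X, |f x - f y| ≤ L * ‖x - y‖

/-- The data of a CIM-BS problem and of a run of the algorithm on it. -/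
structure Problem (V : Type) (d : ℕ) extends TriggeringModel V where
  /-- upper ends of the region on which the strategy activation functions live -/
  u : Fin d → ℝ≥0∞
  /-- the domain `𝒟` of strategy mixes -/
  dom : Set (Mix d)
  /-- the strategy activation functions and their gradients -/
  h : V → Mix d → ℝ
  gradh : V → Mix d → Mix d
  /-- cost function, budget, balance parameter -/
  c : Mix d → ℝ
  k : ℝ
  lam : ℝ
  /-- Lipschitz and smoothness constants of `h`, Lipschitz constant of `c` -/
  Lh : ℝ
  βh : ℝ
  Lc : ℝ
  /-- approximation and confidence parameter -/
  ε : ℝ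
  ℓ : ℝ
  /-- an upper bound of the diameter of the feasible set -/
  Δ : ℝ
  /-- the starting point of the proximal gradient iteration -/
  x₀ : Mix d
  /-- `prox η z` is the proximal step with step size `η` at `z` -/
  prox : ℝ → Mix d → Mix d
  /-- time to sample a triggering set of `v` -/
  timeTrig : V → ℕ
  /-- time to compute `h v x` and `gradh v x` -/
  timeH : V → Mix d → ℕ
  /-- time to compute `c x` (and a gradient of `c`) at `x` -/
  timeC : Mix d → ℕ
  /-- time of the proximal step -/
  timeProx : ℝ → Mix d → ℕ

namespace Problem

variable {V : Type} [Fintype V] [DecidableEq V] {d : ℕ} (I : Problem V d)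

/-- The number of nodes, as a real number. -/
def n (_ : Problem V d) : ℝ := (Fintype.card V : ℝ)

/-- The feasible set `𝒫`. -/
def feasible : Set (Mix d) := {x | x ∈ I.dom ∧ I.c x ≤ I.k}

/-- The influence spread `g` of a strategy mix. -/
def g (x : Mix d) : ℝ :=
  ∑ S : Finset V, I.spread S * ((∏ u ∈ S, I.h u x) * ∏ v ∈ Sᶜ, (1 - I.h v x))

/-- The budget saving `s`. -/
def s (x : Mix d) : ℝ := I.lam * (I.k - I.c x)

/-- The optimal value of `g + s` on the feasible set. -/
def OPT : ℝ := sSup ((fun x => I.g x + I.s x) '' I.feasible)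

/-- The covering number of the feasible set: the least number of closed balls of radius `r`,
with arbitrary centres, that cover it. -/
def covering (r : ℝ) : ℝ :=
  ((Metric.externalCoveringNumber r.toNNReal I.feasible).toNat : ℝ)

/-! #### Generating RR sets

The profile of all triggering sets serves as the random tape. The reverse search reads the
triggering set of a node when it visits the node, and pays for sampling it then; the triggering
sets that it never reads are never paid for. -/

/-- Mark and push the nodes of a list that are not yet marked. `stack` holds the nodes that are
reached but not yet expanded, `seen` all the nodes reached so far. -/
def expand : List V → List V → List V → Timed (List V × List V)
  | [], stack, seen => pure (stack, seen)
  | w :: ws, stack, seen => do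
    tick 1
    if w ∈ seen then expand ws stack seen
    else do
      tick 3
      expand ws (w :: stack) (w :: seen)

/-- Reverse search. The first argument bounds the number of expanded nodes. -/
def search (T : V → Finset V) : ℕ → List V → List V → Timed (List V)
  | 0, _, seen => pure seen
  | _ + 1, [], seen => pure seen
  | fuel + 1, v :: stack, seen => do
    tick (I.timeTrig v + 1)
    let r ← expand (T v).toList stack seen
    search T fuel r.1 r.2

/-- Generate one RR set, listed without repetition. -/
def genRR [Nonempty V] : Prog (List V) :=
  (PMF.uniformOfFintype V).bind fun v => I.profile.map fun T =>
    ((I.search T (Fintype.card V) [v] [v]).val,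
      (I.search T (Fintype.card V) [v] [v]).time + 4)

/-- Generate `θ` independent RR sets. -/
def genRRs [Nonempty V] : ℕ → Prog (List (List V))
  | 0 => pure []
  | θ + 1 => do
    let R ← I.genRR
    let Rs ← genRRs θ
    Prog.ofTimed (tick 1)
    pure (R :: Rs)

/-! #### The gradient algorithm

Let `ĝ_Rs (x) = n / θ * ∑ R ∈ Rs, (1 - ∏ v ∈ R, (1 - h_v (x)))`, where `θ` is the length of `Rs`.
One step pays for an arithmetic operation on real numbers; an operation on vectors pays for every
coordinate it touches. -/

/-- The number of nonzero coordinates of the gradient of `h v` at `x`. -/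
def gradSize (v : V) (x : Mix d) : ℕ := (Finset.univ.filter fun i => I.gradh v x i ≠ 0).card

/-- The contribution of one RR set: the value is `∏ v ∈ R, (1 - h_v (x))`, and `acc` is increased
by `pre * ∑ v' ∈ R, (∏ v ∈ R \ {v'}, (1 - h_v (x))) • ∇ h_v' (x)`. -/
def rrTerm (x : Mix d) : List V → ℝ → Mix d → Timed (ℝ × Mix d)
  | [], _, acc => pure (1, acc)
  | v :: vs, pre, acc => do
    tick (I.timeH v x + 2 * I.gradSize v x + 5)
    let q := 1 - I.h v x
    let r ← rrTerm x vs (pre * q) acc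
    pure (q * r.1, r.2 + (pre * r.1) • I.gradh v x)

/-- The sum of `1 - ∏ v ∈ R, (1 - h_v (x))` over the RR sets, and `acc` plus its gradient. -/
def sumTerms (x : Mix d) : List (List V) → Mix d → Timed (ℝ × Mix d)
  | [], acc => pure (0, acc)
  | R :: Rs, acc => do
    let r ← I.rrTerm x R 1 acc
    let t ← sumTerms x Rs r.2
    tick 3
    pure (t.1 + (1 - r.1), t.2)

/-- The value of `ĝ_Rs + s` and the gradient of `ĝ_Rs` at `x`. -/
def evalObj (Rs : List (List V)) (x : Mix d) : Timed (ℝ × Mix d) := do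
  tick d
  let t ← I.sumTerms x Rs 0
  tick (I.timeC x + d + 6)
  pure (I.n / Rs.length * t.1 + I.lam * (I.k - I.c x), (I.n / Rs.length) • t.2)

/-- The sums of the sizes and of the squared sizes of the RR sets. -/
def sizes : List (List V) → Timed (ℝ × ℝ)
  | [] => pure (0, 0)
  | R :: Rs => do
    tick (R.length + 4)
    let t ← sizes Rs
    pure (t.1 + R.length, t.2 + (R.length : ℝ) ^ 2)

/-- Proximal gradient iteration with step size `η` from the point `x`, at which the gradient of
`ĝ_Rs` is `v`; `best` is the best point so far with its value. -/
def iterate (η : ℝ) (Rs : List (List V)) : ℕ → Mix d → Mix d → Mix d × ℝ → Timed (Mix d × ℝ)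
  | 0, _, _, best => pure best
  | t + 1, x, v, best => do
    tick (2 * d)
    tick (I.timeProx η (x + η • v))
    let y := I.prox η (x + η • v)
    let w ← I.evalObj Rs y
    tick (d + 2)
    iterate η Rs t y w.2 (if best.2 < w.1 then (y, w.1) else best)

/-- The smoothness constant `ν¹(Rs) n β_h + ν²(Rs) n L_h²` of `ĝ_Rs`, where `ν¹(Rs)` and `ν²(Rs)`
are the averages of the sizes and of the squared sizes of the RR sets. -/
def smoothness (Rs : List (List V)) : ℝ :=
  (sizes Rs).val.1 / Rs.length * I.n * I.βh + (sizes Rs).val.2 / Rs.length * I.n * I.Lh ^ 2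

/-- The proximal gradient algorithm for `ĝ_Rs + s` with additive error `err`. It returns the best
of its iterates with the value of `ĝ_Rs + s` there. -/
def proxGrad (Rs : List (List V)) (err : ℝ) : Timed (Mix d × ℝ) := do
  let _ ← sizes Rs
  tick 20
  let w ← I.evalObj Rs I.x₀
  tick d
  I.iterate (1 / I.smoothness Rs) Rs ⌈3 * I.smoothness Rs * I.Δ ^ 2 / (4 * err)⌉₊
    I.x₀ w.2 (I.x₀, w.1)

/-! #### ProxGrad-RIS with resampling -/

/-- The common Lipschitz constant `L₁ = L₂` of `g + s` and `ĝ + s`. -/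
def L : ℝ := I.n ^ 2 * I.Lh + I.lam * I.Lc

/-- `ε' = √2 ε / 3` -/
def ε' : ℝ := Real.sqrt 2 * I.ε / 3

/-- The number of rounds of the sampling procedure. -/
def numRounds : ℕ := ⌊Real.logb 2 (I.n + I.lam * I.k) - 1⌋₊

/-- The guess `x_i` of round `i`. -/
def guess (i : ℕ) : ℝ := (I.n + I.lam * I.k) / 2 ^ i

/-- The number `θ_i` of RR sets of round `i`. -/
def theta (i : ℕ) : ℕ :=
  ⌈I.n * (2 + 2 / 3 * I.ε') *
    (Real.log (I.covering (I.ε / 3 / I.L * I.guess i)) + I.ℓ * Real.log I.n + Real.log 2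
      + Real.log (Real.logb 2 (I.n + I.lam * I.k))) / (I.ε' ^ 2 * I.guess i)⌉₊

/-- `θ⁽¹⁾`, with the approximation ratio `α = 1 / 2` -/
def theta1 (LB : ℝ) : ℝ :=
  8 * I.n * Real.log (4 * I.n ^ I.ℓ) / (LB * ((1 / 2 - I.ε / 3) ^ 2 * I.ε ^ 2 / 9))

/-- `θ⁽²⁾`, with `α = 1 / 2` and `α' = α - ε / 3` -/
def theta2 (LB : ℝ) : ℝ :=
  2 * (1 / 2 - I.ε / 3) * I.n *
      Real.log (4 * I.n ^ I.ℓ * I.covering (I.ε / 3 / (I.L + I.L) * LB)) /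
    ((I.ε / 3 - 1 / 4 * (1 / 2 - I.ε / 3) ^ 2 * (I.ε / 3)) ^ 2 * LB)

/-- The rounds `i, i + 1, …, i + j - 1` of the sampling procedure, each with newly sampled RR sets.
The result is the lower bound `LB`, which is `1` if no round breaks the loop. -/
def rounds [Nonempty V] : ℕ → ℕ → Prog ℝ
  | 0, _ => pure 1
  | j + 1, i => do
    Prog.ofTimed (tick 30)
    let Rs ← I.genRRs (I.theta i)
    let y ← Prog.ofTimed (I.proxGrad Rs (I.ε * I.guess i / 3))
    if (1 + I.ε' + I.ε / 3) * I.guess i ≤ y.2 then pure (y.2 / (1 + I.ε' + I.ε / 3))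
    else rounds j (i + 1)

/-- ProxGrad-RIS, where every round of the sampling procedure samples all its RR sets anew. -/
def proxGradRIS [Nonempty V] : Prog (Mix d) := do
  let LB ← I.rounds I.numRounds 1
  Prog.ofTimed (tick 40)
  let Rs ← I.genRRs ⌈max (I.theta1 LB) (I.theta2 LB)⌉₊
  let y ← Prog.ofTimed (I.proxGrad Rs (I.ε * LB))
  pure y.1

/-! #### The assumptions and the bound -/

/-- The standing assumptions on the data. `Th`, `Tc`, `Tprox` bound the times of the oracles, and
`κ` is the constant of proportionality in the time for sampling a triggering set. -/
structure Assumptions (κ : ℝ) (Th Tc Tprox : ℕ) : Prop where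
  two_le_n : 2 ≤ I.n
  -- the domain, the cost function, the budget and the balance parameter
  dom_subset : I.dom ⊆ box I.u
  c_convex : ConvexOn ℝ I.dom I.c
  c_nonneg : ∀ x ∈ I.dom, 0 ≤ I.c x
  c_lipschitz : LipschitzOnMix I.Lc I.c I.dom
  Lc_nonneg : 0 ≤ I.Lc
  lam_nonneg : 0 ≤ I.lam
  lam_mul_k_le : I.lam * I.k ≤ I.n
  n_add_le : I.n + I.lam * I.k ≤ I.n ^ I.ℓ
  -- the strategy activation functions
  h_mem : ∀ v, ∀ x ∈ box I.u, I.h v x ∈ Set.Icc (0 : ℝ) 1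
  h_mono : ∀ v, MonotoneOnMix (I.h v) (box I.u)
  h_dr : ∀ v, DRSubmodularOn (I.h v) (box I.u)
  h_lipschitz : ∀ v, LipschitzOnMix I.Lh (I.h v) I.dom
  h_grad : ∀ v, ∀ x ∈ I.dom, HasGradientWithinAt (I.h v) (I.gradh v x) (box I.u) x
  h_smooth : ∀ v, ∀ x ∈ I.dom, ∀ y ∈ I.dom, ‖I.gradh v x - I.gradh v y‖ ≤ I.βh * ‖x - y‖
  Lh_pos : 0 < I.Lh
  βh_nonneg : 0 ≤ I.βh
  -- the parameters of the algorithm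
  ε_pos : 0 < I.ε
  ε_lt : I.ε < 1 / 2
  Δ_pos : 0 < I.Δ
  dist_le : ∀ x ∈ I.feasible, ∀ y ∈ I.feasible, ‖x - y‖ ≤ I.Δ
  x₀_mem : I.x₀ ∈ I.feasible
  -- the proximal step is an exact minimizer over the feasible set
  prox_mem : ∀ η > 0, ∀ z, I.prox η z ∈ I.feasible
  prox_min : ∀ η > 0, ∀ z, ∀ y ∈ I.feasible,
    -η * I.s (I.prox η z) + 1 / 2 * ‖z - I.prox η z‖ ^ 2 ≤ -η * I.s y + 1 / 2 * ‖z - y‖ ^ 2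
  -- the optimum is attained, and it is not below the influence spread of a single node
  opt_attained : ∃ x ∈ I.feasible, ∀ y ∈ I.feasible, I.g y + I.s y ≤ I.g x + I.s x
  spread_le : ∀ v, ∃ x ∈ I.feasible, I.spread {v} ≤ I.g x
  -- the times of the oracles
  timeTrig_le : ∀ v, (I.timeTrig v : ℝ) ≤ κ * I.inDegree v
  timeH_le : ∀ v x, I.timeH v x ≤ Th
  timeC_le : ∀ x, I.timeC x ≤ Tc
  timeProx_le : ∀ η z, I.timeProx η z ≤ Tprox
  -- an oracle needs a step for every coordinate that it writes
  gradSize_le : ∀ v x, I.gradSize v x ≤ I.timeH v x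
  dim_le : ∀ η z, d ≤ I.timeProx η z

/-- The bound on the expected running time, with the radius `r` in the covering number. -/
def timeBound (Th Tc Tprox : ℕ) (r : ℝ) : ℝ :=
  I.n ^ 2 * (I.rrMoment 2 * I.βh + I.rrMoment 3 * I.Lh ^ 2)
      * Real.log (I.n ^ I.ℓ * I.covering r) / (I.ε ^ 3 * I.OPT) * (1 + Th)
    + (I.rrMoment 1 * I.n * I.βh + I.rrMoment 2 * I.n * I.Lh ^ 2) / I.ε
      * Real.logb 2 (I.n + I.lam * I.k) * (Tc + Tprox)
    + ((I.numEdges : ℝ) + I.n) * Real.log (I.n ^ I.ℓ * I.covering r) / I.ε ^ 2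

end Problem

end CIMBS

end

/-!
By the Chernoff bound for the estimate of `g` at the optimum, a round whose guess `x_i` is at most
`OPT / 6` fails to leave the loop with probability at most `1 / 8`. A round with the guess `x` costs
at most `A / x ^ 2 + B / x`: it needs `θ = O(n ln(n ^ ℓ 𝒩) / (ε ^ 2 x))` RR sets, and the expected
product of the number of gradient steps, which grows with the averages of `|R|` and `|R| ^ 2`, and
of the time of a step, which grows with the sum of the `|R|`, is controlled by Chebyshev's sum
inequality `ν^(1) ν^(j) ≤ ν^(j+1)`. Halving `x` multiplies this cost by at most `4`, so the expected
cost decreases geometrically after the guess `OPT / 6`, while it increases geometrically before, and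
the whole run costs a constant times a phase at the scale `OPT`. For the radius in (b), a ball of
radius `3 r` in dimension `d` is covered by a number of balls of radius `r` that depends only on
`d`, and this changes `ln(n ^ ℓ 𝒩)` by a constant factor because `n ^ ℓ ≥ 2`.
-/

noncomputable section

namespace CIMBS

/-! ### Expectations of randomized programs -/

@[simp] theorem Timed.val_pure {α : Type} (a : α) : (pure a : Timed α).val = a := rfl

@[simp] theorem Timed.time_pure {α : Type} (a : α) : (pure a : Timed α).time = 0 := rfl

@[simp] theorem Timed.val_bind {α β : Type} (x : Timed α) (f : α → Timed β) :
    (x >>= f).val = (f x.val).val := rfl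

@[simp] theorem Timed.time_bind {α β : Type} (x : Timed α) (f : α → Timed β) :
    (x >>= f).time = x.time + (f x.val).time := rfl

@[simp] theorem time_tick (n : ℕ) : (tick n).time = n := rfl

/-- The expectation of a function with values in `[0, ∞]` under a probability mass function. -/
def pmfMean {β : Type*} (p : PMF β) (f : β → ℝ≥0∞) : ℝ≥0∞ := ∑' x, p x * f x

section pmfMean

variable {β γ : Type*}

theorem pmfMean_pure (a : β) (f : β → ℝ≥0∞) : pmfMean (PMF.pure a) f = f a := by
  unfold pmfMean
  rw [tsum_eq_single a fun b hb => by simp [hb]]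
  simp

theorem pmfMean_bind (p : PMF β) (q : β → PMF γ) (f : γ → ℝ≥0∞) :
    pmfMean (p.bind q) f = pmfMean p fun x => pmfMean (q x) f := by
  unfold pmfMean
  simp_rw [PMF.bind_apply, ← ENNReal.tsum_mul_right, ← ENNReal.tsum_mul_left]
  rw [ENNReal.tsum_comm]
  simp_rw [mul_assoc]

theorem pmfMean_map (p : PMF β) (q : β → γ) (f : γ → ℝ≥0∞) :
    pmfMean (p.map q) f = pmfMean p fun x => f (q x) := by
  rw [PMF.map, pmfMean_bind]
  simp only [Function.comp_apply, pmfMean_pure]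

theorem pmfMean_mono (p : PMF β) {f g : β → ℝ≥0∞} (h : ∀ x, f x ≤ g x) :
    pmfMean p f ≤ pmfMean p g :=
  ENNReal.tsum_le_tsum fun x => by gcongr; exact h x

theorem pmfMean_add (p : PMF β) (f g : β → ℝ≥0∞) :
    (pmfMean p fun x => f x + g x) = pmfMean p f + pmfMean p g := by
  unfold pmfMean
  simp_rw [mul_add]
  exact ENNReal.tsum_add

theorem pmfMean_const_mul (p : PMF β) (c : ℝ≥0∞) (f : β → ℝ≥0∞) :
    (pmfMean p fun x => c * f x) = c * pmfMean p f := by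
  unfold pmfMean
  simp_rw [mul_left_comm _ c]
  exact ENNReal.tsum_mul_left

theorem pmfMean_const (p : PMF β) (c : ℝ≥0∞) : (pmfMean p fun _ => c) = c := by
  unfold pmfMean
  rw [ENNReal.tsum_mul_right, PMF.tsum_coe, one_mul]

end pmfMean

namespace Prog

variable {α β : Type}

/-- The expectation of a function of the result and of the number of steps of a program. -/
def mean (p : Prog α) (F : α → ℕ → ℝ≥0∞) : ℝ≥0∞ :=
  pmfMean (β := α × ℕ) p fun x => F x.1 x.2

theorem expTime_eq_mean (p : Prog α) : p.expTime = p.mean fun _ t => (t : ℝ≥0∞) := rfl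

theorem mean_pure (a : α) (F : α → ℕ → ℝ≥0∞) : (pure a : Prog α).mean F = F a 0 :=
  pmfMean_pure (a, 0) _

theorem mean_ofTimed (t : Timed α) (F : α → ℕ → ℝ≥0∞) :
    (ofTimed t).mean F = F t.val t.time := pmfMean_pure (t.val, t.time) _

theorem mean_bind (p : Prog α) (f : α → Prog β) (F : β → ℕ → ℝ≥0∞) :
    (p >>= f).mean F = p.mean fun a s => (f a).mean fun b t => F b (s + t) := by
  refine (pmfMean_bind (β := α × ℕ) p _ _).trans ?_
  refine congrArg (pmfMean (β := α × ℕ) p) (funext fun x => ?_)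
  exact pmfMean_map (β := β × ℕ) (f x.1) _ _

theorem mean_mono (p : Prog α) {F G : α → ℕ → ℝ≥0∞} (h : ∀ a t, F a t ≤ G a t) :
    p.mean F ≤ p.mean G := pmfMean_mono _ fun x => h x.1 x.2

theorem mean_add (p : Prog α) (F G : α → ℕ → ℝ≥0∞) :
    (p.mean fun a t => F a t + G a t) = p.mean F + p.mean G := pmfMean_add _ _ _

theorem mean_const_mul (p : Prog α) (c : ℝ≥0∞) (F : α → ℕ → ℝ≥0∞) :
    (p.mean fun a t => c * F a t) = c * p.mean F := pmfMean_const_mul _ _ _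

theorem mean_const (p : Prog α) (c : ℝ≥0∞) : (p.mean fun _ _ => c) = c := pmfMean_const _ _

end Prog

/-! ### Reachability in the triggering model -/

/-- The probability that exactly the nodes of `S` become seeds, if each node `v` independently
becomes a seed with probability `p v`. -/
def seedProb {V R : Type*} [Fintype V] [DecidableEq V] [CommRing R] (p : V → R)
    (S : Finset V) : R :=
  (∏ u ∈ S, p u) * ∏ v ∈ Sᶜ, (1 - p v)

section seedProb

variable {V R : Type*} [Fintype V] [DecidableEq V] [CommRing R] (p : V → R)

theorem sum_seedProb : ∑ S, seedProb p S = 1 := by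
  simp [seedProb, ← Fintype.prod_add]

theorem sum_seedProb_disjoint (A : Finset V) :
    ∑ S with Disjoint S A, seedProb p S = ∏ v ∈ A, (1 - p v) := by
  calc ∑ S with Disjoint S A, seedProb p S
      = ∑ S, (∏ u ∈ S, if u ∈ A then 0 else p u) * ∏ v ∈ Sᶜ, (1 - p v) := by
        rw [Finset.sum_filter]
        refine Finset.sum_congr rfl fun S _ => ?_
        split_ifs with hSA
        · rw [seedProb, Finset.prod_congr rfl fun u hu =>
            (if_neg (Finset.disjoint_left.1 hSA hu)).symm]
        · obtain ⟨u, huS, huA⟩ := Finset.not_disjoint_iff.1 hSA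
          rw [Finset.prod_eq_zero huS (by rw [if_pos huA]), zero_mul]
    _ = ∏ v, if v ∈ A then 1 - p v else 1 := by
        rw [← Fintype.prod_add]
        exact Finset.prod_congr rfl fun v _ => by split_ifs <;> ring
    _ = ∏ v ∈ A, (1 - p v) := by rw [Finset.prod_ite_mem, Finset.univ_inter]

theorem sum_seedProb_not_disjoint (A : Finset V) :
    ∑ S with ¬ Disjoint S A, seedProb p S = 1 - ∏ v ∈ A, (1 - p v) := by
  rw [eq_sub_iff_add_eq', ← sum_seedProb_disjoint, Finset.sum_filter_add_sum_filter_not,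
    sum_seedProb]

end seedProb

namespace TriggeringModel

variable {V : Type} [Fintype V]

theorem mem_rrSet {T : V → Finset V} {u v : V} :
    u ∈ rrSet T v ↔ Relation.ReflTransGen (fun a b => a ∈ T b) u v := by
  simp [rrSet]

theorem self_mem_rrSet (T : V → Finset V) (v : V) : v ∈ rrSet T v :=
  mem_rrSet.2 .refl

variable [DecidableEq V]

theorem mem_finalActive_iff {T : V → Finset V} {S : Finset V} {v : V} :
    v ∈ finalActive T S ↔ ¬ Disjoint S (rrSet T v) := by
  simp only [finalActive, Finset.mem_filter, Finset.mem_univ, true_and, Finset.not_disjoint_iff,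
    mem_rrSet]
  constructor
  · rintro ⟨t, ht⟩
    induction t generalizing v with
    | zero => exact ⟨v, ht, .refl⟩
    | succ t ih =>
      rw [active, Finset.mem_union, Finset.mem_filter] at ht
      rcases ht with ht | ⟨_, w, hw, hwt⟩
      · exact ih ht
      · obtain ⟨u, hu, huw⟩ := ih hwt
        exact ⟨u, hu, huw.tail hw⟩
  · rintro ⟨u, hu, huv⟩
    induction huv with
    | refl => exact ⟨0, hu⟩
    | tail _ hbc ih =>
      obtain ⟨t, ht⟩ := ih
      refine ⟨t + 1, ?_⟩
      rw [active, Finset.mem_union, Finset.mem_filter]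
      exact .inr ⟨Finset.mem_univ _, _, hbc, ht⟩

variable (M : TriggeringModel V)

theorem card_le_inDegree {T : V → Finset V} (hT : T ∈ M.profile.support) (v : V) :
    (T v).card ≤ M.inDegree v := by
  refine Finset.card_le_card fun u hu => ?_
  have hTv : T v ∈ (M.D v).support := by
    rw [PMF.mem_support_iff] at hT ⊢
    exact fun h₀ => hT (Finset.prod_eq_zero (Finset.mem_univ v) h₀)
  simpa using M.D_subset v (T v) hTv u hu

theorem sum_profile : ∑ T : V → Finset V, (M.profile T).toReal = 1 := by
  rw [← ENNReal.toReal_sum (fun T _ => M.profile.apply_ne_top T),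
    ← tsum_fintype (L := .unconditional _), PMF.tsum_coe, ENNReal.toReal_one]

theorem one_le_spread_singleton (v : V) : 1 ≤ M.spread {v} := by
  unfold spread
  rw [← M.sum_profile]
  refine Finset.sum_le_sum fun T _ => le_mul_of_one_le_right ENNReal.toReal_nonneg ?_
  have hv : v ∈ finalActive T {v} := mem_finalActive_iff.2 (by simp [self_mem_rrSet])
  exact_mod_cast Finset.card_pos.2 ⟨v, hv⟩

/-- The mean of `f T v` for a uniformly random root `v` and a random profile `T` of triggering
sets. -/
def rootMean (f : (V → Finset V) → V → ℝ) : ℝ :=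
  ∑ v : V, (1 / (Fintype.card V : ℝ)) * ∑ T : V → Finset V, (M.profile T).toReal * f T v

theorem rrMoment_eq_rootMean (j : ℕ) :
    M.rrMoment j = M.rootMean fun T v => ((rrSet T v).card : ℝ) ^ j :=
  rfl

theorem rootMean_mono {f f' : (V → Finset V) → V → ℝ} (h : ∀ T v, f T v ≤ f' T v) :
    M.rootMean f ≤ M.rootMean f' := by
  unfold rootMean
  gcongr with v _ T _
  exact h T v

theorem rootMean_add (f f' : (V → Finset V) → V → ℝ) :
    M.rootMean (fun T v => f T v + f' T v) = M.rootMean f + M.rootMean f' := by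
  simp only [rootMean, mul_add, Finset.sum_add_distrib]

theorem rootMean_const_mul (a : ℝ) (f : (V → Finset V) → V → ℝ) :
    M.rootMean (fun T v => a * f T v) = a * M.rootMean f := by
  simp only [rootMean, Finset.mul_sum]
  exact Finset.sum_congr rfl fun v _ => Finset.sum_congr rfl fun T _ => by ring

theorem rootMean_sum {ι : Type*} (s : Finset ι) (f : ι → (V → Finset V) → V → ℝ) :
    M.rootMean (fun T v => ∑ i ∈ s, f i T v) = ∑ i ∈ s, M.rootMean (f i) := by
  simp only [rootMean, Finset.mul_sum]
  exact (Finset.sum_congr rfl fun v _ => Finset.sum_comm).trans Finset.sum_comm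

variable [Nonempty V]

theorem rootMean_const (a : ℝ) : M.rootMean (fun _ _ => a) = a := by
  simp [rootMean, ← Finset.sum_mul, M.sum_profile]

theorem spread_eq_rootMean (S : Finset V) :
    M.spread S = Fintype.card V *
      M.rootMean fun T v => if Disjoint S (rrSet T v) then 0 else 1 := by
  have hcard : (Fintype.card V : ℝ) ≠ 0 := by exact_mod_cast Fintype.card_ne_zero
  unfold spread rootMean
  rw [← Finset.mul_sum, ← mul_assoc, mul_one_div_cancel hcard, one_mul, Finset.sum_comm]
  refine Finset.sum_congr rfl fun T _ => ?_
  simp_rw [← Finset.mul_sum, ← ite_not (p := Disjoint _ _), ← mem_finalActive_iff]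
  rw [Finset.sum_boole, Finset.filter_univ_mem]

theorem rootMean_sum_rrSet (w : V → ℝ) :
    M.rootMean (fun T v => ∑ u ∈ rrSet T v, w u) =
      ∑ u, w u * (M.spread {u} / Fintype.card V) := by
  calc M.rootMean (fun T v => ∑ u ∈ rrSet T v, w u)
      = M.rootMean fun T v => ∑ u, w u * if Disjoint {u} (rrSet T v) then 0 else 1 := by
        simp only [Finset.disjoint_singleton_left, ite_not, mul_ite, mul_one, mul_zero,
          Finset.sum_ite_mem, Finset.univ_inter]
    _ = ∑ u, w u * (M.spread {u} / Fintype.card V) := by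
        simp only [rootMean_sum, rootMean_const_mul]
        refine Finset.sum_congr rfl fun u _ => ?_
        rw [spread_eq_rootMean, mul_div_cancel_left₀ _ (by exact_mod_cast Fintype.card_ne_zero)]

end TriggeringModel

namespace Problem

open TriggeringModel

section ReverseSearch

variable {V : Type}

theorem expand_val [DecidableEq V] {ws : List V} (hws : ws.Nodup) (stack seen : List V) :
    (expand ws stack seen).val =
      ((ws.filter (· ∉ seen)).reverse ++ stack, (ws.filter (· ∉ seen)).reverse ++ seen) := by
  induction ws generalizing stack seen with
  | nil => rfl
  | cons a ws ih =>
    rw [List.nodup_cons] at hws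
    by_cases ha : a ∈ seen
    · simp [expand, ha, ih hws.2]
    · have hfilter : ws.filter (· ∉ a :: seen) = ws.filter (· ∉ seen) :=
        List.filter_congr fun w hw => by
          simp [ne_of_mem_of_not_mem hw hws.1]
      have ih' := ih hws.2 (a :: stack) (a :: seen)
      rw [hfilter] at ih'
      simp [expand, ha, ih']

theorem expand_time_le [DecidableEq V] (ws stack seen : List V) :
    (expand ws stack seen).time ≤ 4 * ws.length := by
  induction ws generalizing stack seen with
  | nil => simp [expand]
  | cons a ws ih =>
    by_cases ha : a ∈ seen
    · have := ih stack seen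
      simp [expand, ha]
      lia
    · have := ih (a :: stack) (a :: seen)
      simp [expand, ha]
      lia

variable [Fintype V]

/-- The invariant of a reverse search from `root`: every reached node that is no longer on the
stack has all its triggering nodes among the reached ones. -/
structure SearchInvariant (T : V → Finset V) (root : V) (stack seen : List V) : Prop where
  seen_nodup : seen.Nodup
  stack_subset : stack ⊆ seen
  root_mem : root ∈ seen
  seen_reach : ∀ w ∈ seen, w ∈ rrSet T root
  closed : ∀ w ∈ seen, w ∉ stack → ∀ u ∈ T w, u ∈ seen

variable {T : V → Finset V} {root : V} {stack seen : List V}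

theorem SearchInvariant.init (T : V → Finset V) (root : V) :
    SearchInvariant T root [root] [root] := by
  constructor <;> simp [self_mem_rrSet]

theorem SearchInvariant.eq_nil (h : SearchInvariant T root stack seen)
    (hfuel : Fintype.card V + stack.length ≤ seen.length) : stack = [] := by
  have := h.seen_nodup.length_le_card
  exact List.eq_nil_of_length_eq_zero (by lia)

variable [DecidableEq V]

theorem SearchInvariant.toFinset_eq_rrSet (h : SearchInvariant T root [] seen) :
    seen.toFinset = rrSet T root := by
  ext w
  rw [List.mem_toFinset]
  refine ⟨h.seen_reach w, fun hw => ?_⟩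
  rw [mem_rrSet] at hw
  induction hw using Relation.ReflTransGen.head_induction_on with
  | refl => exact h.root_mem
  | head hab _ ih => exact h.closed _ ih List.not_mem_nil _ hab

theorem SearchInvariant.expand {v : V} (h : SearchInvariant T root (v :: stack) seen) :
    SearchInvariant T root (((T v).toList.filter (· ∉ seen)).reverse ++ stack)
      (((T v).toList.filter (· ∉ seen)).reverse ++ seen) := by
  obtain ⟨hseen, hsub, hroot, hreach, hclosed⟩ := h
  rw [List.cons_subset] at hsub
  set new := ((T v).toList.filter (· ∉ seen)).reverse
  have mem_new (w : V) : w ∈ new ↔ w ∈ T v ∧ w ∉ seen := by simp [new]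
  have new_nodup : new.Nodup := List.nodup_reverse.2 ((T v).nodup_toList.filter _)
  have new_disjoint : new.Disjoint seen := fun w hw => ((mem_new w).1 hw).2
  refine ⟨new_nodup.append hseen new_disjoint, List.append_subset.2
      ⟨List.subset_append_left _ _, List.subset_append_of_subset_right _ hsub.2⟩,
    List.mem_append_right _ hroot, fun w hw => ?_, fun w hw hwst u hu => ?_⟩
  · rcases List.mem_append.1 hw with hw | hw
    · exact mem_rrSet.2 (.head ((mem_new w).1 hw).1 (mem_rrSet.1 (hreach v hsub.1)))
    · exact hreach w hw
  · simp only [List.mem_append, not_or, mem_new] at hw hwst ⊢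
    by_cases hus : u ∈ seen
    · exact .inr hus
    · have hw' : w ∈ seen := hw.resolve_left (by simpa using hwst.1)
      have hwv : w = v := by
        by_contra hwv
        exact hus (hclosed w hw' (by simp [hwv, hwst.2]) u hu)
      exact .inl ⟨hwv ▸ hu, hus⟩

variable {d : ℕ} (I : Problem V d)

/-- The number of steps that a reverse search spends on a node: sampling its triggering set and
marking the elements of that set. -/
def expandCost (T : V → Finset V) (w : V) : ℕ := I.timeTrig w + 1 + 4 * (T w).card

theorem search_spec (h : SearchInvariant T root stack seen) {fuel : ℕ}
    (hfuel : Fintype.card V + stack.length ≤ fuel + seen.length) :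
    SearchInvariant T root [] (I.search T fuel stack seen).val ∧
    (I.search T fuel stack seen).time + (seen.map (I.expandCost T)).sum ≤
      (stack.map (I.expandCost T)).sum +
        ((I.search T fuel stack seen).val.map (I.expandCost T)).sum := by
  induction fuel generalizing stack seen with
  | zero =>
    obtain rfl := h.eq_nil (by lia)
    simpa [search] using h
  | succ fuel ih =>
    cases stack with
    | nil => simpa [search] using h
    | cons v stack =>
      have hval := expand_val (T v).nodup_toList stack seen
      have htime := expand_time_le (T v).toList stack seen
      rw [Finset.length_toList] at htime
      set new := ((T v).toList.filter (· ∉ seen)).reverse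
      obtain ⟨ihval, ihtime⟩ := ih h.expand (by
        simp only [List.length_append, List.length_cons] at hfuel ⊢
        lia)
      simp only [List.map_append, List.sum_append, List.map_cons, List.sum_cons] at ihtime ⊢
      simp only [search, Timed.val_bind, Timed.time_bind, time_tick, hval]
      refine ⟨ihval, ?_⟩
      have hcost : I.expandCost T v = I.timeTrig v + 1 + 4 * (T v).card := rfl
      lia

theorem search_root_spec (T : V → Finset V) (v : V) :
    (I.search T (Fintype.card V) [v] [v]).val.Nodup ∧
    (I.search T (Fintype.card V) [v] [v]).val.toFinset = rrSet T v ∧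
    (I.search T (Fintype.card V) [v] [v]).time ≤ ∑ w ∈ rrSet T v, I.expandCost T w := by
  obtain ⟨hval, htime⟩ := I.search_spec (.init T v) (fuel := Fintype.card V) le_rfl
  refine ⟨hval.seen_nodup, hval.toFinset_eq_rrSet, ?_⟩
  rw [← hval.toFinset_eq_rrSet, List.sum_toFinset _ hval.seen_nodup]
  lia

theorem search_root_length (T : V → Finset V) (v : V) :
    (I.search T (Fintype.card V) [v] [v]).val.length = (rrSet T v).card := by
  obtain ⟨hnodup, heq, -⟩ := I.search_root_spec T v
  rw [← heq, List.toFinset_card_of_nodup hnodup]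

end ReverseSearch

/-! ### Samples of RR sets -/

variable {V : Type} [Fintype V] [DecidableEq V] [Nonempty V] {d : ℕ} (I : Problem V d)

theorem g_eq_rootMean (x : Mix d) :
    I.g x = I.n * I.rootMean fun T v => 1 - ∏ u ∈ rrSet T v, (1 - I.h u x) := by
  have hhit (T : V → Finset V) (v : V) : 1 - ∏ u ∈ rrSet T v, (1 - I.h u x) =
      ∑ S, seedProb (I.h · x) S * if Disjoint S (rrSet T v) then 0 else 1 := by
    rw [← sum_seedProb_not_disjoint, Finset.sum_filter]
    exact Finset.sum_congr rfl fun S _ => by simp only [ite_not, mul_ite, mul_zero, mul_one]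
  simp only [hhit, rootMean_sum, rootMean_const_mul, Finset.mul_sum]
  unfold g
  refine Finset.sum_congr rfl fun S _ => ?_
  rw [spread_eq_rootMean, seedProb, n]
  ring

theorem mean_genRR (F : List V → ℕ → ℝ≥0∞) :
    I.genRR.mean F = ∑ v : V, (Fintype.card V : ℝ≥0∞)⁻¹ * ∑ T : V → Finset V, I.profile T *
      F (I.search T (Fintype.card V) [v] [v]).val
        ((I.search T (Fintype.card V) [v] [v]).time + 4) := by
  unfold genRR Prog.mean
  rw [pmfMean_bind]
  simp only [pmfMean_map]
  simp [pmfMean, tsum_fintype]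

theorem mean_genRR_le {F : List V → ℕ → ℝ≥0∞} {f : (V → Finset V) → V → ℝ}
    (hf : ∀ T v, 0 ≤ f T v)
    (hF : ∀ T ∈ I.profile.support, ∀ v, F (I.search T (Fintype.card V) [v] [v]).val
        ((I.search T (Fintype.card V) [v] [v]).time + 4) ≤ ENNReal.ofReal (f T v)) :
    I.genRR.mean F ≤ ENNReal.ofReal (I.rootMean f) := by
  have hterm (v : V) (T : V → Finset V) : 0 ≤ (I.profile T).toReal * f T v :=
    mul_nonneg ENNReal.toReal_nonneg (hf T v)
  rw [mean_genRR, rootMean, ENNReal.ofReal_sum_of_nonneg fun v _ =>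
    mul_nonneg (by positivity) (Finset.sum_nonneg fun T _ => hterm v T)]
  refine Finset.sum_le_sum fun v _ => ?_
  rw [ENNReal.ofReal_mul (by positivity), one_div, ENNReal.ofReal_inv_of_pos
    (by exact_mod_cast Fintype.card_pos), ENNReal.ofReal_natCast,
    ENNReal.ofReal_sum_of_nonneg fun T _ => hterm v T]
  gcongr with T _
  rw [ENNReal.ofReal_mul ENNReal.toReal_nonneg, ENNReal.ofReal_toReal (PMF.apply_ne_top _ _)]
  by_cases hT : I.profile T = 0
  · simp [hT]
  · gcongr
    exact hF T (by simpa using hT) v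

theorem mean_genRR_length_pow_le (j : ℕ) :
    (I.genRR.mean fun R _ => (R.length : ℝ≥0∞) ^ j) ≤ ENNReal.ofReal (I.rrMoment j) := by
  rw [rrMoment_eq_rootMean]
  refine I.mean_genRR_le (fun T v => by positivity) fun T _ v => ?_
  rw [search_root_length, ENNReal.ofReal_pow (by positivity), ENNReal.ofReal_natCast]

variable {κ O : ℝ}

theorem rootMean_sum_inDegree_le (hκ : 0 ≤ κ) (hO : ∀ v, I.spread {v} ≤ O) :
    (I.rootMean fun T v => ∑ w ∈ rrSet T v, ((κ + 4) * I.inDegree w + 1)) ≤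
      (κ + 4) * (I.numEdges + I.n) / I.n * O := by
  have hn : 0 < I.n := Nat.cast_pos.2 Fintype.card_pos
  have hO1 : 1 ≤ O := (I.one_le_spread_singleton (Classical.arbitrary V)).trans (hO _)
  have hm : ∑ u, ((κ + 4) * (I.inDegree u : ℝ) + 1) = (κ + 4) * I.numEdges + I.n := by
    simp [Finset.sum_add_distrib, ← Finset.mul_sum, numEdges, n]
  rw [rootMean_sum_rrSet]
  calc ∑ u, ((κ + 4) * (I.inDegree u : ℝ) + 1) * (I.spread {u} / I.n)
      ≤ ∑ u, ((κ + 4) * (I.inDegree u : ℝ) + 1) * (O / I.n) := by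
        gcongr with u _
        exact hO u
    _ = ((κ + 4) * I.numEdges + 1 * I.n) * (O / I.n) := by rw [← Finset.sum_mul, hm, one_mul]
    _ ≤ ((κ + 4) * I.numEdges + (κ + 4) * I.n) * (O / I.n) := by
        gcongr
        linarith
    _ = (κ + 4) * (I.numEdges + I.n) / I.n * O := by ring

theorem mean_genRR_time_le (hκ : 0 ≤ κ) (hO : ∀ v, I.spread {v} ≤ O)
    (ht : ∀ v, (I.timeTrig v : ℝ) ≤ κ * I.inDegree v) :
    (I.genRR.mean fun _ t => (t : ℝ≥0∞)) ≤
      ENNReal.ofReal ((κ + 8) * (I.numEdges + I.n) / I.n * O) := by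
  have hn : 0 < I.n := Nat.cast_pos.2 Fintype.card_pos
  have hO1 : 1 ≤ O := (I.one_le_spread_singleton (Classical.arbitrary V)).trans (hO _)
  refine (I.mean_genRR_le (f := fun T v => ∑ w ∈ rrSet T v, ((κ + 4) * I.inDegree w + 1) + 4)
    (fun T v => by positivity) fun T hT v => ?_).trans (ENNReal.ofReal_le_ofReal ?_)
  · rw [← ENNReal.ofReal_natCast]
    refine ENNReal.ofReal_le_ofReal ?_
    push_cast
    gcongr
    refine (Nat.cast_le.2 (I.search_root_spec T v).2.2).trans ?_
    push_cast
    refine Finset.sum_le_sum fun w _ => ?_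
    have hcard : ((T w).card : ℝ) ≤ I.inDegree w := by exact_mod_cast I.card_le_inDegree hT w
    simp only [expandCost, Nat.cast_add, Nat.cast_mul, Nat.cast_one, Nat.cast_ofNat]
    linarith [ht w]
  · have hconst : (4 : ℝ) ≤ 4 * (I.numEdges + I.n) / I.n * O := by
      have hratio : 1 ≤ (I.numEdges + I.n) / I.n := by
        rw [one_le_div hn]
        linarith [I.numEdges.cast_nonneg (α := ℝ)]
      have := one_le_mul_of_one_le_of_one_le hratio hO1
      rw [mul_div_assoc, mul_assoc]
      linarith
    rw [rootMean_add, rootMean_const]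
    calc _ ≤ (κ + 4) * (I.numEdges + I.n) / I.n * O + 4 * (I.numEdges + I.n) / I.n * O :=
          add_le_add (I.rootMean_sum_inDegree_le hκ hO) hconst
      _ = _ := by ring

theorem mean_genRRs_succ (θ : ℕ) (F : List (List V) → ℕ → ℝ≥0∞) :
    (I.genRRs (θ + 1)).mean F =
      I.genRR.mean fun R s => (I.genRRs θ).mean fun Rs t => F (R :: Rs) (s + (t + 1)) := by
  rw [genRRs]
  simp [Prog.mean_bind, Prog.mean_ofTimed, Prog.mean_pure]

theorem mean_genRRs_mono (θ : ℕ) {F G : List (List V) → ℕ → ℝ≥0∞}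
    (h : ∀ Rs t, Rs.length = θ → (∀ R ∈ Rs, R ≠ []) → F Rs t ≤ G Rs t) :
    (I.genRRs θ).mean F ≤ (I.genRRs θ).mean G := by
  induction θ generalizing F G with
  | zero =>
    rw [genRRs, Prog.mean_pure, Prog.mean_pure]
    exact h _ _ rfl (by simp)
  | succ θ ih =>
    rw [mean_genRRs_succ, mean_genRRs_succ, mean_genRR, mean_genRR]
    gcongr with v _ T _
    refine ih fun Rs t hlen hne => h _ _ (by simp [hlen]) (List.forall_mem_cons.2 ⟨?_, hne⟩)
    rw [← List.length_pos_iff, search_root_length]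
    exact Finset.card_pos.2 ⟨v, self_mem_rrSet T v⟩

theorem mean_genRRs_time (θ : ℕ) :
    ((I.genRRs θ).mean fun _ t => (t : ℝ≥0∞)) = θ * ((I.genRR.mean fun _ t => (t : ℝ≥0∞)) + 1) := by
  induction θ with
  | zero => rw [genRRs, Prog.mean_pure]; simp
  | succ θ ih =>
    rw [mean_genRRs_succ]
    push_cast
    simp only [Prog.mean_add, Prog.mean_const, ih]
    ring

theorem mean_genRRs_sum (θ : ℕ) (f : List V → ℝ≥0∞) :
    ((I.genRRs θ).mean fun Rs _ => (Rs.map f).sum) = θ * I.genRR.mean fun R _ => f R := by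
  induction θ with
  | zero => rw [genRRs, Prog.mean_pure]; simp
  | succ θ ih =>
    rw [mean_genRRs_succ]
    simp only [List.map_cons, List.sum_cons, Prog.mean_add, Prog.mean_const, ih]
    push_cast
    ring

theorem mean_genRRs_prod (θ : ℕ) (f : List V → ℝ≥0∞) :
    ((I.genRRs θ).mean fun Rs _ => (Rs.map f).prod) = (I.genRR.mean fun R _ => f R) ^ θ := by
  induction θ with
  | zero => rw [genRRs, Prog.mean_pure]; simp
  | succ θ ih =>
    rw [mean_genRRs_succ]
    simp only [List.map_cons, List.prod_cons, Prog.mean_const_mul, ih]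
    simp only [mul_comm _ (_ ^ θ), Prog.mean_const_mul]
    rw [pow_succ]

end Problem

/-! ### First-order inequalities in inner product spaces -/

section InnerProductSpace

open Filter Topology

variable {E : Type*} [NormedAddCommGroup E] [InnerProductSpace ℝ E]

/-- `p` is the proximal step with step size `η` at `z` for the gain `s` on `X`. -/
structure IsProximalPoint (η : ℝ) (s : E → ℝ) (X : Set E) (z p : E) : Prop where
  mem : p ∈ X
  le : ∀ y ∈ X, -η * s p + 1 / 2 * ‖z - p‖ ^ 2 ≤ -η * s y + 1 / 2 * ‖z - y‖ ^ 2

theorem norm_sub_add_smul_sq (z p w : E) (t : ℝ) :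
    ‖z - (p + t • w)‖ ^ 2 = ‖z - p‖ ^ 2 - 2 * (t * inner ℝ (z - p) w) + t ^ 2 * ‖w‖ ^ 2 := by
  rw [← sub_sub, norm_sub_sq_real, real_inner_smul_right, norm_smul, mul_pow, Real.norm_eq_abs,
    sq_abs]

theorem IsProximalPoint.three_point {η : ℝ} (hη : 0 < η) {s : E → ℝ} {X : Set E}
    (hs : ConcaveOn ℝ X s) {z p y : E} (hp : IsProximalPoint η s X z p) (hy : y ∈ X) :
    η * (s y - s p) + inner ℝ (z - p) (y - p) ≤ 0 := by
  have hsegment : ∀ t ∈ Set.Ioc (0 : ℝ) 1,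
      η * (s y - s p) + inner ℝ (z - p) (y - p) ≤ t * (1 / 2 * ‖y - p‖ ^ 2) := by
    intro t ht
    have hmin := hp.le _ (hs.1.add_smul_sub_mem hp.mem hy ⟨ht.1.le, ht.2⟩)
    have hconcave : (1 - t) * s p + t * s y ≤ s (p + t • (y - p)) := by
      have := hs.2 hp.mem hy (sub_nonneg.2 ht.2) ht.1.le (sub_add_cancel _ _)
      rwa [show (1 - t) • p + t • y = p + t • (y - p) by module] at this
    rw [norm_sub_add_smul_sq] at hmin
    refine le_of_mul_le_mul_left ?_ ht.1
    linarith [mul_le_mul_of_nonneg_left hconcave hη.le]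
  have hlim : Tendsto (fun t : ℝ => t * (1 / 2 * ‖y - p‖ ^ 2)) (𝓝[>] 0) (𝓝 0) := by
    simpa using (tendsto_id.mul_const (1 / 2 * ‖y - p‖ ^ 2)).mono_left
      (nhdsWithin_le_nhds (a := (0 : ℝ)))
  exact ge_of_tendsto hlim (eventually_of_mem (Ioc_mem_nhdsGT zero_lt_one) hsegment)

theorem inner_add_smul_sub_sub (x y p v : E) (η : ℝ) :
    inner ℝ (x + η • v - p) (y - p) =
      1 / 2 * (‖x - p‖ ^ 2 + ‖p - y‖ ^ 2 - ‖x - y‖ ^ 2) +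
        η * (inner ℝ v (y - x) - inner ℝ v (p - x)) := by
  have hxy : ‖x - y‖ ^ 2 = ‖x - p‖ ^ 2 - 2 * inner ℝ (x - p) (y - p) + ‖y - p‖ ^ 2 := by
    rw [← norm_sub_sq_real, sub_sub_sub_cancel_right]
  rw [add_sub_right_comm, inner_add_left, real_inner_smul_left, ← inner_sub_right,
    sub_sub_sub_cancel_right, hxy, norm_sub_rev p y]
  ring

theorem IsProximalPoint.le_add_of_quadratic_bound {M : ℝ} (hM : 0 < M) {f s : E → ℝ} {X : Set E}
    (hs : ConcaveOn ℝ X s) {x y p v : E} (hp : IsProximalPoint (1 / M) s X (x + (1 / M) • v) p)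
    (hy : y ∈ X) (hfy : f y - 2 * f x ≤ inner ℝ v (y - x))
    (hfp : f x + inner ℝ v (p - x) - M / 2 * ‖p - x‖ ^ 2 ≤ f p) :
    f y + s y ≤ f x + (f p + s p) + M / 2 * (‖x - y‖ ^ 2 - ‖p - y‖ ^ 2) := by
  have hscaled : s y - s p + (inner ℝ v (y - x) - inner ℝ v (p - x)) +
      M / 2 * (‖x - p‖ ^ 2 + ‖p - y‖ ^ 2 - ‖x - y‖ ^ 2) ≤ 0 := by
    have h := mul_nonpos_of_nonneg_of_nonpos hM.le (hp.three_point (one_div_pos.2 hM) hs hy)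
    rw [inner_add_smul_sub_sub] at h
    field_simp at h
    linarith
  rw [norm_sub_rev p x] at hfp
  linarith

variable [CompleteSpace E] {f : E → ℝ} {f' x w : E} {S X : Set E}

theorem tendsto_slope_of_hasGradientWithinAt (hf : HasGradientWithinAt f f' S x)
    (hS : ∀ t ∈ Set.Icc (0 : ℝ) 1, x + t • w ∈ S) :
    Tendsto (fun N : ℕ => ((N : ℝ) + 1) * (f (x + (1 / ((N : ℝ) + 1)) • w) - f x)) atTop
      (𝓝 (inner ℝ f' w)) := by
  have hscale : ∀ N : ℕ, ((N : ℝ) + 1) • (1 / ((N : ℝ) + 1)) • w = w := fun N => by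
    rw [smul_smul, mul_one_div_cancel N.cast_add_one_ne_zero, one_smul]
  have := hf.hasFDerivWithinAt.lim (l := atTop) (c := fun N : ℕ => (N : ℝ) + 1)
    (d := fun N : ℕ => (1 / ((N : ℝ) + 1)) • w) (v := w)
    (by simpa using (tendsto_one_div_add_atTop_nhds_zero_nat (𝕜 := ℝ)).smul_const w)
    (Eventually.of_forall fun N => hS _ ⟨Nat.one_div_pos_of_nat.le, Nat.one_div_le_one_div
      N.zero_le |>.trans_eq (by simp)⟩)
    (by simp only [hscale, tendsto_const_nhds])
  simpa using this

/-- The increments of `f` over the pieces of a partition of the segment into equal parts are at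
most the first one, which is asymptotically given by the gradient. -/
theorem sub_le_inner_of_increments_le (hf : HasGradientWithinAt f f' S x)
    (hS : ∀ t ∈ Set.Icc (0 : ℝ) 1, x + t • w ∈ S)
    (hinc : ∀ a e : ℝ, 0 ≤ a → 0 ≤ e → a + e ≤ 1 →
      f (x + (a + e) • w) - f (x + a • w) ≤ f (x + e • w) - f x) :
    f (x + w) - f x ≤ inner ℝ f' w := by
  refine ge_of_tendsto' (tendsto_slope_of_hasGradientWithinAt hf hS) fun N => ?_
  set e : ℝ := 1 / ((N : ℝ) + 1)
  have he : 0 ≤ e := by positivity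
  have hN : ((N : ℝ) + 1) * e = 1 := mul_one_div_cancel N.cast_add_one_ne_zero
  have hpartial : ∀ j : ℕ, (j : ℝ) * e ≤ 1 →
      f (x + ((j : ℝ) * e) • w) - f x ≤ j * (f (x + e • w) - f x) := by
    intro j
    induction j with
    | zero => simp
    | succ j ih =>
      intro hj
      push_cast at hj ⊢
      rw [add_one_mul] at hj ⊢
      linarith [hinc (j * e) e (by positivity) he hj, ih (by linarith)]
  simpa [hN] using hpartial (N + 1) (by push_cast; exact hN.le)

theorem abs_inner_sub_le_of_lipschitz {L : ℝ} (hf : HasGradientWithinAt f f' S x)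
    (hX : Convex ℝ X) (hXS : X ⊆ S) (hx : x ∈ X) (hL : ∀ y ∈ X, |f y - f x| ≤ L * ‖y - x‖)
    {z : E} (hz : z ∈ X) : |inner ℝ f' (z - x)| ≤ L * ‖z - x‖ := by
  have hmem : ∀ t ∈ Set.Icc (0 : ℝ) 1, x + t • (z - x) ∈ X := fun t =>
    hX.add_smul_sub_mem hx hz
  refine le_of_tendsto' (tendsto_slope_of_hasGradientWithinAt hf fun t ht => hXS (hmem t ht)).abs
    fun N => ?_
  have hN : (0 : ℝ) < (N : ℝ) + 1 := by positivity
  have h := hL _ (hmem (1 / ((N : ℝ) + 1)) ⟨by positivity, (div_le_one hN).2 (by simp)⟩)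
  rw [add_sub_cancel_left, norm_smul, Real.norm_of_nonneg (by positivity)] at h
  rw [abs_mul, abs_of_pos hN]
  calc _ ≤ ((N : ℝ) + 1) * (L * (1 / ((N : ℝ) + 1) * ‖z - x‖)) := by gcongr
    _ = _ := by field_simp

theorem hasDerivWithinAt_comp_segment {f' : E → E} (hX : Convex ℝ X) (hXS : X ⊆ S)
    (hg : ∀ x ∈ X, HasGradientWithinAt f (f' x) S x) {x y : E} (hx : x ∈ X) (hy : y ∈ X)
    {t : ℝ} (ht : t ∈ Set.Icc (0 : ℝ) 1) :
    HasDerivWithinAt (fun t : ℝ => f (x + t • (y - x)))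
      (inner ℝ (f' (x + t • (y - x))) (y - x)) (Set.Icc 0 1) t := by
  have hline : HasDerivAt (fun t : ℝ => x + t • (y - x)) (y - x) t := by
    simpa using ((hasDerivAt_id t).smul_const (y - x)).const_add x
  exact (hg _ (hX.add_smul_sub_mem hx hy ht)).hasFDerivWithinAt.comp_hasDerivWithinAt t
    hline.hasDerivWithinAt fun r hr => hXS (hX.add_smul_sub_mem hx hy hr)

theorem sub_quadratic_le_of_inner_gradient_sub_ge {f' : E → E} {K : ℝ} (hX : Convex ℝ X)
    (hXS : X ⊆ S) (hg : ∀ x ∈ X, HasGradientWithinAt f (f' x) S x)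
    (hK : ∀ x ∈ X, ∀ z ∈ X, -(K * ‖z - x‖ ^ 2) ≤ inner ℝ (f' z - f' x) (z - x))
    {x y : E} (hx : x ∈ X) (hy : y ∈ X) :
    f x + inner ℝ (f' x) (y - x) - K / 2 * ‖y - x‖ ^ 2 ≤ f y := by
  set q : ℝ → ℝ := fun t =>
    f (x + t • (y - x)) - t * inner ℝ (f' x) (y - x) + K / 2 * ‖y - x‖ ^ 2 * t ^ 2
  have hderiv : ∀ t ∈ Set.Icc (0 : ℝ) 1, HasDerivWithinAt q
      (inner ℝ (f' (x + t • (y - x))) (y - x) - inner ℝ (f' x) (y - x) +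
        K / 2 * ‖y - x‖ ^ 2 * (2 * t)) (Set.Icc 0 1) t := by
    intro t ht
    refine ((hasDerivWithinAt_comp_segment hX hXS hg hx hy ht).sub ?_).add ?_
    · simpa using ((hasDerivAt_id t).mul_const (inner ℝ (f' x) (y - x))).hasDerivWithinAt
    · simpa using (((hasDerivAt_id t).pow 2).const_mul (K / 2 * ‖y - x‖ ^ 2)).hasDerivWithinAt
  have hmono : MonotoneOn q (Set.Icc 0 1) := by
    refine monotoneOn_of_hasDerivWithinAt_nonneg (convex_Icc 0 1)
      (fun t ht => (hderiv t ht).continuousWithinAt)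
      (fun t ht => (hderiv t (interior_subset ht)).mono interior_subset) fun t ht => ?_
    rw [interior_Icc] at ht
    have h := hK x hx _ (hX.add_smul_sub_mem hx hy ⟨ht.1.le, ht.2.le⟩)
    rw [add_sub_cancel_left, norm_smul, inner_smul_right, inner_sub_left, mul_pow,
      Real.norm_of_nonneg ht.1.le] at h
    refine le_of_mul_le_mul_left ?_ ht.1
    linarith
  have hq := hmono (Set.left_mem_Icc.2 zero_le_one) (Set.right_mem_Icc.2 zero_le_one) zero_le_one
  simp only [q, zero_smul, add_zero, zero_mul, sub_zero, one_smul, one_mul, one_pow, mul_one,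
    add_sub_cancel, ne_eq, OfNat.ofNat_ne_zero, not_false_eq_true, zero_pow, mul_zero] at hq
  linarith

end InnerProductSpace

/-! ### DR-submodular functions -/

section DRSubmodular

variable {d : ℕ} {X : Set (Mix d)} {f g : Mix d → ℝ}

theorem MonotoneOnMix.add (hf : MonotoneOnMix f X) (hg : MonotoneOnMix g X) :
    MonotoneOnMix (fun x => f x + g x) X :=
  fun x hx y hy hxy => add_le_add (hf x hx y hy hxy) (hg x hx y hy hxy)

theorem MonotoneOnMix.const_mul {a : ℝ} (ha : 0 ≤ a) (hf : MonotoneOnMix f X) :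
    MonotoneOnMix (fun x => a * f x) X :=
  fun x hx y hy hxy => mul_le_mul_of_nonneg_left (hf x hx y hy hxy) ha

theorem MonotoneOnMix.one_sub_mul (hf : MonotoneOnMix f X) (hg : MonotoneOnMix g X)
    (hf1 : ∀ x ∈ X, f x ≤ 1) (hg1 : ∀ x ∈ X, g x ≤ 1) :
    MonotoneOnMix (fun x => 1 - (1 - f x) * (1 - g x)) X :=
  fun x hx y hy hxy => sub_le_sub_left (mul_le_mul (sub_le_sub_left (hf x hx y hy hxy) 1)
    (sub_le_sub_left (hg x hx y hy hxy) 1) (sub_nonneg.2 (hg1 y hy))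
    (sub_nonneg.2 (hf1 x hx))) 1

theorem DRSubmodularOn.add (hf : DRSubmodularOn f X) (hg : DRSubmodularOn g X) :
    DRSubmodularOn (fun x => f x + g x) X := fun x hx y hy hxy i δ hδ hx' hy' => by
  linarith [hf x hx y hy hxy i δ hδ hx' hy', hg x hx y hy hxy i δ hδ hx' hy']

theorem DRSubmodularOn.const_mul {a : ℝ} (ha : 0 ≤ a) (hf : DRSubmodularOn f X) :
    DRSubmodularOn (fun x => a * f x) X := fun x hx y hy hxy i δ hδ hx' hy' => by
  rw [← mul_sub, ← mul_sub]
  exact mul_le_mul_of_nonneg_left (hf x hx y hy hxy i δ hδ hx' hy') ha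

theorem le_add_single {x : Mix d} {i : Fin d} {δ : ℝ} (hδ : 0 ≤ δ) (j : Fin d) :
    x j ≤ (x + EuclideanSpace.single i δ) j := by
  simp only [PiLp.add_apply, PiLp.single_apply]
  split_ifs <;> linarith

theorem add_single_le_add_single {x y : Mix d} (h : ∀ i, x i ≤ y i) (i : Fin d) (δ : ℝ)
    (j : Fin d) : (x + EuclideanSpace.single i δ) j ≤ (y + EuclideanSpace.single i δ) j :=
  add_le_add_left (h j) _

theorem DRSubmodularOn.one_sub_mul (hf : DRSubmodularOn f X) (hg : DRSubmodularOn g X)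
    (hfm : MonotoneOnMix f X) (hgm : MonotoneOnMix g X)
    (hf1 : ∀ x ∈ X, f x ≤ 1) (hg1 : ∀ x ∈ X, g x ≤ 1) :
    DRSubmodularOn (fun x => 1 - (1 - f x) * (1 - g x)) X := by
  intro x hx y hy hxy i δ hδ hx' hy'
  set x' := x + EuclideanSpace.single i δ
  set y' := y + EuclideanSpace.single i δ
  have hxx' : ∀ j, x j ≤ x' j := le_add_single hδ.le
  have hyy' : ∀ j, y j ≤ y' j := le_add_single hδ.le
  have hxy' : ∀ j, x' j ≤ y' j := add_single_le_add_single hxy i δ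
  have hfirst : (f y' - f y) * (1 - g y) ≤ (f x' - f x) * (1 - g x) :=
    mul_le_mul (hf x hx y hy hxy i δ hδ hx' hy') (sub_le_sub_left (hgm x hx y hy hxy) 1)
      (sub_nonneg.2 (hg1 y hy)) (sub_nonneg.2 (hfm x hx x' hx' hxx'))
  have hsecond : (1 - f y') * (g y' - g y) ≤ (1 - f x') * (g x' - g x) :=
    mul_le_mul (sub_le_sub_left (hfm x' hx' y' hy' hxy') 1) (hg x hx y hy hxy i δ hδ hx' hy')
      (sub_nonneg.2 (hgm y hy y' hy' hyy')) (sub_nonneg.2 (hf1 x' hx'))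
  linarith

end DRSubmodular

section Box

variable {d : ℕ} {u : Fin d → ℝ≥0∞} {f : Mix d → ℝ} {f' x y w : Mix d}

theorem mem_box_of_le (hy : y ∈ box u) (h0 : ∀ i, 0 ≤ x i) (h : ∀ i, x i ≤ y i) : x ∈ box u :=
  fun i => ⟨h0 i, (ENNReal.ofReal_le_ofReal (h i)).trans (hy i).2⟩

theorem sum_single_apply (w : Mix d) (s : Finset (Fin d)) (j : Fin d) :
    (∑ i ∈ s, EuclideanSpace.single i (w i) : Mix d) j = if j ∈ s then w j else 0 := by
  simp [WithLp.ofLp_sum, Finset.sum_apply]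

theorem add_sum_single_mem_box (hx : x ∈ box u) (hxy : ∀ i, x i ≤ y i) (hw : ∀ i, 0 ≤ w i)
    (hyw : y + w ∈ box u) (s : Finset (Fin d)) :
    x + ∑ i ∈ s, EuclideanSpace.single i (w i) ∈ box u := by
  refine mem_box_of_le hyw (fun j => ?_) fun j => ?_ <;>
    simp only [PiLp.add_apply, sum_single_apply] <;>
    split_ifs <;> linarith [(hx j).1, hxy j, hw j]

theorem DRSubmodularOn.sub_le_sub (hf : DRSubmodularOn f (box u)) (hx : x ∈ box u)
    (hxy : ∀ i, x i ≤ y i) (hw : ∀ i, 0 ≤ w i) (hyw : y + w ∈ box u) :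
    f (y + w) - f y ≤ f (x + w) - f x := by
  have hy : y ∈ box u := mem_box_of_le hyw (fun i => (hx i).1.trans (hxy i))
    fun i => le_add_of_nonneg_right (hw i)
  have hpartial : ∀ s : Finset (Fin d),
      f (y + ∑ i ∈ s, EuclideanSpace.single i (w i)) - f y ≤
        f (x + ∑ i ∈ s, EuclideanSpace.single i (w i)) - f x := by
    intro s
    induction s using Finset.induction_on with
    | empty => simp
    | insert a s ha ih =>
      have hy' := add_sum_single_mem_box hy (fun _ => le_rfl) hw hyw (insert a s)
      have hx' := add_sum_single_mem_box hx hxy hw hyw (insert a s)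
      rw [Finset.sum_insert ha, add_comm (EuclideanSpace.single a (w a)), ← add_assoc] at hx' hy' ⊢
      rw [← add_assoc]
      rcases (hw a).eq_or_lt with h0 | h0
      · have hzero : (EuclideanSpace.single a (0 : ℝ) : Mix d) = 0 := by ext; simp
        rwa [← h0, hzero, add_zero, add_zero]
      · have := hf _ (add_sum_single_mem_box hx hxy hw hyw s)
          _ (add_sum_single_mem_box hy (fun _ => le_rfl) hw hyw s)
          (fun j => add_le_add_left (hxy j) _) a (w a) h0 hx' hy'
        linarith
  have hsum : ∑ i, EuclideanSpace.single i (w i) = w := by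
    ext j
    simp [sum_single_apply]
  simpa only [hsum] using hpartial Finset.univ

theorem convex_box : Convex ℝ (box u) := by
  intro x hx y hy a b ha hb hab i
  refine ⟨?_, ?_⟩
  · simpa using add_nonneg (mul_nonneg ha (hx i).1) (mul_nonneg hb (hy i).1)
  · have hle : (a • x + b • y) i ≤ max (x i) (y i) := by
      simpa using Convex.combo_le_max (x i) (y i) ha hb hab
    exact (ENNReal.ofReal_le_ofReal hle).trans
      ((ENNReal.ofReal_max _ _).trans_le (max_le (hx i).2 (hy i).2))

theorem DRSubmodularOn.sub_le_inner_of_le (hf : DRSubmodularOn f (box u)) (hx : x ∈ box u)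
    (hy : y ∈ box u) (hxy : ∀ i, x i ≤ y i) (hg : HasGradientWithinAt f f' (box u) x) :
    f y - f x ≤ inner ℝ f' (y - x) := by
  have hmem : ∀ t ∈ Set.Icc (0 : ℝ) 1, x + t • (y - x) ∈ box u := fun t =>
    convex_box.add_smul_sub_mem hx hy
  have h := sub_le_inner_of_increments_le hg hmem fun a e ha he hae => ?_
  · rwa [add_sub_cancel] at h
  · have hnonneg : ∀ {t : ℝ}, 0 ≤ t → ∀ i, 0 ≤ (t • (y - x)) i := fun ht i =>
      mul_nonneg ht (sub_nonneg.2 (hxy i))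
    rw [add_smul, ← add_assoc]
    exact hf.sub_le_sub hx (fun i => le_add_of_nonneg_right (hnonneg ha i)) (hnonneg he)
      (by rw [add_assoc, ← add_smul]; exact hmem _ ⟨add_nonneg ha he, hae⟩)

theorem DRSubmodularOn.sub_le_inner_of_ge (hf : DRSubmodularOn f (box u)) (hx : x ∈ box u)
    (hy : y ∈ box u) (hyx : ∀ i, y i ≤ x i) (hg : HasGradientWithinAt f f' (box u) x) :
    f y - f x ≤ inner ℝ f' (y - x) := by
  have hmem : ∀ t ∈ Set.Icc (0 : ℝ) 1, x + t • (y - x) ∈ box u := fun t =>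
    convex_box.add_smul_sub_mem hx hy
  have h := sub_le_inner_of_increments_le hg hmem fun a e ha he hae => ?_
  · rwa [add_sub_cancel] at h
  · have hnonneg : ∀ {t : ℝ}, 0 ≤ t → ∀ i, 0 ≤ (t • (x - y)) i := fun ht i =>
      mul_nonneg ht (sub_nonneg.2 (hyx i))
    have hneg : ∀ t : ℝ, t • (y - x) = -(t • (x - y)) := fun t => by rw [← smul_neg, neg_sub]
    have hdr := hf.sub_le_sub (x := x + (a + e) • (y - x)) (y := x + e • (y - x))
      (w := e • (x - y)) (hmem _ ⟨add_nonneg ha he, hae⟩)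
      (fun i => by
        rw [add_smul, add_comm (a • _), ← add_assoc, hneg a]
        exact add_le_of_nonpos_right (neg_nonpos.2 (hnonneg ha i)))
      (hnonneg he) (by rwa [hneg, neg_add_cancel_right])
    rw [hneg e, neg_add_cancel_right, add_smul, hneg e, ← add_assoc, neg_add_cancel_right] at hdr
    rw [hneg e, add_smul, hneg e, ← add_assoc]
    linarith

/-- Moving from `x` to `x ⊔ y` gains at least `f y - f x`, and moving from `x` to `x ⊓ y` loses at
most `f x`. -/
theorem DRSubmodularOn.sub_two_mul_le_inner (hf : DRSubmodularOn f (box u))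
    (hmono : MonotoneOnMix f (box u)) (hnonneg : ∀ x ∈ box u, 0 ≤ f x)
    (hx : x ∈ box u) (hy : y ∈ box u) (hg : HasGradientWithinAt f f' (box u) x) :
    f y - 2 * f x ≤ inner ℝ f' (y - x) := by
  set sup : Mix d := WithLp.toLp 2 fun i => max (x i) (y i)
  set inf : Mix d := WithLp.toLp 2 fun i => min (x i) (y i)
  have hsup : sup ∈ box u := fun i => by
    rcases max_choice (x i) (y i) with h | h <;> simp only [sup, h, hx i, hy i, and_self]
  have hinf : inf ∈ box u := fun i => by
    rcases min_choice (x i) (y i) with h | h <;> simp only [inf, h, hx i, hy i, and_self]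
  have hsum : y - x = (sup - x) + (inf - x) := by
    ext i
    simp only [PiLp.sub_apply, PiLp.add_apply, sup, inf]
    linarith [max_add_min (x i) (y i)]
  rw [hsum, inner_add_right]
  linarith [hf.sub_le_inner_of_le hx hsup (fun i => le_max_left _ _) hg,
    hf.sub_le_inner_of_ge hx hinf (fun i => min_le_left _ _) hg,
    hmono y hy sup hsup fun i => le_max_right _ _, hnonneg inf hinf]

end Box

namespace Problem

/-! ### The empirical objective and the proximal gradient method -/

section EmpiricalObjective

variable {V : Type} {d : ℕ} (I : Problem V d)

/-- The probability that no node of `R` is activated. -/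
def miss (R : List V) (x : Mix d) : ℝ := (R.map fun v => 1 - I.h v x).prod

/-- The gradient of `1 - miss R`. -/
def hitGrad (x : Mix d) : List V → Mix d
  | [] => 0
  | v :: R => (1 - I.h v x) • hitGrad x R + I.miss R x • I.gradh v x

/-- The expected number of RR sets in `Rs` that contain an activated node. -/
def hits (Rs : List (List V)) (x : Mix d) : ℝ := (Rs.map fun R => 1 - I.miss R x).sum

/-- The gradient of `hits Rs`. -/
def hitsGrad (Rs : List (List V)) (x : Mix d) : Mix d := (Rs.map fun R => I.hitGrad x R).sum

/-- The sum of the `j`-th powers of the sizes of the RR sets. -/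
def powSum (j : ℕ) (Rs : List (List V)) : ℝ := (Rs.map fun R => (R.length : ℝ) ^ j).sum

@[simp] theorem miss_nil (x : Mix d) : I.miss [] x = 1 := rfl

theorem miss_cons (v : V) (R : List V) (x : Mix d) :
    I.miss (v :: R) x = (1 - I.h v x) * I.miss R x := by simp [miss]

@[simp] theorem hits_nil (x : Mix d) : I.hits [] x = 0 := rfl

theorem hits_cons (R : List V) (Rs : List (List V)) (x : Mix d) :
    I.hits (R :: Rs) x = (1 - I.miss R x) + I.hits Rs x := by simp [hits]

@[simp] theorem hitsGrad_nil (x : Mix d) : I.hitsGrad [] x = 0 := rfl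

theorem hitsGrad_cons (R : List V) (Rs : List (List V)) (x : Mix d) :
    I.hitsGrad (R :: Rs) x = I.hitGrad x R + I.hitsGrad Rs x := by simp [hitsGrad]

@[simp] theorem powSum_nil (j : ℕ) : powSum j ([] : List (List V)) = 0 := rfl

theorem powSum_cons (j : ℕ) (R : List V) (Rs : List (List V)) :
    powSum j (R :: Rs) = (R.length : ℝ) ^ j + powSum j Rs := by simp [powSum]

theorem rrTerm_val (x : Mix d) (R : List V) : ∀ (pre : ℝ) (acc : Mix d),
    (I.rrTerm x R pre acc).val = (I.miss R x, acc + pre • I.hitGrad x R) := by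
  induction R with
  | nil => intro pre acc; simp [rrTerm, hitGrad]
  | cons v R ih =>
    intro pre acc
    simp only [rrTerm, Timed.val_bind, Timed.val_pure, ih, miss_cons, hitGrad]
    refine Prod.ext rfl ?_
    simp only [smul_add, smul_smul, add_assoc]

theorem sumTerms_val (x : Mix d) (Rs : List (List V)) : ∀ acc : Mix d,
    (I.sumTerms x Rs acc).val = (I.hits Rs x, acc + I.hitsGrad Rs x) := by
  induction Rs with
  | nil => intro acc; simp [sumTerms]
  | cons R Rs ih =>
    intro acc
    simp only [sumTerms, Timed.val_bind, Timed.val_pure, rrTerm_val, ih, hits_cons, hitsGrad_cons]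
    refine Prod.ext (add_comm _ _) ?_
    simp only [one_smul, add_assoc]

theorem sizes_val (Rs : List (List V)) : (sizes Rs).val = (powSum 1 Rs, powSum 2 Rs) := by
  induction Rs with
  | nil => simp [sizes]
  | cons R Rs ih =>
    simp only [sizes, Timed.val_bind, Timed.val_pure, ih, powSum_cons, pow_one]
    exact Prod.ext (add_comm _ _) (add_comm _ _)

theorem inner_hitGrad_cons_sub (x z w : Mix d) (v : V) (R : List V) :
    inner ℝ (I.hitGrad z (v :: R) - I.hitGrad x (v :: R)) w =
      (1 - I.h v z) * inner ℝ (I.hitGrad z R - I.hitGrad x R) w +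
        (I.h v x - I.h v z) * inner ℝ (I.hitGrad x R) w +
        I.miss R z * inner ℝ (I.gradh v z - I.gradh v x) w +
        (I.miss R z - I.miss R x) * inner ℝ (I.gradh v x) w := by
  simp only [hitGrad, inner_sub_left, inner_add_left, real_inner_smul_left]
  ring

variable [Fintype V]

theorem n_pos [Nonempty V] : 0 < I.n := Nat.cast_pos.2 Fintype.card_pos

theorem n_nonneg : 0 ≤ I.n := Nat.cast_nonneg _

theorem n_div_length_nonneg (Rs : List (List V)) : 0 ≤ I.n / Rs.length :=
  div_nonneg I.n_nonneg (Nat.cast_nonneg _)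

/-- The estimate `ĝ` of `g`. -/
def estimate (Rs : List (List V)) (x : Mix d) : ℝ := I.n / Rs.length * I.hits Rs x

/-- The gradient of `estimate Rs`. -/
def estimateGrad (Rs : List (List V)) (x : Mix d) : Mix d := (I.n / Rs.length) • I.hitsGrad Rs x

theorem evalObj_val (Rs : List (List V)) (x : Mix d) :
    (I.evalObj Rs x).val = (I.estimate Rs x + I.s x, I.estimateGrad Rs x) := by
  simp [evalObj, sumTerms_val, estimate, estimateGrad, s]

theorem smoothness_eq (Rs : List (List V)) : I.smoothness Rs =
    I.n / Rs.length * (powSum 1 Rs * I.βh + powSum 2 Rs * I.Lh ^ 2) := by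
  rw [smoothness, sizes_val]
  ring

theorem le_iterate (η : ℝ) (Rs : List (List V)) (t : ℕ) : ∀ (x v : Mix d) (best : Mix d × ℝ),
    best.2 ≤ (I.iterate η Rs t x v best).val.2 := by
  induction t with
  | zero => exact fun _ _ _ => le_rfl
  | succ t ih =>
    intro x v best
    refine le_trans ?_ (ih _ _ _)
    split_ifs with h
    exacts [h.le, le_rfl]

end EmpiricalObjective

namespace Assumptions

variable {V : Type} [Fintype V] [DecidableEq V] {d : ℕ} {I : Problem V d} {κ : ℝ}
  {Th Tc Tprox : ℕ} (A : I.Assumptions κ Th Tc Tprox)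

include A

theorem miss_mem {x : Mix d} (hx : x ∈ box I.u) (R : List V) :
    I.miss R x ∈ Set.Icc (0 : ℝ) 1 := by
  induction R with
  | nil => simp
  | cons v R ih =>
    rw [miss_cons]
    exact unitInterval.mul_mem (Set.Icc.one_sub_mem (A.h_mem v x hx)) ih

theorem hit_mono (R : List V) : MonotoneOnMix (fun x => 1 - I.miss R x) (box I.u) := by
  induction R with
  | nil => simp [MonotoneOnMix]
  | cons v R ih =>
    simpa only [miss_cons, sub_sub_cancel] using (A.h_mono v).one_sub_mul ih
      (fun x hx => (A.h_mem v x hx).2) fun x hx => sub_le_self 1 (A.miss_mem hx R).1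

theorem hit_dr (R : List V) : DRSubmodularOn (fun x => 1 - I.miss R x) (box I.u) := by
  induction R with
  | nil => simp [DRSubmodularOn]
  | cons v R ih =>
    simpa only [miss_cons, sub_sub_cancel] using (A.h_dr v).one_sub_mul ih (A.h_mono v)
      (A.hit_mono R) (fun x hx => (A.h_mem v x hx).2) fun x hx => sub_le_self 1 (A.miss_mem hx R).1

theorem hits_nonneg {x : Mix d} (hx : x ∈ box I.u) (Rs : List (List V)) : 0 ≤ I.hits Rs x :=
  List.sum_nonneg <| List.forall_mem_map.2 fun R _ => sub_nonneg.2 (A.miss_mem hx R).2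

theorem hits_le {x : Mix d} (hx : x ∈ box I.u) (Rs : List (List V)) :
    I.hits Rs x ≤ Rs.length := by
  simpa [hits] using List.sum_le_card_nsmul (Rs.map fun R => 1 - I.miss R x) 1
    (List.forall_mem_map.2 fun R _ => sub_le_self 1 (A.miss_mem hx R).1)

theorem hits_mono (Rs : List (List V)) : MonotoneOnMix (I.hits Rs) (box I.u) := by
  induction Rs with
  | nil => simp [MonotoneOnMix]
  | cons R Rs ih => simpa only [MonotoneOnMix, hits_cons] using (A.hit_mono R).add ih

theorem hits_dr (Rs : List (List V)) : DRSubmodularOn (I.hits Rs) (box I.u) := by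
  induction Rs with
  | nil => simp [DRSubmodularOn]
  | cons R Rs ih => simpa only [DRSubmodularOn, hits_cons] using (A.hit_dr R).add ih

theorem estimate_nonneg {x : Mix d} (hx : x ∈ box I.u) (Rs : List (List V)) :
    0 ≤ I.estimate Rs x :=
  mul_nonneg (I.n_div_length_nonneg Rs) (A.hits_nonneg hx Rs)

theorem estimate_le {x : Mix d} (hx : x ∈ box I.u) (Rs : List (List V)) :
    I.estimate Rs x ≤ I.n :=
  (mul_le_mul_of_nonneg_left (A.hits_le hx Rs) (I.n_div_length_nonneg Rs)).trans <|
    (div_mul_comm _ _ _).trans_le (mul_le_of_le_one_left I.n_nonneg (div_self_le_one _))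

theorem estimate_mono (Rs : List (List V)) : MonotoneOnMix (I.estimate Rs) (box I.u) :=
  (A.hits_mono Rs).const_mul (I.n_div_length_nonneg Rs)

theorem estimate_dr (Rs : List (List V)) : DRSubmodularOn (I.estimate Rs) (box I.u) :=
  (A.hits_dr Rs).const_mul (I.n_div_length_nonneg Rs)

theorem hasGradientWithinAt_hit {x : Mix d} (hx : x ∈ I.dom) (R : List V) :
    HasGradientWithinAt (fun x => 1 - I.miss R x) (I.hitGrad x R) (box I.u) x := by
  induction R with
  | nil => simpa [hitGrad] using hasGradientWithinAt_const x (box I.u) (0 : ℝ)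
  | cons v R ih =>
    rw [hasGradientWithinAt_iff_hasFDerivWithinAt] at ih ⊢
    have h := (((A.h_grad v x hx).hasFDerivWithinAt.const_sub 1).mul
      (ih.const_sub 1)).const_sub 1
    simp only [sub_sub_cancel] at h
    simp only [miss_cons]
    refine h.congr_fderiv ?_
    ext w
    simp [hitGrad, add_comm]

theorem hasGradientWithinAt_hits {x : Mix d} (hx : x ∈ I.dom) (Rs : List (List V)) :
    HasGradientWithinAt (I.hits Rs) (I.hitsGrad Rs x) (box I.u) x := by
  induction Rs with
  | nil => exact hasGradientWithinAt_const _ _ _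
  | cons R Rs ih =>
    rw [hasGradientWithinAt_iff_hasFDerivWithinAt] at ih ⊢
    rw [hitsGrad_cons, map_add]
    exact ((A.hasGradientWithinAt_hit hx R).hasFDerivWithinAt.add ih).congr
      (fun y _ => I.hits_cons R Rs y) (I.hits_cons R Rs x)

theorem hasGradientWithinAt_estimate {x : Mix d} (hx : x ∈ I.dom) (Rs : List (List V)) :
    HasGradientWithinAt (I.estimate Rs) (I.estimateGrad Rs x) (box I.u) x := by
  have h := A.hasGradientWithinAt_hits hx Rs
  rw [hasGradientWithinAt_iff_hasFDerivWithinAt] at h ⊢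
  refine (h.const_mul (I.n / Rs.length)).congr_fderiv ?_
  ext w
  simp [estimateGrad]

theorem abs_inner_gradh_le {x z : Mix d} (hx : x ∈ I.dom) (hz : z ∈ I.dom) (v : V) :
    |inner ℝ (I.gradh v x) (z - x)| ≤ I.Lh * ‖z - x‖ :=
  abs_inner_sub_le_of_lipschitz (A.h_grad v x hx) A.c_convex.1 A.dom_subset hx
    (fun y hy => A.h_lipschitz v y hy x hx) hz

theorem abs_one_sub_h_mul_le {x : Mix d} (hx : x ∈ I.dom) (v : V) (a : ℝ) :
    |(1 - I.h v x) * a| ≤ |a| := by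
  have h := Set.Icc.one_sub_mem (A.h_mem v x (A.dom_subset hx))
  rw [abs_mul, abs_of_nonneg h.1]
  exact mul_le_of_le_one_left (abs_nonneg a) h.2

theorem abs_miss_mul_le {x : Mix d} (hx : x ∈ I.dom) (R : List V) (a : ℝ) :
    |I.miss R x * a| ≤ |a| := by
  have h := A.miss_mem (A.dom_subset hx) R
  rw [abs_mul, abs_of_nonneg h.1]
  exact mul_le_of_le_one_left (abs_nonneg a) h.2

theorem abs_miss_sub_le {x z : Mix d} (hx : x ∈ I.dom) (hz : z ∈ I.dom) (R : List V) :
    |I.miss R z - I.miss R x| ≤ R.length * (I.Lh * ‖z - x‖) := by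
  induction R with
  | nil => simp
  | cons v R ih =>
    have hsplit : I.miss (v :: R) z - I.miss (v :: R) x =
        (1 - I.h v z) * (I.miss R z - I.miss R x) + I.miss R x * (I.h v x - I.h v z) := by
      rw [miss_cons, miss_cons]; ring
    have hlip := A.h_lipschitz v x hx z hz
    rw [norm_sub_rev] at hlip
    rw [hsplit, List.length_cons, Nat.cast_add_one, add_one_mul]
    exact (abs_add_le _ _).trans (add_le_add ((A.abs_one_sub_h_mul_le hz v _).trans ih)
      ((A.abs_miss_mul_le hx R _).trans hlip))

theorem abs_inner_hitGrad_le {x z : Mix d} (hx : x ∈ I.dom) (hz : z ∈ I.dom) (R : List V) :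
    |inner ℝ (I.hitGrad x R) (z - x)| ≤ R.length * (I.Lh * ‖z - x‖) :=
  abs_inner_sub_le_of_lipschitz (A.hasGradientWithinAt_hit hx R) A.c_convex.1 A.dom_subset hx
    (fun y hy => by
      rw [sub_sub_sub_cancel_left, abs_sub_comm, mul_assoc]
      exact A.abs_miss_sub_le hx hy R) hz |>.trans_eq (mul_assoc _ _ _)

theorem abs_inner_hitGrad_sub_le {x z : Mix d} (hx : x ∈ I.dom) (hz : z ∈ I.dom) (R : List V) :
    |inner ℝ (I.hitGrad z R - I.hitGrad x R) (z - x)| ≤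
      (R.length * I.βh + (R.length : ℝ) ^ 2 * I.Lh ^ 2) * ‖z - x‖ ^ 2 := by
  induction R with
  | nil => simp [hitGrad]
  | cons v R ih =>
    have hLD : 0 ≤ I.Lh * ‖z - x‖ := mul_nonneg A.Lh_pos.le (norm_nonneg _)
    have hrest := (A.abs_one_sub_h_mul_le hz v _).trans ih
    have hh : |(I.h v x - I.h v z) * inner ℝ (I.hitGrad x R) (z - x)| ≤
        (I.Lh * ‖z - x‖) * (R.length * (I.Lh * ‖z - x‖)) := by
      rw [abs_mul]
      refine mul_le_mul ?_ (A.abs_inner_hitGrad_le hx hz R) (abs_nonneg _) hLD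
      rw [norm_sub_rev]
      exact A.h_lipschitz v x hx z hz
    have hgrad : |I.miss R z * inner ℝ (I.gradh v z - I.gradh v x) (z - x)| ≤
        I.βh * ‖z - x‖ * ‖z - x‖ :=
      (A.abs_miss_mul_le hz R _).trans <| (abs_real_inner_le_norm _ _).trans <|
        mul_le_mul_of_nonneg_right (A.h_smooth v z hz x hx) (norm_nonneg _)
    have hmiss : |(I.miss R z - I.miss R x) * inner ℝ (I.gradh v x) (z - x)| ≤
        (R.length * (I.Lh * ‖z - x‖)) * (I.Lh * ‖z - x‖) := by
      rw [abs_mul]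
      exact mul_le_mul (A.abs_miss_sub_le hx hz R) (A.abs_inner_gradh_le hx hz v) (abs_nonneg _)
        (mul_nonneg (Nat.cast_nonneg _) hLD)
    have htriangle := (abs_add_le _ _).trans (add_le_add ((abs_add_le _ _).trans
      (add_le_add ((abs_add_le _ _).trans (add_le_add hrest hh)) hgrad)) hmiss)
    rw [inner_hitGrad_cons_sub, List.length_cons, Nat.cast_add_one]
    linarith [sq_nonneg (I.Lh * ‖z - x‖)]

theorem abs_inner_hitsGrad_sub_le {x z : Mix d} (hx : x ∈ I.dom) (hz : z ∈ I.dom)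
    (Rs : List (List V)) :
    |inner ℝ (I.hitsGrad Rs z - I.hitsGrad Rs x) (z - x)| ≤
      (powSum 1 Rs * I.βh + powSum 2 Rs * I.Lh ^ 2) * ‖z - x‖ ^ 2 := by
  induction Rs with
  | nil => simp
  | cons R Rs ih =>
    rw [hitsGrad_cons, hitsGrad_cons, add_sub_add_comm, inner_add_left, powSum_cons, powSum_cons]
    calc _ ≤ _ := (abs_add_le _ _).trans (add_le_add (A.abs_inner_hitGrad_sub_le hx hz R) ih)
      _ = _ := by ring

theorem abs_inner_estimateGrad_sub_le {x z : Mix d} (hx : x ∈ I.dom) (hz : z ∈ I.dom)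
    (Rs : List (List V)) :
    |inner ℝ (I.estimateGrad Rs z - I.estimateGrad Rs x) (z - x)| ≤
      I.smoothness Rs * ‖z - x‖ ^ 2 := by
  have hn := I.n_div_length_nonneg Rs
  rw [estimateGrad, estimateGrad, ← smul_sub, real_inner_smul_left, abs_mul, abs_of_nonneg hn,
    smoothness_eq, mul_assoc]
  exact mul_le_mul_of_nonneg_left (A.abs_inner_hitsGrad_sub_le hx hz Rs) hn

theorem s_nonneg {x : Mix d} (hx : x ∈ I.feasible) : 0 ≤ I.s x :=
  mul_nonneg A.lam_nonneg (sub_nonneg.2 hx.2)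

theorem s_le {x : Mix d} (hx : x ∈ I.feasible) : I.s x ≤ I.lam * I.k :=
  mul_le_mul_of_nonneg_left (sub_le_self I.k (A.c_nonneg x hx.1)) A.lam_nonneg

theorem estimate_add_s_le {x : Mix d} (hx : x ∈ I.feasible) (Rs : List (List V)) :
    I.estimate Rs x + I.s x ≤ I.n + I.lam * I.k :=
  add_le_add (A.estimate_le (A.dom_subset hx.1) Rs) (A.s_le hx)

theorem concaveOn_s : ConcaveOn ℝ I.feasible I.s :=
  have hconv := A.c_convex.convex_le I.k
  ((concaveOn_const I.k hconv).sub (A.c_convex.subset (fun _ hx => hx.1) hconv)).smul A.lam_nonneg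

theorem isProximalPoint_prox {η : ℝ} (hη : 0 < η) (z : Mix d) :
    IsProximalPoint η I.s I.feasible z (I.prox η z) :=
  ⟨A.prox_mem η hη z, A.prox_min η hη z⟩

theorem estimate_add_s_le_prox {Rs : List (List V)} (hM : 0 < I.smoothness Rs) {x y : Mix d}
    (hx : x ∈ I.feasible) (hy : y ∈ I.feasible) {p : Mix d}
    (hp : p = I.prox (1 / I.smoothness Rs) (x + (1 / I.smoothness Rs) • I.estimateGrad Rs x)) :
    I.estimate Rs y + I.s y ≤ I.estimate Rs x + (I.estimate Rs p + I.s p) +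
      I.smoothness Rs / 2 * (‖x - y‖ ^ 2 - ‖p - y‖ ^ 2) := by
  have hprox := A.isProximalPoint_prox (one_div_pos.2 hM)
    (x + (1 / I.smoothness Rs) • I.estimateGrad Rs x)
  rw [← hp] at hprox
  refine hprox.le_add_of_quadratic_bound hM A.concaveOn_s hy ?_ ?_
  · exact (A.estimate_dr Rs).sub_two_mul_le_inner (A.estimate_mono Rs)
      (fun x hx => A.estimate_nonneg hx Rs) (A.dom_subset hx.1) (A.dom_subset hy.1)
      (A.hasGradientWithinAt_estimate hx.1 Rs)
  · exact sub_quadratic_le_of_inner_gradient_sub_ge A.c_convex.1 A.dom_subset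
      (fun x hx => A.hasGradientWithinAt_estimate hx Rs)
      (fun x hx z hz => (abs_le.1 (A.abs_inner_estimateGrad_sub_le hx hz Rs)).1) hx.1 hprox.mem.1

theorem iterate_le {η : ℝ} (hη : 0 < η) (Rs : List (List V)) (t : ℕ) :
    ∀ (x v : Mix d) (best : Mix d × ℝ), best.2 ≤ I.n + I.lam * I.k →
      (I.iterate η Rs t x v best).val.2 ≤ I.n + I.lam * I.k := by
  induction t with
  | zero => exact fun _ _ _ hbest => hbest
  | succ _ ih =>
    intro x v best hbest
    refine ih _ _ _ ?_
    rw [evalObj_val]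
    split_ifs
    exacts [A.estimate_add_s_le (A.prox_mem η hη _) Rs, hbest]

/-- Summing the progress of the steps telescopes the distances to `y`. -/
theorem mul_estimate_add_s_le_iterate {Rs : List (List V)} (hM : 0 < I.smoothness Rs) {y : Mix d}
    (hy : y ∈ I.feasible) (t : ℕ) : ∀ (x : Mix d) (best : Mix d × ℝ), x ∈ I.feasible →
      I.estimate Rs x + I.s x ≤ best.2 →
      t * (I.estimate Rs y + I.s y) ≤
        2 * t * (I.iterate (1 / I.smoothness Rs) Rs t x (I.estimateGrad Rs x) best).val.2 +
          I.smoothness Rs / 2 * ‖x - y‖ ^ 2 := by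
  induction t with
  | zero => intro x best _ _; simpa using by positivity
  | succ t ih =>
    intro x best hx hbest
    simp only [iterate, Timed.val_bind, evalObj_val]
    set p := I.prox (1 / I.smoothness Rs) (x + (1 / I.smoothness Rs) • I.estimateGrad Rs x) with hp
    set next := if best.2 < I.estimate Rs p + I.s p then (p, I.estimate Rs p + I.s p) else best
      with hnext
    have hbest_le : best.2 ≤ next.2 := by
      rw [hnext]; split_ifs with h
      exacts [h.le, le_rfl]
    have hp_le : I.estimate Rs p + I.s p ≤ next.2 := by
      rw [hnext]; split_ifs with h
      exacts [le_rfl, not_lt.1 h]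
    have hrest := ih p next (A.prox_mem _ (by positivity) _) hp_le
    have hstep := A.estimate_add_s_le_prox hM hx hy hp
    have hnext_le := I.le_iterate (1 / I.smoothness Rs) Rs t p (I.estimateGrad Rs p) next
    push_cast
    linarith [A.s_nonneg hx]

theorem proxGrad_le {Rs : List (List V)} (hM : 0 < I.smoothness Rs) (a : ℝ) :
    (I.proxGrad Rs a).val.2 ≤ I.n + I.lam * I.k := by
  simp only [proxGrad, Timed.val_bind, evalObj_val]
  exact A.iterate_le (one_div_pos.2 hM) Rs _ _ _ _ (A.estimate_add_s_le A.x₀_mem Rs)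

theorem estimate_add_s_le_proxGrad {Rs : List (List V)} (hM : 0 < I.smoothness Rs) {a : ℝ}
    (ha : 0 < a) {y : Mix d} (hy : y ∈ I.feasible) :
    I.estimate Rs y + I.s y ≤ 2 * (I.proxGrad Rs a).val.2 + 2 / 3 * a := by
  simp only [proxGrad, Timed.val_bind, evalObj_val]
  set T := ⌈3 * I.smoothness Rs * I.Δ ^ 2 / (4 * a)⌉₊
  have hΔ := A.Δ_pos
  have hT : 3 * I.smoothness Rs * I.Δ ^ 2 / (4 * a) ≤ T := Nat.le_ceil _
  have hT0 : (0 : ℝ) < T := lt_of_lt_of_le (by positivity) hT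
  have hiterate := A.mul_estimate_add_s_le_iterate hM hy T I.x₀
    (I.x₀, I.estimate Rs I.x₀ + I.s I.x₀) A.x₀_mem le_rfl
  have hdist : ‖I.x₀ - y‖ ^ 2 ≤ I.Δ ^ 2 := by
    gcongr
    exact A.dist_le _ A.x₀_mem _ hy
  have herror : I.smoothness Rs / 2 * ‖I.x₀ - y‖ ^ 2 ≤ T * (2 / 3 * a) := by
    rw [div_le_iff₀ (by positivity)] at hT
    linarith [mul_le_mul_of_nonneg_left hdist hM.le]
  refine le_of_mul_le_mul_left ?_ hT0
  linarith

end Assumptions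

end Problem

/-! ### Running time of the gradient algorithm -/

namespace Problem

open TriggeringModel

section Sizes

variable {V : Type}

/-- The sum of the sizes of the RR sets, as a natural number. -/
def totalSize (Rs : List (List V)) : ℕ := (Rs.map List.length).sum

theorem totalSize_cons (R : List V) (Rs : List (List V)) :
    totalSize (R :: Rs) = R.length + totalSize Rs := by simp [totalSize]

theorem cast_totalSize (Rs : List (List V)) : (totalSize Rs : ℝ) = powSum 1 Rs := by
  simp [totalSize, powSum, Nat.cast_list_sum, Function.comp_def]

theorem length_le_powSum (j : ℕ) {Rs : List (List V)} (hne : ∀ R ∈ Rs, R ≠ []) :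
    (Rs.length : ℝ) ≤ powSum j Rs := by
  simpa [powSum] using (Rs.map fun R => (R.length : ℝ) ^ j).card_nsmul_le_sum 1
    (List.forall_mem_map.2 fun R hR =>
      one_le_pow₀ (Nat.one_le_cast.2 (List.length_pos_iff.2 (hne R hR))))

theorem length_le_totalSize {Rs : List (List V)} (hne : ∀ R ∈ Rs, R ≠ []) :
    Rs.length ≤ totalSize Rs := by
  exact_mod_cast (length_le_powSum 1 hne).trans_eq (cast_totalSize Rs).symm

theorem powSum_nonneg (j : ℕ) (Rs : List (List V)) : 0 ≤ powSum j Rs :=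
  List.sum_nonneg <| List.forall_mem_map.2 fun _ _ => by positivity

theorem powSum_mul_powSum_one_le (j : ℕ) (Rs : List (List V)) :
    powSum j Rs * powSum 1 Rs ≤ Rs.length * powSum (j + 1) Rs := by
  have hmono : Monovary (fun i : Fin Rs.length => (Rs[i].length : ℝ) ^ j)
      (fun i => (Rs[i].length : ℝ)) :=
    fun a b hab => pow_le_pow_left₀ (Nat.cast_nonneg _) hab.le j
  simpa [powSum, ← pow_succ, ← Fin.sum_univ_fun_getElem] using hmono.sum_mul_sum_le_card_mul_sum

theorem sizes_time_le {Rs : List (List V)} (hne : ∀ R ∈ Rs, R ≠ []) :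
    (sizes Rs).time ≤ 5 * totalSize Rs := by
  induction Rs with
  | nil => simp [sizes]
  | cons R Rs ih =>
    rw [List.forall_mem_cons] at hne
    have hR := List.length_pos_iff.2 hne.1
    have hRs := ih hne.2
    simp only [sizes, Timed.time_bind, Timed.time_pure, time_tick, totalSize_cons]
    lia

theorem ofReal_powSum (j : ℕ) (Rs : List (List V)) :
    ENNReal.ofReal (powSum j Rs) = (Rs.map fun R => (R.length : ℝ≥0∞) ^ j).sum := by
  induction Rs with
  | nil => simp
  | cons R Rs ih =>
    rw [powSum_cons, ENNReal.ofReal_add (by positivity) (powSum_nonneg j Rs), ih, List.map_cons,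
      List.sum_cons, ENNReal.ofReal_pow (by positivity), ENNReal.ofReal_natCast]

end Sizes

namespace Assumptions

variable {V : Type} [Fintype V] [DecidableEq V] {d : ℕ} {I : Problem V d} {κ : ℝ}
  {Th Tc Tprox : ℕ} (A : I.Assumptions κ Th Tc Tprox)

include A

theorem dim_le_Tprox : d ≤ Tprox := (A.dim_le 0 0).trans (A.timeProx_le 0 0)

theorem rrTerm_time_le (x : Mix d) (R : List V) : ∀ (pre : ℝ) (acc : Mix d),
    (I.rrTerm x R pre acc).time ≤ R.length * (3 * Th + 5) := by
  induction R with
  | nil => simp [rrTerm]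
  | cons v R ih =>
    intro pre acc
    have hh := A.timeH_le v x
    have hgrad := A.gradSize_le v x
    have hR := ih (pre * (1 - I.h v x)) acc
    simp only [rrTerm, Timed.time_bind, Timed.time_pure, time_tick, List.length_cons, add_one_mul]
    lia

theorem sumTerms_time_le (x : Mix d) {Rs : List (List V)} (hne : ∀ R ∈ Rs, R ≠ []) :
    ∀ acc : Mix d, (I.sumTerms x Rs acc).time ≤ totalSize Rs * (3 * Th + 8) := by
  induction Rs with
  | nil => simp [sumTerms]
  | cons R Rs ih =>
    intro acc
    rw [List.forall_mem_cons] at hne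
    have hpos := List.length_pos_iff.2 hne.1
    have hR := A.rrTerm_time_le x R 1 acc
    have hRs := ih hne.2 (I.rrTerm x R 1 acc).val.2
    simp only [sumTerms, Timed.time_bind, Timed.time_pure, time_tick, totalSize_cons, add_mul]
    linarith

theorem evalObj_time_le (x : Mix d) {Rs : List (List V)} (hne : ∀ R ∈ Rs, R ≠ [])
    (hpos : 0 < totalSize Rs) :
    (I.evalObj Rs x).time ≤ totalSize Rs * (3 * Th + 14) + Tc + 2 * Tprox := by
  have hsum := A.sumTerms_time_le x hne 0
  have hc := A.timeC_le x
  have hd := A.dim_le_Tprox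
  simp only [evalObj, Timed.time_bind, Timed.time_pure, time_tick]
  linarith

theorem iterate_time_le (η : ℝ) {Rs : List (List V)} (hne : ∀ R ∈ Rs, R ≠ [])
    (hpos : 0 < totalSize Rs) (t : ℕ) : ∀ (x v : Mix d) (best : Mix d × ℝ),
    (I.iterate η Rs t x v best).time ≤
      t * (totalSize Rs * (3 * Th + 16) + Tc + 6 * Tprox) := by
  induction t with
  | zero => simp [iterate]
  | succ t ih =>
    intro x v best
    have hprox := A.timeProx_le η (x + η • v)
    have hobj := A.evalObj_time_le (I.prox η (x + η • v)) hne hpos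
    have hd := A.dim_le_Tprox
    simp only [iterate, Timed.time_bind, time_tick, add_one_mul]
    linarith [ih (I.prox η (x + η • v)) (I.evalObj Rs (I.prox η (x + η • v))).val.2
      (if best.2 < (I.evalObj Rs (I.prox η (x + η • v))).val.1
        then (I.prox η (x + η • v), (I.evalObj Rs (I.prox η (x + η • v))).val.1) else best)]

theorem proxGrad_time_le_mul_totalSize {Rs : List (List V)} (hne : ∀ R ∈ Rs, R ≠ [])
    (hpos : 0 < totalSize Rs) (a : ℝ) :
    (I.proxGrad Rs a).time ≤ (⌈3 * I.smoothness Rs * I.Δ ^ 2 / (4 * a)⌉₊ + 1) *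
      (39 * (totalSize Rs * (1 + Th) + (Tc + Tprox))) := by
  have hsizes := sizes_time_le hne
  have hobj := A.evalObj_time_le I.x₀ hne hpos
  have hd := A.dim_le_Tprox
  have hiter := A.iterate_time_le (1 / I.smoothness Rs) hne hpos
    ⌈3 * I.smoothness Rs * I.Δ ^ 2 / (4 * a)⌉₊ I.x₀ (I.evalObj Rs I.x₀).val.2
    (I.x₀, (I.evalObj Rs I.x₀).val.1)
  simp only [proxGrad, Timed.time_bind, time_tick]
  set T := ⌈3 * I.smoothness Rs * I.Δ ^ 2 / (4 * a)⌉₊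
  have hTh := Nat.zero_le (totalSize Rs * Th)
  have hloop := Nat.mul_le_mul_left T (show totalSize Rs * (3 * Th + 16) + Tc + 6 * Tprox ≤
    39 * (totalSize Rs * (1 + Th) + (Tc + Tprox)) by linarith)
  linarith

theorem le_smoothness {b : ℝ} (hb : b ≤ I.βh + I.Lh ^ 2) {Rs : List (List V)}
    (hne : ∀ R ∈ Rs, R ≠ []) (hpos : 0 < Rs.length) : I.n * b ≤ I.smoothness Rs := by
  rw [smoothness_eq, div_mul_eq_mul_div, le_div_iff₀ (Nat.cast_pos.2 hpos), mul_assoc]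
  refine mul_le_mul_of_nonneg_left ?_ I.n_nonneg
  calc b * Rs.length ≤ (I.βh + I.Lh ^ 2) * Rs.length := by gcongr
    _ = Rs.length * I.βh + Rs.length * I.Lh ^ 2 := by ring
    _ ≤ powSum 1 Rs * I.βh + powSum 2 Rs * I.Lh ^ 2 := add_le_add
      (mul_le_mul_of_nonneg_right (length_le_powSum 1 hne) A.βh_nonneg)
      (mul_le_mul_of_nonneg_right (length_le_powSum 2 hne) (sq_nonneg _))

theorem smoothness_mul_powSum_one_le {Rs : List (List V)} (hpos : 0 < Rs.length) :
    I.smoothness Rs * powSum 1 Rs ≤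
      I.n * (powSum 2 Rs * I.βh + powSum 3 Rs * I.Lh ^ 2) := by
  have : (0 : ℝ) < Rs.length := Nat.cast_pos.2 hpos
  calc I.smoothness Rs * powSum 1 Rs = I.n / Rs.length *
        (powSum 1 Rs * powSum 1 Rs * I.βh + powSum 2 Rs * powSum 1 Rs * I.Lh ^ 2) := by
        rw [smoothness_eq]; ring
    _ ≤ I.n / Rs.length *
        (Rs.length * powSum 2 Rs * I.βh + Rs.length * powSum 3 Rs * I.Lh ^ 2) :=
        mul_le_mul_of_nonneg_left (add_le_add
          (mul_le_mul_of_nonneg_right (powSum_mul_powSum_one_le 1 Rs) A.βh_nonneg)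
          (mul_le_mul_of_nonneg_right (powSum_mul_powSum_one_le 2 Rs) (sq_nonneg _)))
          (I.n_div_length_nonneg Rs)
    _ = I.n * (powSum 2 Rs * I.βh + powSum 3 Rs * I.Lh ^ 2) := by field_simp

theorem ceil_steps_add_one_le {b Δ₀ M a : ℝ} (hb : 0 < b) (hΔ : I.Δ ≤ Δ₀) (hM : I.n * b ≤ M)
    (ha : 0 < a) (han : a ≤ I.n) :
    (⌈3 * M * I.Δ ^ 2 / (4 * a)⌉₊ : ℝ) + 1 ≤ (Δ₀ ^ 2 + 2 / b) * (M / a) := by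
  have hn : 0 < I.n := ha.trans_le han
  have hM0 : 0 < M := (mul_pos hn hb).trans_le hM
  have hbM : b ≤ M / a := by
    rw [le_div_iff₀ ha, mul_comm]
    exact (mul_le_mul_of_nonneg_right han hb.le).trans hM
  have htwo : 2 ≤ 2 / b * (M / a) := by
    rw [div_mul_eq_mul_div, le_div_iff₀ hb]
    linarith
  have hΔsq : I.Δ ^ 2 ≤ Δ₀ ^ 2 := pow_le_pow_left₀ A.Δ_pos.le hΔ 2
  calc (⌈3 * M * I.Δ ^ 2 / (4 * a)⌉₊ : ℝ) + 1 ≤ 3 * M * I.Δ ^ 2 / (4 * a) + 1 + 1 := by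
        gcongr
        exact (Nat.ceil_lt_add_one (by positivity)).le
    _ = 3 / 4 * I.Δ ^ 2 * (M / a) + 2 := by field_simp; ring
    _ ≤ Δ₀ ^ 2 * (M / a) + 2 / b * (M / a) := by
        gcongr
        linarith [sq_nonneg I.Δ]
    _ = (Δ₀ ^ 2 + 2 / b) * (M / a) := by ring

theorem proxGrad_time_le {b Δ₀ : ℝ} (hb : 0 < b) (hbI : b ≤ I.βh + I.Lh ^ 2) (hΔ : I.Δ ≤ Δ₀)
    {Rs : List (List V)} (hne : ∀ R ∈ Rs, R ≠ []) (hpos : 0 < Rs.length) {a : ℝ} (ha : 0 < a)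
    (han : a ≤ I.n) :
    ((I.proxGrad Rs a).time : ℝ) ≤ 39 * (Δ₀ ^ 2 + 2 / b) / a *
      ((1 + Th) * I.n * (powSum 2 Rs * I.βh + powSum 3 Rs * I.Lh ^ 2) +
        (Tc + Tprox) * (I.n / Rs.length) * (powSum 1 Rs * I.βh + powSum 2 Rs * I.Lh ^ 2)) := by
  have hsmooth := A.le_smoothness hbI hne hpos
  have hpow := powSum_nonneg 1 Rs
  have htime : ((I.proxGrad Rs a).time : ℝ) ≤
      (⌈3 * I.smoothness Rs * I.Δ ^ 2 / (4 * a)⌉₊ + 1) *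
        (39 * (powSum 1 Rs * (1 + Th) + (Tc + Tprox))) := by
    rw [← cast_totalSize]
    exact_mod_cast A.proxGrad_time_le_mul_totalSize hne
      (hpos.trans_le (length_le_totalSize hne)) a
  calc ((I.proxGrad Rs a).time : ℝ)
      ≤ (Δ₀ ^ 2 + 2 / b) * (I.smoothness Rs / a) *
        (39 * (powSum 1 Rs * (1 + Th) + (Tc + Tprox))) := htime.trans <|
        mul_le_mul_of_nonneg_right (A.ceil_steps_add_one_le hb hΔ hsmooth ha han) (by positivity)
    _ = 39 * (Δ₀ ^ 2 + 2 / b) / a *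
        ((1 + Th) * (I.smoothness Rs * powSum 1 Rs) + (Tc + Tprox) * I.smoothness Rs) := by
        field_simp
    _ ≤ 39 * (Δ₀ ^ 2 + 2 / b) / a *
        ((1 + Th) * (I.n * (powSum 2 Rs * I.βh + powSum 3 Rs * I.Lh ^ 2)) +
          (Tc + Tprox) * I.smoothness Rs) := by
        gcongr _ * (_ * ?_ + _)
        exact A.smoothness_mul_powSum_one_le hpos
    _ = _ := by rw [smoothness_eq]; ring

end Assumptions

variable {V : Type} [Fintype V] [DecidableEq V] {d : ℕ} (I : Problem V d)

theorem rrMoment_nonneg (j : ℕ) : 0 ≤ I.rrMoment j :=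
  Finset.sum_nonneg fun _ _ => mul_nonneg (by positivity)
    (Finset.sum_nonneg fun _ _ => mul_nonneg ENNReal.toReal_nonneg (by positivity))

variable [Nonempty V]

theorem mean_ofReal_powSum_le (θ j : ℕ) :
    ((I.genRRs θ).mean fun Rs _ => ENNReal.ofReal (powSum j Rs)) ≤
      ENNReal.ofReal (θ * I.rrMoment j) := by
  simp only [ofReal_powSum]
  rw [mean_genRRs_sum, ENNReal.ofReal_mul (Nat.cast_nonneg _), ENNReal.ofReal_natCast]
  exact mul_le_mul_right (I.mean_genRR_length_pow_le j) _

theorem mean_ofReal_linear_powSum_le (θ : ℕ) {a₁ a₂ a₃ : ℝ} (h₁ : 0 ≤ a₁) (h₂ : 0 ≤ a₂)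
    (h₃ : 0 ≤ a₃) :
    ((I.genRRs θ).mean fun Rs _ =>
      ENNReal.ofReal (a₁ * powSum 1 Rs + a₂ * powSum 2 Rs + a₃ * powSum 3 Rs)) ≤
      ENNReal.ofReal (θ * (a₁ * I.rrMoment 1 + a₂ * I.rrMoment 2 + a₃ * I.rrMoment 3)) := by
  have hlinear {y₁ y₂ y₃ : ℝ} (hy₁ : 0 ≤ y₁) (hy₂ : 0 ≤ y₂) (hy₃ : 0 ≤ y₃) :
      ENNReal.ofReal (a₁ * y₁ + a₂ * y₂ + a₃ * y₃) = ENNReal.ofReal a₁ * ENNReal.ofReal y₁ +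
        ENNReal.ofReal a₂ * ENNReal.ofReal y₂ + ENNReal.ofReal a₃ * ENNReal.ofReal y₃ := by
    rw [ENNReal.ofReal_add (by positivity) (by positivity),
      ENNReal.ofReal_add (by positivity) (by positivity), ENNReal.ofReal_mul h₁,
      ENNReal.ofReal_mul h₂, ENNReal.ofReal_mul h₃]
  have hmoment (j : ℕ) : 0 ≤ θ * I.rrMoment j :=
    mul_nonneg (Nat.cast_nonneg _) (I.rrMoment_nonneg j)
  simp only [hlinear (powSum_nonneg 1 _) (powSum_nonneg 2 _) (powSum_nonneg 3 _), Prog.mean_add,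
    Prog.mean_const_mul]
  rw [show θ * (a₁ * I.rrMoment 1 + a₂ * I.rrMoment 2 + a₃ * I.rrMoment 3) =
    a₁ * (θ * I.rrMoment 1) + a₂ * (θ * I.rrMoment 2) + a₃ * (θ * I.rrMoment 3) by ring,
    hlinear (hmoment 1) (hmoment 2) (hmoment 3)]
  gcongr <;> exact I.mean_ofReal_powSum_le θ _

variable {I} {κ : ℝ} {Th Tc Tprox : ℕ}

theorem Assumptions.mean_proxGrad_time_le (A : I.Assumptions κ Th Tc Tprox) {b Δ₀ : ℝ}
    (hb : 0 < b) (hbI : b ≤ I.βh + I.Lh ^ 2) (hΔ : I.Δ ≤ Δ₀) {θ : ℕ} (hθ : 0 < θ) {a : ℝ}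
    (ha : 0 < a) (han : a ≤ I.n) :
    ((I.genRRs θ).mean fun Rs _ => ((I.proxGrad Rs a).time : ℝ≥0∞)) ≤
      ENNReal.ofReal (39 * (Δ₀ ^ 2 + 2 / b) / a *
        ((1 + Th) * I.n * θ * (I.rrMoment 2 * I.βh + I.rrMoment 3 * I.Lh ^ 2) +
          (Tc + Tprox) * (I.rrMoment 1 * I.n * I.βh + I.rrMoment 2 * I.n * I.Lh ^ 2))) := by
  have hn := I.n_pos
  have hβ := A.βh_nonneg
  have : (0 : ℝ) < θ := Nat.cast_pos.2 hθ
  set K := 39 * (Δ₀ ^ 2 + 2 / b) / a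
  have : 0 ≤ K := by positivity
  refine (I.mean_genRRs_mono θ (G := fun Rs _ => ENNReal.ofReal
    (K * ((Tc + Tprox) * (I.n / θ) * I.βh) * powSum 1 Rs +
      K * ((1 + Th) * I.n * I.βh + (Tc + Tprox) * (I.n / θ) * I.Lh ^ 2) * powSum 2 Rs +
      K * ((1 + Th) * I.n * I.Lh ^ 2) * powSum 3 Rs)) fun Rs _ hlen hne => ?_).trans
    ((I.mean_ofReal_linear_powSum_le θ (by positivity) (by positivity) (by positivity)).trans_eq
      (congrArg ENNReal.ofReal ?_))
  · rw [← ENNReal.ofReal_natCast]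
    refine ENNReal.ofReal_le_ofReal ?_
    refine (A.proxGrad_time_le hb hbI hΔ hne (hlen ▸ hθ) ha han).trans_eq ?_
    rw [hlen]
    ring
  · field_simp
    ring

end Problem

/-! ### Concentration -/

theorem exp_neg_le_one_sub_mul {x : ℝ} (h0 : 0 ≤ x) (h1 : x ≤ 1) :
    Real.exp (-x) ≤ 1 - 3 / 5 * x := by
  have hconv := convexOn_exp.2 (Set.mem_univ 0) (Set.mem_univ (-1 : ℝ)) (sub_nonneg.2 h1) h0
    (sub_add_cancel 1 x)
  have hexp : Real.exp (-1) ≤ 2 / 5 := Real.exp_neg_one_lt_d9.le.trans (by norm_num)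
  simp only [smul_eq_mul, mul_zero, zero_add, Real.exp_zero, mul_one, mul_neg] at hconv
  linarith [mul_le_mul_of_nonneg_left hexp h0]

namespace Problem

open TriggeringModel

section Miss

variable {V : Type} {d : ℕ} (I : Problem V d)

theorem prod_ofReal_exp_neg_hit (Rs : List (List V)) (x : Mix d) :
    (Rs.map fun R => ENNReal.ofReal (Real.exp (-(1 - I.miss R x)))).prod =
      ENNReal.ofReal (Real.exp (-I.hits Rs x)) := by
  induction Rs with
  | nil => simp
  | cons R Rs ih =>
    rw [List.map_cons, List.prod_cons, ih, ← ENNReal.ofReal_mul (Real.exp_pos _).le,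
      ← Real.exp_add, hits_cons, neg_add]

theorem indicator_hits_le (Rs : List (List V)) (x : Mix d) (Q : ℝ) :
    (if I.hits Rs x ≤ Q then 1 else 0 : ℝ≥0∞) ≤ ENNReal.ofReal (Real.exp Q) *
      (Rs.map fun R => ENNReal.ofReal (Real.exp (-(1 - I.miss R x)))).prod := by
  rw [prod_ofReal_exp_neg_hit, ← ENNReal.ofReal_mul (Real.exp_pos _).le, ← Real.exp_add]
  split_ifs with h
  · rw [ENNReal.one_le_ofReal, Real.one_le_exp_iff]
    linarith
  · exact zero_le

variable [Fintype V] [DecidableEq V]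

theorem miss_search (T : V → Finset V) (v : V) (x : Mix d) :
    I.miss (I.search T (Fintype.card V) [v] [v]).val x = ∏ u ∈ rrSet T v, (1 - I.h u x) := by
  obtain ⟨hnodup, hset, -⟩ := I.search_root_spec T v
  rw [← hset, List.prod_toFinset _ hnodup, miss]

variable [Nonempty V]

theorem g_div_n (x : Mix d) :
    I.g x / I.n = I.rootMean fun T v => 1 - ∏ u ∈ rrSet T v, (1 - I.h u x) := by
  rw [g_eq_rootMean, mul_div_cancel_left₀ _ I.n_pos.ne']

end Miss

namespace Assumptions

variable {V : Type} [Fintype V] [DecidableEq V] [Nonempty V] {d : ℕ} {I : Problem V d} {κ : ℝ}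
  {Th Tc Tprox : ℕ} (A : I.Assumptions κ Th Tc Tprox)

include A

theorem mean_exp_neg_hit_le {x : Mix d} (hx : x ∈ box I.u) :
    (I.genRR.mean fun R _ => ENNReal.ofReal (Real.exp (-(1 - I.miss R x)))) ≤
      ENNReal.ofReal (Real.exp (-(3 / 5 * (I.g x / I.n)))) := by
  refine (I.mean_genRR_le
    (f := fun T v => Real.exp (-(1 - ∏ u ∈ rrSet T v, (1 - I.h u x))))
    (fun T v => (Real.exp_pos _).le) fun T _ v => by rw [miss_search]).trans
    (ENNReal.ofReal_le_ofReal ?_)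
  calc (I.rootMean fun T v => Real.exp (-(1 - ∏ u ∈ rrSet T v, (1 - I.h u x))))
      ≤ I.rootMean fun T v => 1 + -(3 / 5) * (1 - ∏ u ∈ rrSet T v, (1 - I.h u x)) := by
        refine I.rootMean_mono fun T v => ?_
        have hmem := A.miss_mem hx (I.search T (Fintype.card V) [v] [v]).val
        rw [miss_search] at hmem
        refine (exp_neg_le_one_sub_mul (sub_nonneg.2 hmem.2) (sub_le_self 1 hmem.1)).trans_eq ?_
        ring
    _ = -(3 / 5 * (I.g x / I.n)) + 1 := by
        rw [rootMean_add, rootMean_const, rootMean_const_mul, ← g_div_n]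
        ring
    _ ≤ Real.exp (-(3 / 5 * (I.g x / I.n))) := Real.add_one_le_exp _

theorem hits_lower_tail {x : Mix d} (hx : x ∈ box I.u) (θ : ℕ) (Q : ℝ) :
    ((I.genRRs θ).mean fun Rs _ => if I.hits Rs x ≤ Q then 1 else 0) ≤
      ENNReal.ofReal (Real.exp (Q - 3 / 5 * θ * (I.g x / I.n))) :=
  calc ((I.genRRs θ).mean fun Rs _ => if I.hits Rs x ≤ Q then 1 else 0)
      ≤ ENNReal.ofReal (Real.exp Q) *
        (I.genRR.mean fun R _ => ENNReal.ofReal (Real.exp (-(1 - I.miss R x)))) ^ θ := by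
        rw [← mean_genRRs_prod, ← Prog.mean_const_mul]
        exact Prog.mean_mono _ fun Rs _ => I.indicator_hits_le Rs x Q
    _ ≤ ENNReal.ofReal (Real.exp Q) *
        ENNReal.ofReal (Real.exp (-(3 / 5 * (I.g x / I.n)))) ^ θ := by
        gcongr
        exact A.mean_exp_neg_hit_le hx
    _ = ENNReal.ofReal (Real.exp (Q - 3 / 5 * θ * (I.g x / I.n))) := by
        rw [← ENNReal.ofReal_pow (Real.exp_pos _).le, ← Real.exp_nat_mul,
          ← ENNReal.ofReal_mul (Real.exp_pos _).le, ← Real.exp_add]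
        congr 2
        ring

end Assumptions

end Problem

/-! ### Covering numbers -/

section Covering

open Metric

theorem exists_isCover_encard_eq {X : Type*} [PseudoEMetricSpace X] (r : ℝ≥0) (A : Set X) :
    ∃ C, IsCover r A C ∧ C.encard = externalCoveringNumber r A := by
  have : Nonempty {C : Set X // IsCover r A C} := ⟨⟨A, .refl r A⟩⟩
  obtain ⟨C, hC⟩ := ENat.exists_eq_iInf fun C : {C : Set X // IsCover r A C} => C.1.encard
  exact ⟨C, C.2, by rw [hC, externalCoveringNumber, iInf_subtype]⟩

theorem externalCoveringNumber_ne_top_of_isBounded {X : Type*} [PseudoMetricSpace X]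
    [ProperSpace X] {r : ℝ≥0} {A : Set X} (hA : Bornology.IsBounded A) (hr : r ≠ 0) :
    externalCoveringNumber r A ≠ ⊤ := by
  obtain ⟨C, -, hfin, hC⟩ := exists_finite_isCover_of_isCompact_closure hr hA.isCompact_closure
  exact ne_top_of_le_ne_top hfin.encard_lt_top.ne hC.externalCoveringNumber_le_encard

variable {E : Type*} [NormedAddCommGroup E] [NormedSpace ℝ E] {r δ : ℝ≥0} {A : Set E}

theorem isCover_image2_add_smul (hr : r ≠ 0) {B C : Set E} (hB : IsCover r A B)
    (hC : IsCover δ (closedBall 0 1) C) :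
    IsCover (r * δ) A (Set.image2 (fun y c => y + (r : ℝ) • c) B C) := by
  have hr' : (0 : ℝ) < r := NNReal.coe_pos.2 (pos_iff_ne_zero.2 hr)
  rw [isCover_iff_subset_iUnion_closedBall] at hB hC ⊢
  intro a ha
  obtain ⟨y, hy, hay⟩ := Set.mem_iUnion₂.1 (hB ha)
  have hunit : (r : ℝ)⁻¹ • (a - y) ∈ closedBall (0 : E) 1 := by
    rw [mem_closedBall_zero_iff, norm_smul, norm_inv, Real.norm_of_nonneg hr'.le,
      inv_mul_le_one₀ hr', ← dist_eq_norm]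
    exact hay
  obtain ⟨c, hc, hac⟩ := Set.mem_iUnion₂.1 (hC hunit)
  refine Set.mem_iUnion₂.2 ⟨_, Set.mem_image2_of_mem hy hc, ?_⟩
  have hscale : a - (y + (r : ℝ) • c) = (r : ℝ) • ((r : ℝ)⁻¹ • (a - y) - c) := by
    rw [smul_sub, smul_inv_smul₀ hr'.ne', sub_sub]
  rw [mem_closedBall, dist_eq_norm, hscale, norm_smul, Real.norm_of_nonneg hr'.le, ← dist_eq_norm,
    NNReal.coe_mul]
  exact mul_le_mul_of_nonneg_left hac hr'.le

theorem externalCoveringNumber_mul_le (hr : r ≠ 0) :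
    externalCoveringNumber (r * δ) A ≤
      externalCoveringNumber δ (closedBall (0 : E) 1) * externalCoveringNumber r A := by
  obtain ⟨B, hB, hBcard⟩ := exists_isCover_encard_eq r A
  obtain ⟨C, hC, hCcard⟩ := exists_isCover_encard_eq δ (closedBall (0 : E) 1)
  calc externalCoveringNumber (r * δ) A
      ≤ (Set.image2 (fun y c => y + (r : ℝ) • c) B C).encard :=
        (isCover_image2_add_smul hr hB hC).externalCoveringNumber_le_encard
    _ ≤ (B ×ˢ C).encard := by
        rw [← Set.image_prod]
        exact Set.encard_image_le _ _
    _ = _ := by rw [Set.encard_prod, hBcard, hCcard, mul_comm]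

end Covering

/-- The number of balls of radius `1 / 3` that cover the unit ball of `Mix d`: the factor by which
a covering number grows at most when the radius is divided by `3`. -/
def ballCovering (d : ℕ) : ℕ :=
  (Metric.externalCoveringNumber (1 / 3) (Metric.closedBall (0 : Mix d) 1)).toNat

theorem coe_ballCovering (d : ℕ) : (ballCovering d : ℕ∞) =
    Metric.externalCoveringNumber (1 / 3) (Metric.closedBall (0 : Mix d) 1) :=
  ENat.natCast_toNat
    (externalCoveringNumber_ne_top_of_isBounded Metric.isBounded_closedBall (by norm_num))

theorem one_le_ballCovering (d : ℕ) : 1 ≤ ballCovering d := by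
  have : 0 < (ballCovering d : ℕ∞) := by
    rw [coe_ballCovering, Metric.externalCoveringNumber_pos_iff]
    exact Metric.nonempty_closedBall.2 zero_le_one
  exact_mod_cast this

namespace Problem

section Feasible

variable {V : Type} [Fintype V] [DecidableEq V] {d : ℕ} {I : Problem V d} {κ : ℝ}
  {Th Tc Tprox : ℕ} (A : I.Assumptions κ Th Tc Tprox)

include A

theorem Assumptions.coe_toNat_externalCoveringNumber {r : ℝ≥0} (hr : r ≠ 0) :
    ((Metric.externalCoveringNumber r I.feasible).toNat : ℕ∞) =
      Metric.externalCoveringNumber r I.feasible :=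
  ENat.natCast_toNat <| externalCoveringNumber_ne_top_of_isBounded
    (Metric.isBounded_iff.2 ⟨I.Δ, fun x hx y hy => dist_eq_norm x y ▸ A.dist_le x hx y hy⟩) hr

theorem Assumptions.one_le_covering {r : ℝ} (hr : 0 < r) : 1 ≤ I.covering r := by
  have hpos : 0 < Metric.externalCoveringNumber r.toNNReal I.feasible :=
    Metric.externalCoveringNumber_pos_iff.2 ⟨_, A.x₀_mem⟩
  rw [← A.coe_toNat_externalCoveringNumber (Real.toNNReal_pos.2 hr).ne'] at hpos
  unfold covering
  exact_mod_cast hpos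

theorem Assumptions.covering_anti {r r' : ℝ} (hr : 0 < r) (h : r ≤ r') :
    I.covering r' ≤ I.covering r := by
  have hanti := Metric.externalCoveringNumber_anti (A := I.feasible) (Real.toNNReal_le_toNNReal h)
  rw [← A.coe_toNat_externalCoveringNumber (Real.toNNReal_pos.2 hr).ne',
    ← A.coe_toNat_externalCoveringNumber (Real.toNNReal_pos.2 (hr.trans_le h)).ne'] at hanti
  unfold covering
  exact_mod_cast hanti

theorem Assumptions.covering_le_ballCovering_mul {r : ℝ} (hr : 0 < r) :
    I.covering r ≤ ballCovering d * I.covering (3 * r) := by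
  have hr' := Real.toNNReal_pos.2 hr
  have hr3 := Real.toNNReal_pos.2 (mul_pos three_pos hr)
  have hthird : (3 * r).toNNReal * (1 / 3) = r.toNNReal := by
    rw [Real.toNNReal_mul zero_le_three, Real.toNNReal_ofNat, mul_right_comm,
      mul_one_div_cancel three_ne_zero, one_mul]
  have hmul := externalCoveringNumber_mul_le (δ := 1 / 3) (A := I.feasible) hr3.ne'
  rw [hthird, ← A.coe_toNat_externalCoveringNumber hr'.ne',
    ← A.coe_toNat_externalCoveringNumber hr3.ne', ← coe_ballCovering] at hmul
  unfold covering
  exact_mod_cast hmul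

end Feasible

/-! ### The optimum, the guesses and the numbers of RR sets -/

theorem ε'_sq {V : Type} {d : ℕ} (I : Problem V d) : I.ε' ^ 2 = 2 / 9 * I.ε ^ 2 := by
  rw [ε', div_pow, mul_pow, Real.sq_sqrt zero_le_two]
  ring

section Defs

variable {V : Type} [Fintype V] {d : ℕ} (I : Problem V d)

/-- `ln (n ^ ℓ 𝒩(𝒫, r))` for `r = ε / (6 L)`, the smallest radius that the algorithm uses. -/
def logCover : ℝ := Real.log (I.n ^ I.ℓ * I.covering (I.ε / 3 / (I.L + I.L)))

/-- The logarithmic factor of `θ_i`. -/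
def thetaLog (i : ℕ) : ℝ :=
  Real.log (I.covering (I.ε / 3 / I.L * I.guess i)) + I.ℓ * Real.log I.n + Real.log 2 +
    Real.log (Real.logb 2 (I.n + I.lam * I.k))

theorem guess_succ (i : ℕ) : I.guess (i + 1) = I.guess i / 2 := by
  rw [guess, guess, pow_succ, div_div]

end Defs

namespace Assumptions

variable {V : Type} [Fintype V] [DecidableEq V] {d : ℕ} {I : Problem V d} {κ : ℝ}
  {Th Tc Tprox : ℕ} (A : I.Assumptions κ Th Tc Tprox)

include A

theorem L_pos : 0 < I.L :=
  add_pos_of_pos_of_nonneg (mul_pos (pow_pos (two_pos.trans_le A.two_le_n) 2) A.Lh_pos)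
    (mul_nonneg A.lam_nonneg A.Lc_nonneg)

theorem radius_pos : 0 < I.ε / 3 / (I.L + I.L) :=
  div_pos (div_pos A.ε_pos three_pos) (add_pos A.L_pos A.L_pos)

theorem k_nonneg : 0 ≤ I.k := (A.c_nonneg _ A.x₀_mem.1).trans A.x₀_mem.2

theorem two_le_n_add : 2 ≤ I.n + I.lam * I.k :=
  le_add_of_le_of_nonneg A.two_le_n (mul_nonneg A.lam_nonneg A.k_nonneg)

theorem n_add_le_two_mul : I.n + I.lam * I.k ≤ 2 * I.n := by linarith [A.lam_mul_k_le]

theorem two_le_n_rpow : 2 ≤ I.n ^ I.ℓ := A.two_le_n_add.trans A.n_add_le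

theorem one_le_logb : 1 ≤ Real.logb 2 (I.n + I.lam * I.k) := by
  rw [Real.le_logb_iff_rpow_le one_lt_two (two_pos.trans_le A.two_le_n_add), Real.rpow_one]
  exact A.two_le_n_add

theorem exists_isOpt : ∃ x ∈ I.feasible, I.g x + I.s x = I.OPT := by
  obtain ⟨x, hx, h⟩ := A.opt_attained
  have hmax : IsGreatest ((fun x => I.g x + I.s x) '' I.feasible) (I.g x + I.s x) :=
    ⟨Set.mem_image_of_mem _ hx, Set.forall_mem_image.2 h⟩
  exact ⟨x, hx, hmax.csSup_eq.symm⟩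

theorem spread_le_OPT (v : V) : I.spread {v} ≤ I.OPT := by
  obtain ⟨x, hx, h⟩ := A.spread_le v
  obtain ⟨y, -, hmax⟩ := A.opt_attained
  have hbdd : BddAbove ((fun x => I.g x + I.s x) '' I.feasible) :=
    ⟨I.g y + I.s y, Set.forall_mem_image.2 hmax⟩
  exact (le_add_of_le_of_nonneg h (A.s_nonneg hx)).trans
    (le_csSup hbdd (Set.mem_image_of_mem _ hx))

theorem one_le_OPT [Nonempty V] : 1 ≤ I.OPT :=
  (I.one_le_spread_singleton (Classical.arbitrary V)).trans (A.spread_le_OPT _)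

theorem OPT_le [Nonempty V] : I.OPT ≤ I.n + I.lam * I.k := by
  obtain ⟨x, hx, h⟩ := A.exists_isOpt
  rw [← h, g_eq_rootMean]
  refine add_le_add (mul_le_of_le_one_right I.n_nonneg ?_) (A.s_le hx)
  refine (I.rootMean_mono (f' := fun _ _ => 1) fun T v => sub_le_self 1 ?_).trans
    (I.rootMean_const 1).le
  exact Finset.prod_nonneg fun u _ => sub_nonneg.2 (A.h_mem u x (A.dom_subset hx.1)).2

theorem guess_pos (i : ℕ) : 0 < I.guess i :=
  div_pos (two_pos.trans_le A.two_le_n_add) (pow_pos two_pos i)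

theorem two_le_guess {i : ℕ} (h : i ≤ I.numRounds) : 2 ≤ I.guess i := by
  have hX := two_pos.trans_le A.two_le_n_add
  have hlog : ((i + 1 : ℕ) : ℝ) ≤ Real.logb 2 (I.n + I.lam * I.k) := by
    rw [Nat.cast_succ, ← le_sub_iff_add_le]
    exact (Nat.le_floor_iff (sub_nonneg.2 A.one_le_logb)).1 h
  rw [Real.le_logb_iff_rpow_le one_lt_two hX, Real.rpow_natCast] at hlog
  rw [guess, le_div_iff₀ (by positivity), ← pow_succ']
  exact hlog

theorem guess_last_le : I.guess (I.numRounds + 1) ≤ 2 := by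
  have hX := two_pos.trans_le A.two_le_n_add
  have hlog : Real.logb 2 (I.n + I.lam * I.k) < ((I.numRounds + 2 : ℕ) : ℝ) := by
    have : Real.logb 2 (I.n + I.lam * I.k) - 1 < I.numRounds + 1 := Nat.lt_floor_add_one _
    push_cast
    linarith
  rw [Real.logb_lt_iff_lt_rpow one_lt_two hX, Real.rpow_natCast] at hlog
  rw [guess, div_le_iff₀ (by positivity), ← pow_succ']
  exact hlog.le

theorem guess_le {i : ℕ} (hi : 1 ≤ i) : I.guess i ≤ I.n := by
  rw [guess, div_le_iff₀ (by positivity), mul_comm I.n]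
  refine A.n_add_le_two_mul.trans (mul_le_mul_of_nonneg_right ?_ I.n_nonneg)
  exact le_self_pow₀ one_le_two (Nat.one_le_iff_ne_zero.1 hi)

theorem ε'_pos : 0 < I.ε' := by
  have := A.ε_pos
  unfold ε'
  positivity

theorem ε'_le : I.ε' ≤ I.ε / 2 :=
  abs_le_of_sq_le_sq' (by rw [ε'_sq]; linarith [sq_nonneg I.ε]) (half_pos A.ε_pos).le |>.2

theorem log_mul_covering_mem {r : ℝ} (hr : I.ε / 3 / (I.L + I.L) ≤ r) :
    Real.log (I.n ^ I.ℓ * I.covering r) ∈ Set.Icc (Real.log 2) I.logCover := by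
  have h2 : 2 ≤ I.n ^ I.ℓ * I.covering r :=
    A.two_le_n_rpow.trans (le_mul_of_one_le_right (zero_le_two.trans A.two_le_n_rpow)
      (A.one_le_covering (A.radius_pos.trans_le hr)))
  refine ⟨Real.log_le_log two_pos h2, Real.log_le_log (two_pos.trans_le h2) ?_⟩
  exact mul_le_mul_of_nonneg_left (A.covering_anti A.radius_pos hr)
    (zero_le_two.trans A.two_le_n_rpow)

theorem log_two_le_logCover : Real.log 2 ≤ I.logCover := (A.log_mul_covering_mem le_rfl).1

theorem half_le_logCover : 1 / 2 ≤ I.logCover := by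
  linarith [A.log_two_le_logCover, Real.log_two_gt_d9]

theorem log_n_rpow_le_logCover : Real.log (I.n ^ I.ℓ) ≤ I.logCover := by
  have hn := two_pos.trans_le A.two_le_n_rpow
  exact Real.log_le_log hn (le_mul_of_one_le_right hn.le (A.one_le_covering A.radius_pos))

theorem log_logb_mem : Real.log (Real.logb 2 (I.n + I.lam * I.k)) ∈
    Set.Icc 0 (Real.log 2 + I.logCover) := by
  have hX := two_pos.trans_le A.two_le_n_add
  refine ⟨Real.log_nonneg A.one_le_logb, ?_⟩
  have hlogb : Real.logb 2 (I.n + I.lam * I.k) ≤ 2 * I.n ^ I.ℓ := by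
    rw [Real.logb, div_le_iff₀ (Real.log_pos one_lt_two)]
    calc Real.log (I.n + I.lam * I.k) ≤ I.n ^ I.ℓ :=
          (Real.log_le_self hX.le).trans A.n_add_le
      _ ≤ I.n ^ I.ℓ * (2 * Real.log 2) := le_mul_of_one_le_right (hX.le.trans A.n_add_le)
          (by linarith [Real.log_two_gt_d9])
      _ = 2 * I.n ^ I.ℓ * Real.log 2 := by ring
  calc Real.log (Real.logb 2 (I.n + I.lam * I.k)) ≤ Real.log (2 * I.n ^ I.ℓ) :=
        Real.log_le_log (one_pos.trans_le A.one_le_logb) hlogb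
    _ = Real.log 2 + Real.log (I.n ^ I.ℓ) :=
        Real.log_mul two_ne_zero (hX.trans_le A.n_add_le).ne'
    _ ≤ Real.log 2 + I.logCover := by gcongr; exact A.log_n_rpow_le_logCover

theorem thetaLog_mem {i : ℕ} (h : i ≤ I.numRounds) :
    I.thetaLog i ∈ Set.Icc (2 * Real.log 2) (4 * I.logCover) := by
  have hε := A.ε_pos
  have hL := A.L_pos
  have hr : I.ε / 3 / (I.L + I.L) ≤ I.ε / 3 / I.L * I.guess i := by
    refine (div_le_div_of_nonneg_left (by positivity) hL (by linarith)).trans ?_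
    exact le_mul_of_one_le_right (by positivity) (one_le_two.trans (A.two_le_guess h))
  have hcov : 0 < I.covering (I.ε / 3 / I.L * I.guess i) :=
    one_pos.trans_le (A.one_le_covering (A.radius_pos.trans_le hr))
  have hnum : I.thetaLog i = Real.log (I.n ^ I.ℓ * I.covering (I.ε / 3 / I.L * I.guess i)) +
      Real.log 2 + Real.log (Real.logb 2 (I.n + I.lam * I.k)) := by
    rw [Real.log_mul (two_pos.trans_le A.two_le_n_rpow).ne' hcov.ne',
      Real.log_rpow (two_pos.trans_le A.two_le_n), thetaLog]
    ring
  obtain ⟨hlower, hupper⟩ := A.log_mul_covering_mem hr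
  obtain ⟨hloglog, hloglog'⟩ := A.log_logb_mem
  rw [hnum]
  constructor <;> linarith [A.log_two_le_logCover]

theorem twelve_mul_n_le_theta_mul_guess {i : ℕ} (h : i ≤ I.numRounds) :
    12 * I.n ≤ I.theta i * I.guess i := by
  have hn := I.n_nonneg
  have hg := A.guess_pos i
  have hε' := A.ε'_pos
  have hlog : 4 / 3 ≤ I.thetaLog i := by linarith [(A.thetaLog_mem h).1, Real.log_two_gt_d9]
  have hsq : I.ε' ^ 2 ≤ 1 / 18 := by
    rw [ε'_sq]
    linarith [pow_le_pow_left₀ A.ε_pos.le A.ε_lt.le 2]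
  refine le_trans ?_ (mul_le_mul_of_nonneg_right (Nat.le_ceil _) hg.le)
  change 12 * I.n ≤ I.n * (2 + 2 / 3 * I.ε') * I.thetaLog i / (I.ε' ^ 2 * I.guess i) * I.guess i
  rw [← div_div, div_mul_cancel₀ _ hg.ne', le_div_iff₀ (by positivity)]
  calc 12 * I.n * I.ε' ^ 2 ≤ 12 * I.n * (1 / 18) := by gcongr
    _ ≤ I.n * 2 * (4 / 3) := by linarith
    _ ≤ I.n * (2 + 2 / 3 * I.ε') * I.thetaLog i := by
        gcongr
        linarith

theorem one_le_n_mul_logCover_div {x : ℝ} (hx : 0 < x) (hxn : x ≤ 2 * I.n) :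
    1 ≤ I.n * I.logCover / (I.ε ^ 2 * x) := by
  have hε := A.ε_pos
  rw [one_le_div (by positivity)]
  calc I.ε ^ 2 * x ≤ (1 / 2) ^ 2 * (2 * I.n) := by
        gcongr
        exact A.ε_lt.le
    _ = I.n * (1 / 2) := by ring
    _ ≤ I.n * I.logCover := mul_le_mul_of_nonneg_left A.half_le_logCover I.n_nonneg

theorem theta_le {i : ℕ} (hi : 1 ≤ i) (h : i ≤ I.numRounds) :
    (I.theta i : ℝ) ≤ 46 * (I.n * I.logCover / (I.ε ^ 2 * I.guess i)) := by
  have hn := I.n_nonneg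
  have hg := A.guess_pos i
  have hε := A.ε_pos
  have hε' := A.ε'_pos
  have hlogCover := A.half_le_logCover
  obtain ⟨hlog, hlog'⟩ := A.thetaLog_mem h
  have hlog_nonneg : 0 ≤ I.thetaLog i := (by positivity : 0 ≤ 2 * Real.log 2).trans hlog
  have hratio : I.n * (2 + 2 / 3 * I.ε') * I.thetaLog i / (I.ε' ^ 2 * I.guess i) ≤
      45 * (I.n * I.logCover / (I.ε ^ 2 * I.guess i)) :=
    calc I.n * (2 + 2 / 3 * I.ε') * I.thetaLog i / (I.ε' ^ 2 * I.guess i)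
        ≤ I.n * (5 / 2) * (4 * I.logCover) / (2 / 9 * I.ε ^ 2 * I.guess i) := by
          rw [ε'_sq]
          gcongr
          linarith [A.ε'_le, A.ε_lt]
      _ = 45 * (I.n * I.logCover / (I.ε ^ 2 * I.guess i)) := by
          field_simp
          ring
  have hceil := Nat.ceil_lt_add_one
    (a := I.n * (2 + 2 / 3 * I.ε') * I.thetaLog i / (I.ε' ^ 2 * I.guess i)) (by positivity)
  change (I.theta i : ℝ) < _ at hceil
  linarith [A.one_le_n_mul_logCover_div hg (by linarith [A.guess_le hi])]

theorem log_four_mul_mul_covering_mem {r : ℝ} (hr : I.ε / 3 / (I.L + I.L) ≤ r) :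
    Real.log (4 * I.n ^ I.ℓ * I.covering r) ∈ Set.Icc 0 (3 * I.logCover) := by
  have hcov := A.one_le_covering (A.radius_pos.trans_le hr)
  have hn := two_pos.trans_le A.two_le_n_rpow
  have hlog4 : Real.log 4 = 2 * Real.log 2 := by
    rw [show (4 : ℝ) = 2 ^ 2 by norm_num, Real.log_pow, Nat.cast_ofNat]
  obtain ⟨hlower, hupper⟩ := A.log_mul_covering_mem hr
  rw [mul_assoc, Real.log_mul four_ne_zero (by positivity), hlog4]
  constructor <;> linarith [A.log_two_le_logCover, Real.log_two_gt_d9]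

theorem log_four_mul_n_rpow_le : Real.log (4 * I.n ^ I.ℓ) ≤ 3 * I.logCover := by
  have hn := two_pos.trans_le A.two_le_n_rpow
  exact (Real.log_le_log (by positivity) (le_mul_of_one_le_right (by positivity)
    (A.one_le_covering A.radius_pos))).trans (A.log_four_mul_mul_covering_mem le_rfl).2

theorem theta1_pos {LB : ℝ} (hLB : 0 < LB) : 0 < I.theta1 LB := by
  have hn := two_pos.trans_le A.two_le_n
  have hε := A.ε_pos
  have hα : 0 < 1 / 2 - I.ε / 3 := by linarith [A.ε_lt]
  have hlog : 0 < Real.log (4 * I.n ^ I.ℓ) := Real.log_pos (by linarith [A.two_le_n_rpow])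
  unfold theta1
  positivity

theorem theta1_le {LB : ℝ} (hLB : 0 < LB) :
    I.theta1 LB ≤ 1944 * (I.n * I.logCover / (I.ε ^ 2 * LB)) := by
  have hn := I.n_nonneg
  have hε := A.ε_pos
  have hα : 1 / 3 ≤ 1 / 2 - I.ε / 3 := by linarith [A.ε_lt]
  have hlogCover := A.half_le_logCover
  calc I.theta1 LB ≤ 8 * I.n * (3 * I.logCover) / (LB * ((1 / 3) ^ 2 * I.ε ^ 2 / 9)) := by
        unfold theta1
        gcongr
        exact A.log_four_mul_n_rpow_le
    _ = 1944 * (I.n * I.logCover / (I.ε ^ 2 * LB)) := by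
        field_simp
        ring

theorem theta2_le {LB : ℝ} (hLB : 1 ≤ LB) :
    I.theta2 LB ≤ 1944 * (I.n * I.logCover / (I.ε ^ 2 * LB)) := by
  have hn := I.n_nonneg
  have hε := A.ε_pos
  have hε_lt := A.ε_lt
  have hlogCover := A.half_le_logCover
  obtain ⟨hlog, hlog'⟩ := A.log_four_mul_mul_covering_mem (r := I.ε / 3 / (I.L + I.L) * LB)
    (le_mul_of_one_le_right A.radius_pos.le hLB)
  have hden : I.ε / 4 ≤ I.ε / 3 - 1 / 4 * (1 / 2 - I.ε / 3) ^ 2 * (I.ε / 3) := by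
    have : (1 / 2 - I.ε / 3) ^ 2 ≤ 1 := pow_le_one₀ (by linarith) (by linarith)
    linarith [mul_le_mul_of_nonneg_right this hε.le]
  calc I.theta2 LB ≤ 2 * (1 / 2) * I.n * (3 * I.logCover) / ((I.ε / 4) ^ 2 * LB) := by
        unfold theta2
        gcongr
        linarith
    _ = 48 * (I.n * I.logCover / (I.ε ^ 2 * LB)) := by
        field_simp
        ring
    _ ≤ 1944 * (I.n * I.logCover / (I.ε ^ 2 * LB)) :=
        mul_le_mul_of_nonneg_right (by norm_num) (by positivity)

theorem ceil_max_theta_le {LB : ℝ} (hLB : 1 ≤ LB) (hLB' : LB ≤ 2 * I.n) :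
    (⌈max (I.theta1 LB) (I.theta2 LB)⌉₊ : ℝ) ≤
      1945 * (I.n * I.logCover / (I.ε ^ 2 * LB)) := by
  have hLB0 := one_pos.trans_le hLB
  have hceil := Nat.ceil_lt_add_one ((A.theta1_pos hLB0).le.trans (le_max_left _ (I.theta2 LB)))
  linarith [max_le (A.theta1_le hLB0) (A.theta2_le hLB), A.one_le_n_mul_logCover_div hLB0 hLB']

end Assumptions

/-! ### One sampling phase -/

section PhaseCost

variable {D n ε x Λ θ : ℝ}

theorem sampling_cost_le {κ m o : ℝ} (hκ : 0 ≤ κ) (hn : 0 < n) (hm : 0 ≤ m) (ho : 1 ≤ o)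
    (hθ : 1 ≤ θ) (hθ' : θ ≤ 1945 * (n * Λ / (ε ^ 2 * x))) :
    40 + θ * ((κ + 8) * (m + n) / n * o + 1) ≤
      1945 * (κ + 49) * ((m + n) * Λ * o / ε ^ 2 / x) := by
  have hmn : 1 ≤ (m + n) / n * o :=
    one_le_mul_of_one_le_of_one_le ((one_le_div hn).2 (le_add_of_nonneg_left hm)) ho
  calc 40 + θ * ((κ + 8) * (m + n) / n * o + 1)
      ≤ 40 * (θ * ((m + n) / n * o)) +
          θ * ((κ + 8) * (m + n) / n * o + (m + n) / n * o) := by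
        gcongr
        exact le_mul_of_one_le_right (by norm_num) (one_le_mul_of_one_le_of_one_le hθ hmn)
    _ = θ * ((κ + 49) * ((m + n) / n * o)) := by ring
    _ ≤ 1945 * (n * Λ / (ε ^ 2 * x)) * ((κ + 49) * ((m + n) / n * o)) := by gcongr
    _ = 1945 * (κ + 49) * ((m + n) * Λ * o / ε ^ 2 / x) := by field_simp

theorem gradient_cost_le {p w y z a : ℝ} (hD : 0 ≤ D) (hp : 0 ≤ p) (hw : 0 ≤ w)
    (hy : 0 ≤ y) (hz : 0 ≤ z) (hn : 0 < n) (hε : 0 < ε) (hx : 0 < x)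
    (hθ_nonneg : 0 ≤ θ) (hθ : θ ≤ 1945 * (n * Λ / (ε ^ 2 * x))) (ha : ε * x / 3 ≤ a) :
    39 * D / a * (p * n * θ * y + w * z) ≤
      1945 * (117 * D) * (p * n ^ 2 * y * Λ / ε ^ 3 / x ^ 2 + w * z / ε / x) := by
  have ha' : 0 < ε * x / 3 := by positivity
  have : 0 < a := ha'.trans_le ha
  calc 39 * D / a * (p * n * θ * y + w * z)
      ≤ 39 * D / (ε * x / 3) *
          (p * n * (1945 * (n * Λ / (ε ^ 2 * x))) * y + 1945 * (w * z)) := by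
        have : w * z ≤ 1945 * (w * z) :=
          le_mul_of_one_le_left (mul_nonneg hw hz) (by norm_num)
        gcongr
    _ = 1945 * (117 * D) * (p * n ^ 2 * y * Λ / ε ^ 3 / x ^ 2 + w * z / ε / x) := by
        field_simp
        ring

end PhaseCost

variable {V : Type} [Fintype V] [DecidableEq V] {d : ℕ} (I : Problem V d)

/-- The coefficient of `1 / x ^ 2` in the mean cost of a phase at scale `x`: the evaluation of the
strategy activation functions and of their gradients. -/
def evalCoeff (Th : ℕ) : ℝ :=
  (1 + Th) * I.n ^ 2 * (I.rrMoment 2 * I.βh + I.rrMoment 3 * I.Lh ^ 2) * I.logCover / I.ε ^ 3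

/-- A coefficient of `1 / x` in the mean cost of a phase at scale `x`: the evaluation of the cost
and the proximal steps. -/
def proxCoeff (Tc Tprox : ℕ) : ℝ :=
  (Tc + Tprox) * (I.rrMoment 1 * I.n * I.βh + I.rrMoment 2 * I.n * I.Lh ^ 2) / I.ε

/-- A coefficient of `1 / x` in the mean cost of a phase at scale `x`: the generation of the RR
sets. -/
def sampleCoeff : ℝ := (I.numEdges + I.n) * I.logCover * I.OPT / I.ε ^ 2

/-- The constant factor of the mean cost of a phase. -/
def phaseConst (κ Δ₀ b : ℝ) : ℝ := 1945 * (κ + 49) + 1945 * (117 * (Δ₀ ^ 2 + 2 / b))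

/-- A bound on the mean cost of a phase at scale `x`, that is, with `O (n logCover / (ε ^ 2 x))`
RR sets and with an additive error of the order of `ε x`. -/
def phaseBound (κ Δ₀ b : ℝ) (Th Tc Tprox : ℕ) (x : ℝ) : ℝ :=
  phaseConst κ Δ₀ b *
    (I.evalCoeff Th / x ^ 2 + (I.proxCoeff Tc Tprox + I.sampleCoeff) / x)

/-- The mean time of a phase with `θ` RR sets and with the additive error `a`. -/
def phaseTime [Nonempty V] (θ : ℕ) (a : ℝ) : ℝ≥0∞ :=
  (I.genRRs θ).mean fun Rs t => 40 + ((t : ℝ≥0∞) + ((I.proxGrad Rs a).time : ℝ≥0∞))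

theorem phaseConst_nonneg {κ Δ₀ b : ℝ} (hκ : 0 ≤ κ) (hb : 0 < b) : 0 ≤ phaseConst κ Δ₀ b := by
  unfold phaseConst
  positivity

variable {I} {κ Δ₀ b : ℝ} {Th Tc Tprox : ℕ} (A : I.Assumptions κ Th Tc Tprox)

namespace Assumptions

include A

theorem evalCoeff_nonneg : 0 ≤ I.evalCoeff Th := by
  have hmoment₂ := I.rrMoment_nonneg 2
  have hmoment₃ := I.rrMoment_nonneg 3
  have hβ := A.βh_nonneg
  have hε := A.ε_pos
  have hlogCover := A.half_le_logCover
  unfold evalCoeff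
  positivity

theorem proxCoeff_nonneg : 0 ≤ I.proxCoeff Tc Tprox := by
  have hmoment₁ := I.rrMoment_nonneg 1
  have hmoment₂ := I.rrMoment_nonneg 2
  have hβ := A.βh_nonneg
  have hε := A.ε_pos
  have hn := I.n_nonneg
  unfold proxCoeff
  positivity

variable [Nonempty V]

theorem sampleCoeff_nonneg : 0 ≤ I.sampleCoeff := by
  have hn := I.n_nonneg
  have hlogCover := A.half_le_logCover
  have hOPT := A.one_le_OPT
  unfold sampleCoeff
  positivity

section PhaseTime

variable {θ : ℕ} {x a : ℝ} (hx : 0 < x)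
  (hθx : (θ : ℝ) ≤ 1945 * (I.n * I.logCover / (I.ε ^ 2 * x))) (hκ : 0 ≤ κ) (hb : 0 < b)
  (hbI : b ≤ I.βh + I.Lh ^ 2) (hΔ : I.Δ ≤ Δ₀) (hθ : 0 < θ) (hxa : I.ε * x / 3 ≤ a)
  (han : a ≤ I.n)

include hκ hθ hθx in
theorem mean_genRRs_time_le_sampleCoeff :
    ((I.genRRs θ).mean fun _ t => 40 + (t : ℝ≥0∞)) ≤
      ENNReal.ofReal (1945 * (κ + 49) * (I.sampleCoeff / x)) := by
  have hn := I.n_nonneg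
  have hOPT := A.one_le_OPT
  rw [Prog.mean_add, Prog.mean_const, mean_genRRs_time]
  calc 40 + (θ : ℝ≥0∞) * ((I.genRR.mean fun _ t => (t : ℝ≥0∞)) + 1)
      ≤ 40 + (θ : ℝ≥0∞) *
          (ENNReal.ofReal ((κ + 8) * (I.numEdges + I.n) / I.n * I.OPT) + 1) := by
        gcongr
        exact I.mean_genRR_time_le hκ A.spread_le_OPT A.timeTrig_le
    _ = ENNReal.ofReal (40 + θ * ((κ + 8) * (I.numEdges + I.n) / I.n * I.OPT + 1)) := by
        rw [ENNReal.ofReal_add (by norm_num) (by positivity),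
          ENNReal.ofReal_mul (Nat.cast_nonneg _), ENNReal.ofReal_add (by positivity) zero_le_one,
          ENNReal.ofReal_natCast, ENNReal.ofReal_one, ENNReal.ofReal_ofNat]
    _ ≤ ENNReal.ofReal (1945 * (κ + 49) * (I.sampleCoeff / x)) :=
        ENNReal.ofReal_le_ofReal (sampling_cost_le hκ I.n_pos (Nat.cast_nonneg _) hOPT
          (Nat.one_le_cast.2 hθ) hθx)

include hx hθx hb hbI hΔ hθ hxa han in
theorem mean_proxGrad_time_le_coeff :
    ((I.genRRs θ).mean fun Rs _ => ((I.proxGrad Rs a).time : ℝ≥0∞)) ≤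
      ENNReal.ofReal (1945 * (117 * (Δ₀ ^ 2 + 2 / b)) *
        (I.evalCoeff Th / x ^ 2 + I.proxCoeff Tc Tprox / x)) := by
  have hn := I.n_nonneg
  have hε := A.ε_pos
  have hβ := A.βh_nonneg
  have hmoment₁ := I.rrMoment_nonneg 1
  have hmoment₂ := I.rrMoment_nonneg 2
  have hmoment₃ := I.rrMoment_nonneg 3
  have ha : 0 < a := lt_of_lt_of_le (by positivity) hxa
  refine (A.mean_proxGrad_time_le hb hbI hΔ hθ ha han).trans (ENNReal.ofReal_le_ofReal ?_)
  exact gradient_cost_le (by positivity) (by positivity) (by positivity) (by positivity)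
    (by positivity) I.n_pos hε hx (Nat.cast_nonneg _) hθx hxa

include A hx hθx hκ hb hbI hΔ hθ hxa han in
theorem phaseTime_le :
    I.phaseTime θ a ≤ ENNReal.ofReal (I.phaseBound κ Δ₀ b Th Tc Tprox x) := by
  have heval : 0 ≤ I.evalCoeff Th / x ^ 2 := div_nonneg A.evalCoeff_nonneg (sq_nonneg x)
  have hprox : 0 ≤ I.proxCoeff Tc Tprox / x := div_nonneg A.proxCoeff_nonneg hx.le
  have hsample : 0 ≤ I.sampleCoeff / x := div_nonneg A.sampleCoeff_nonneg hx.le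
  simp only [phaseTime, ← add_assoc]
  rw [Prog.mean_add]
  refine (add_le_add (A.mean_genRRs_time_le_sampleCoeff hθx hκ hθ)
    (A.mean_proxGrad_time_le_coeff hx hθx hb hbI hΔ hθ hxa han)).trans ?_
  rw [← ENNReal.ofReal_add (by positivity) (by positivity)]
  refine ENNReal.ofReal_le_ofReal ?_
  rw [phaseBound, phaseConst, add_div, add_mul]
  gcongr <;> linarith

end PhaseTime

end Assumptions

end Problem

/-! ### Summation over the scales -/

/-- A cost per scale that at least doubles and at most quadruples when the scale is halved, as the
sums of multiples of `1 / x` and of `1 / x ^ 2` do. -/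
structure IsScaleCost (f : ℝ → ℝ) : Prop where
  nonneg : ∀ {x}, 0 < x → 0 ≤ f x
  anti : ∀ {x y}, 0 < x → x ≤ y → f y ≤ f x
  two_mul_le : ∀ {x}, 0 < x → 2 * f x ≤ f (x / 2)
  half_le : ∀ {x}, 0 < x → f (x / 2) ≤ 4 * f x

/-- A bound on the probability that the loop goes on after a round with the guess `x` of the
optimum `o`. -/
def failProb (o x : ℝ) : ℝ := if x ≤ o / 6 then 1 / 8 else 1

/-- A bound on the expected cost from the round with the guess `x` of the optimum `o` on, if a round
with the guess `y` costs `2 * f y` and is followed by another one with probability `failProb o y`.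
The costs grow geometrically down to the guess `o / 12` and decrease geometrically in expectation
after it. -/
def remainingCost (f : ℝ → ℝ) (o x : ℝ) : ℝ :=
  if x ≤ o / 6 then 8 * f x else 14 * f (o / 12) - 4 * f x

theorem failProb_nonneg (o x : ℝ) : 0 ≤ failProb o x := by
  unfold failProb
  split_ifs <;> norm_num

namespace IsScaleCost

variable {f : ℝ → ℝ} {o x : ℝ} (hf : IsScaleCost f) (ho : 0 < o) (hx : 0 < x)

include hf ho hx

theorem mul_le_remainingCost : 8 * f x ≤ remainingCost f o x := by
  unfold remainingCost
  split_ifs with h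
  · exact le_rfl
  · have hanti := hf.anti (x := o / 12) (y := x) (by positivity) (by linarith)
    have htwo := hf.nonneg hx
    linarith

theorem remainingCost_nonneg : 0 ≤ remainingCost f o x :=
  (mul_nonneg (by norm_num) (hf.nonneg hx)).trans (hf.mul_le_remainingCost ho hx)

theorem remainingCost_step :
    2 * f x + failProb o x * remainingCost f o (x / 2) ≤ remainingCost f o x := by
  have hnonneg := hf.nonneg hx
  have htwo := hf.two_mul_le hx
  have hhalf := hf.half_le hx
  unfold remainingCost failProb
  by_cases h : x ≤ o / 6
  · rw [if_pos h, if_pos h, if_pos (by linarith)]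
    linarith
  · rw [if_neg h, if_neg h]
    split_ifs with h'
    · have hanti := hf.anti (x := o / 12) (y := x / 2) (by positivity) (by linarith)
      linarith
    · linarith

end IsScaleCost

namespace Problem

variable {V : Type} [Fintype V] [DecidableEq V] {d : ℕ} (I : Problem V d)

/-! ### The rounds of the algorithm -/

section Rounds

variable [Nonempty V]

/-- The mean time of the final phase. -/
def finalTime (LB : ℝ) : ℝ≥0∞ :=
  I.phaseTime ⌈max (I.theta1 LB) (I.theta2 LB)⌉₊ (I.ε * LB)

/-- The mean time of the rounds from round `i` on and the final phase, if `j` rounds are left. -/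
def totalTime (j i : ℕ) : ℝ≥0∞ := (I.rounds j i).mean fun LB t => (t : ℝ≥0∞) + I.finalTime LB

theorem expTime_proxGradRIS : I.proxGradRIS.expTime = I.totalTime I.numRounds 1 := by
  rw [Prog.expTime_eq_mean, proxGradRIS, totalTime]
  simp only [Prog.mean_bind, Prog.mean_ofTimed, Prog.mean_pure, time_tick, finalTime,
    phaseTime]
  congr 1
  funext LB t
  push_cast
  rw [Prog.mean_add, Prog.mean_const]
  simp only [add_zero]

theorem totalTime_zero (i : ℕ) : I.totalTime 0 i = I.finalTime 1 := by
  rw [totalTime, rounds, Prog.mean_pure, Nat.cast_zero, zero_add]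

theorem totalTime_succ (j i : ℕ) : I.totalTime (j + 1) i =
    (I.genRRs (I.theta i)).mean fun Rs t =>
      (30 + ((t : ℝ≥0∞) + ((I.proxGrad Rs (I.ε * I.guess i / 3)).time : ℝ≥0∞))) +
      if (1 + I.ε' + I.ε / 3) * I.guess i ≤ (I.proxGrad Rs (I.ε * I.guess i / 3)).val.2
      then I.finalTime ((I.proxGrad Rs (I.ε * I.guess i / 3)).val.2 / (1 + I.ε' + I.ε / 3))
      else I.totalTime j (i + 1) := by
  rw [totalTime, rounds]
  simp only [Prog.mean_bind, Prog.mean_ofTimed, time_tick]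
  congr 1
  funext Rs t
  split_ifs with h
  · simp only [Prog.mean_pure]
    push_cast
    simp only [add_zero]
  · rw [totalTime, ← Prog.mean_const (I.rounds j (i + 1)) (30 + _), ← Prog.mean_add]
    push_cast
    simp only [add_assoc]

end Rounds

/-- The bound on the hits of a point `x` in a round `i` that does not leave the loop. -/
def hitsThreshold (i : ℕ) (x : Mix d) : ℝ := I.theta i / I.n * (3 * I.guess i - I.s x)

namespace Assumptions

variable {I} {κ : ℝ} {Th Tc Tprox : ℕ} (A : I.Assumptions κ Th Tc Tprox)

include A

theorem isScaleCost_phaseBound [Nonempty V] {Δ₀ b : ℝ} (hκ : 0 ≤ κ) (hb : 0 < b) :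
    IsScaleCost (I.phaseBound κ Δ₀ b Th Tc Tprox) := by
  have hC := phaseConst_nonneg (Δ₀ := Δ₀) hκ hb
  have heval := A.evalCoeff_nonneg
  have hlin := add_nonneg A.proxCoeff_nonneg A.sampleCoeff_nonneg
  have hhalf (x : ℝ) : I.phaseBound κ Δ₀ b Th Tc Tprox (x / 2) = phaseConst κ Δ₀ b *
      (4 * (I.evalCoeff Th / x ^ 2) + 2 * ((I.proxCoeff Tc Tprox + I.sampleCoeff) / x)) := by
    rw [phaseBound, div_pow, div_div_eq_mul_div, div_div_eq_mul_div]
    ring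
  refine ⟨fun hx => ?_, fun hx hxy => ?_, fun {x} hx => ?_, fun {x} hx => ?_⟩
  · exact mul_nonneg hC (add_nonneg (div_nonneg heval (sq_nonneg _)) (div_nonneg hlin hx.le))
  · unfold phaseBound
    gcongr
  all_goals
    rw [hhalf, phaseBound, mul_left_comm]
    refine mul_le_mul_of_nonneg_left ?_ hC
    linarith [div_nonneg heval (sq_nonneg x), div_nonneg hlin hx.le]

theorem theta_pos {i : ℕ} (h : i ≤ I.numRounds) : 0 < I.theta i := by
  have htheta := A.twelve_mul_n_le_theta_mul_guess h
  have hn := two_pos.trans_le A.two_le_n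
  exact_mod_cast pos_of_mul_pos_left (lt_of_lt_of_le (by positivity) htheta) (A.guess_pos i).le

theorem mean_fail_le [Nonempty V] {i : ℕ} (h : i ≤ I.numRounds) {x : Mix d} (hx : x ∈ I.feasible)
    (hopt : I.g x + I.s x = I.OPT) :
    ((I.genRRs (I.theta i)).mean fun Rs _ => if I.hits Rs x ≤ I.hitsThreshold i x then 1 else 0) ≤
      ENNReal.ofReal (failProb I.OPT (I.guess i)) := by
  rw [failProb]
  split_ifs with hguess
  · refine (A.hits_lower_tail (A.dom_subset hx.1) _ _).trans (ENNReal.ofReal_le_ofReal ?_)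
    have hn := two_pos.trans_le A.two_le_n
    have htheta : 12 ≤ I.theta i / I.n * I.guess i := by
      rw [div_mul_eq_mul_div, le_div_iff₀ hn]
      exact A.twelve_mul_n_le_theta_mul_guess h
    have hexponent : I.hitsThreshold i x - 3 / 5 * I.theta i * (I.g x / I.n) ≤ -7 :=
      calc I.hitsThreshold i x - 3 / 5 * I.theta i * (I.g x / I.n)
          = I.theta i / I.n * (3 * I.guess i - I.s x - 3 / 5 * I.g x) := by
            rw [hitsThreshold]
            ring
        _ ≤ I.theta i / I.n * (-(3 / 5) * I.guess i) := by
            gcongr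
            linarith [A.s_nonneg hx]
        _ ≤ -7 := by linarith
    calc Real.exp (I.hitsThreshold i x - 3 / 5 * I.theta i * (I.g x / I.n))
        ≤ Real.exp (-7) := Real.exp_le_exp.2 hexponent
      _ ≤ 1 / 8 := by
          rw [Real.exp_neg, one_div]
          exact inv_anti₀ (by norm_num) (by linarith [Real.add_one_le_exp (7 : ℝ)])
  · rw [ENNReal.ofReal_one, ← Prog.mean_const (I.genRRs (I.theta i)) 1]
    refine Prog.mean_mono _ fun Rs _ => ?_
    rw [Prog.mean_const]
    split_ifs <;> simp

theorem hits_le_hitsThreshold {i : ℕ} {Rs : List (List V)} (hlen : Rs.length = I.theta i)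
    (hpos : 0 < Rs.length) (hM : 0 < I.smoothness Rs) {x : Mix d} (hx : x ∈ I.feasible)
    (hfail : (I.proxGrad Rs (I.ε * I.guess i / 3)).val.2 < (1 + I.ε' + I.ε / 3) * I.guess i) :
    I.hits Rs x ≤ I.hitsThreshold i x := by
  have hε := A.ε_pos
  have hg := A.guess_pos i
  have hn := two_pos.trans_le A.two_le_n
  have hfactor : (1 + I.ε' + I.ε / 3) * I.guess i ≤ (1 + 1 / 4 + 1 / 6) * I.guess i := by
    refine mul_le_mul_of_nonneg_right ?_ hg.le
    linarith [A.ε'_le, A.ε_lt]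
  have herror : I.ε * I.guess i ≤ 1 / 2 * I.guess i :=
    mul_le_mul_of_nonneg_right A.ε_lt.le hg.le
  have hestimate : I.estimate Rs x ≤ 3 * I.guess i - I.s x := by
    linarith [A.estimate_add_s_le_proxGrad hM (a := I.ε * I.guess i / 3) (by positivity) hx]
  rw [hitsThreshold, ← hlen]
  have : (0 : ℝ) < Rs.length := Nat.cast_pos.2 hpos
  calc I.hits Rs x = Rs.length / I.n * I.estimate Rs x := by
        rw [estimate]
        field_simp
    _ ≤ Rs.length / I.n * (3 * I.guess i - I.s x) := by gcongr

section Time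

variable [Nonempty V] {Δ₀ b : ℝ} (hκ : 0 ≤ κ) (hb : 0 < b) (hbI : b ≤ I.βh + I.Lh ^ 2)
  (hΔ : I.Δ ≤ Δ₀)

include hκ hb hbI hΔ

theorem finalTime_le {LB : ℝ} (hLB : 1 ≤ LB) (hLB' : LB ≤ 2 * I.n) :
    I.finalTime LB ≤ ENNReal.ofReal (I.phaseBound κ Δ₀ b Th Tc Tprox LB) := by
  have hLB_pos := one_pos.trans_le hLB
  have hmul : I.ε * LB ≤ 1 / 2 * (2 * I.n) :=
    mul_le_mul A.ε_lt.le hLB' hLB_pos.le (by norm_num)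
  exact A.phaseTime_le hLB_pos (A.ceil_max_theta_le hLB hLB') hκ hb hbI hΔ
    (Nat.ceil_pos.2 (lt_max_of_lt_left (A.theta1_pos hLB_pos)))
    (div_le_self (mul_pos A.ε_pos hLB_pos).le (by norm_num)) (by linarith)

theorem phaseTime_theta_le {i : ℕ} (hi : 1 ≤ i) (h : i ≤ I.numRounds) :
    I.phaseTime (I.theta i) (I.ε * I.guess i / 3) ≤
      ENNReal.ofReal (I.phaseBound κ Δ₀ b Th Tc Tprox (I.guess i)) := by
  have hg := A.guess_pos i
  have hunit := A.one_le_n_mul_logCover_div hg (by linarith [A.guess_le hi, I.n_pos])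
  have hmul : I.ε * I.guess i ≤ 1 / 2 * I.n :=
    mul_le_mul A.ε_lt.le (A.guess_le hi) hg.le (by norm_num)
  exact A.phaseTime_le hg (by linarith [A.theta_le hi h]) hκ hb hbI hΔ (A.theta_pos h) le_rfl
    (by linarith [I.n_pos])

theorem finalTime_div_le {i : ℕ} (h : i ≤ I.numRounds) {B : ℝ} (hB : B ≤ I.n + I.lam * I.k)
    (hpass : (1 + I.ε' + I.ε / 3) * I.guess i ≤ B) :
    I.finalTime (B / (1 + I.ε' + I.ε / 3)) ≤
      ENNReal.ofReal (I.phaseBound κ Δ₀ b Th Tc Tprox (I.guess i)) := by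
  have hg := A.guess_pos i
  have hc : 1 ≤ 1 + I.ε' + I.ε / 3 := by linarith [A.ε_pos, A.ε'_pos]
  have hguess : I.guess i ≤ B / (1 + I.ε' + I.ε / 3) := by
    rwa [le_div_iff₀ (one_pos.trans_le hc), mul_comm]
  have hB_nonneg : 0 ≤ B := le_trans (by positivity) hpass
  refine (A.finalTime_le hκ hb hbI hΔ (by linarith [A.two_le_guess h]) ?_).trans
    (ENNReal.ofReal_le_ofReal ((A.isScaleCost_phaseBound hκ hb).anti hg hguess))
  exact (div_le_self hB_nonneg hc).trans (hB.trans A.n_add_le_two_mul)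

theorem totalTime_succ_le (j : ℕ) {i : ℕ} (hi : 1 ≤ i) (h : i ≤ I.numRounds) :
    I.totalTime (j + 1) i ≤
      ENNReal.ofReal (2 * I.phaseBound κ Δ₀ b Th Tc Tprox (I.guess i)) +
        ENNReal.ofReal (failProb I.OPT (I.guess i)) * I.totalTime j (i + 1) := by
  obtain ⟨x, hx, hopt⟩ := A.exists_isOpt
  have hbound := (A.isScaleCost_phaseBound (Δ₀ := Δ₀) hκ hb).nonneg (A.guess_pos i)
  have hround (Rs : List (List V)) (t : ℕ) (hlen : Rs.length = I.theta i)
      (hne : ∀ R ∈ Rs, R ≠ []) :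
      ((30 + ((t : ℝ≥0∞) + ((I.proxGrad Rs (I.ε * I.guess i / 3)).time : ℝ≥0∞))) +
        if (1 + I.ε' + I.ε / 3) * I.guess i ≤ (I.proxGrad Rs (I.ε * I.guess i / 3)).val.2
        then I.finalTime ((I.proxGrad Rs (I.ε * I.guess i / 3)).val.2 / (1 + I.ε' + I.ε / 3))
        else I.totalTime j (i + 1)) ≤
      (40 + ((t : ℝ≥0∞) + ((I.proxGrad Rs (I.ε * I.guess i / 3)).time : ℝ≥0∞))) +
        (ENNReal.ofReal (I.phaseBound κ Δ₀ b Th Tc Tprox (I.guess i)) +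
          I.totalTime j (i + 1) * if I.hits Rs x ≤ I.hitsThreshold i x then 1 else 0) := by
    have hpos : 0 < Rs.length := hlen ▸ A.theta_pos h
    have hM : 0 < I.smoothness Rs :=
      (mul_pos I.n_pos hb).trans_le (A.le_smoothness hbI hne hpos)
    refine add_le_add (by gcongr; norm_num) ?_
    split_ifs with hpass hhits hhits
    · exact (A.finalTime_div_le hκ hb hbI hΔ h (A.proxGrad_le hM _) hpass).trans le_self_add
    · exact (A.finalTime_div_le hκ hb hbI hΔ h (A.proxGrad_le hM _) hpass).trans le_self_add
    · rw [mul_one]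
      exact le_add_self
    · exact absurd (A.hits_le_hitsThreshold hlen hpos hM hx (not_le.1 hpass)) hhits
  rw [totalTime_succ]
  refine (I.mean_genRRs_mono _ hround).trans ?_
  rw [Prog.mean_add, Prog.mean_add _ fun _ _ => ENNReal.ofReal _, Prog.mean_const,
    Prog.mean_const_mul, ← add_assoc, two_mul, ENNReal.ofReal_add hbound hbound,
    mul_comm (I.totalTime j (i + 1))]
  gcongr
  · exact A.phaseTime_theta_le hκ hb hbI hΔ hi h
  · exact A.mean_fail_le h hx hopt

theorem totalTime_zero_le {i : ℕ} (hi : I.guess i ≤ 2) :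
    I.totalTime 0 i ≤
      ENNReal.ofReal (remainingCost (I.phaseBound κ Δ₀ b Th Tc Tprox) I.OPT (I.guess i)) := by
  have hcost := A.isScaleCost_phaseBound (Δ₀ := Δ₀) hκ hb
  have hOPT := one_pos.trans_le A.one_le_OPT
  have hg := A.guess_pos i
  rw [totalTime_zero]
  refine (A.finalTime_le hκ hb hbI hΔ le_rfl (by linarith [A.two_le_n])).trans
    (ENNReal.ofReal_le_ofReal ?_)
  calc I.phaseBound κ Δ₀ b Th Tc Tprox 1
      ≤ I.phaseBound κ Δ₀ b Th Tc Tprox (I.guess i / 2) :=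
        hcost.anti (half_pos hg) (by linarith)
    _ ≤ 4 * I.phaseBound κ Δ₀ b Th Tc Tprox (I.guess i) := hcost.half_le hg
    _ ≤ remainingCost (I.phaseBound κ Δ₀ b Th Tc Tprox) I.OPT (I.guess i) := by
        linarith [hcost.mul_le_remainingCost hOPT hg, hcost.nonneg hg]

theorem totalTime_le (j : ℕ) : ∀ i, 1 ≤ i → i + j = I.numRounds + 1 →
    I.totalTime j i ≤
      ENNReal.ofReal (remainingCost (I.phaseBound κ Δ₀ b Th Tc Tprox) I.OPT (I.guess i)) := by
  have hcost := A.isScaleCost_phaseBound (Δ₀ := Δ₀) hκ hb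
  have hOPT := one_pos.trans_le A.one_le_OPT
  induction j with
  | zero =>
    intro i _ hi
    refine A.totalTime_zero_le hκ hb hbI hΔ ?_
    rw [← add_zero i, hi]
    exact A.guess_last_le
  | succ j ih =>
    intro i hi hij
    have hg := A.guess_pos i
    have hfail := failProb_nonneg I.OPT (I.guess i)
    calc I.totalTime (j + 1) i
        ≤ ENNReal.ofReal (2 * I.phaseBound κ Δ₀ b Th Tc Tprox (I.guess i)) +
            ENNReal.ofReal (failProb I.OPT (I.guess i)) * I.totalTime j (i + 1) :=
          A.totalTime_succ_le hκ hb hbI hΔ j hi (by lia)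
      _ ≤ ENNReal.ofReal (2 * I.phaseBound κ Δ₀ b Th Tc Tprox (I.guess i)) +
            ENNReal.ofReal (failProb I.OPT (I.guess i)) * ENNReal.ofReal
              (remainingCost (I.phaseBound κ Δ₀ b Th Tc Tprox) I.OPT (I.guess i / 2)) := by
          rw [← I.guess_succ]
          gcongr
          exact ih (i + 1) (by lia) (by lia)
      _ = ENNReal.ofReal (2 * I.phaseBound κ Δ₀ b Th Tc Tprox (I.guess i) +
            failProb I.OPT (I.guess i) *
              remainingCost (I.phaseBound κ Δ₀ b Th Tc Tprox) I.OPT (I.guess i / 2)) := by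
          rw [ENNReal.ofReal_add (mul_nonneg zero_le_two (hcost.nonneg hg))
            (mul_nonneg hfail (hcost.remainingCost_nonneg hOPT (half_pos hg))),
            ENNReal.ofReal_mul hfail]
      _ ≤ ENNReal.ofReal (remainingCost (I.phaseBound κ Δ₀ b Th Tc Tprox) I.OPT (I.guess i)) :=
          ENNReal.ofReal_le_ofReal (hcost.remainingCost_step hOPT hg)

end Time

end Assumptions

/-! ### The bound on the expected running time -/

variable {V : Type} [Fintype V] {d : ℕ} {I : Problem V d}

theorem L_add_L : I.L + I.L = 2 * I.n ^ 2 * I.Lh + 2 * I.lam * I.Lc := by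
  unfold L
  ring

variable [DecidableEq V] {κ Δ₀ b : ℝ} {Th Tc Tprox : ℕ} (A : I.Assumptions κ Th Tc Tprox)

namespace Assumptions

include A

theorem remainingCost_guess_one_le [Nonempty V] {f : ℝ → ℝ} (hf : IsScaleCost f) :
    remainingCost f I.OPT (I.guess 1) ≤ 14 * f (I.OPT / 12) := by
  have hguess : ¬ I.guess 1 ≤ I.OPT / 6 := by
    rw [guess, pow_one, not_le]
    linarith [A.OPT_le, A.one_le_OPT]
  rw [remainingCost, if_neg hguess]
  linarith [hf.nonneg (A.guess_pos 1)]

theorem phaseBound_OPT_div_le [Nonempty V] (hκ : 0 ≤ κ) (hb : 0 < b) :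
    I.phaseBound κ Δ₀ b Th Tc Tprox (I.OPT / 12) ≤ 144 * phaseConst κ Δ₀ b *
      I.timeBound Th Tc Tprox (I.ε / (3 * (2 * I.n ^ 2 * I.Lh + 2 * I.lam * I.Lc))) := by
  have hOPT := A.one_le_OPT
  have hprox := A.proxCoeff_nonneg
  have hC := phaseConst_nonneg (Δ₀ := Δ₀) hκ hb
  have heval : I.evalCoeff Th / I.OPT ^ 2 ≤ I.evalCoeff Th / I.OPT :=
    div_le_div_of_nonneg_left A.evalCoeff_nonneg (by positivity) (le_self_pow₀ hOPT two_ne_zero)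
  have hlog : I.proxCoeff Tc Tprox / I.OPT ≤
      I.proxCoeff Tc Tprox * Real.logb 2 (I.n + I.lam * I.k) :=
    (div_le_self hprox hOPT).trans (le_mul_of_one_le_right hprox A.one_le_logb)
  have hsample : 0 ≤ I.sampleCoeff / I.OPT := div_nonneg A.sampleCoeff_nonneg (by positivity)
  calc I.phaseBound κ Δ₀ b Th Tc Tprox (I.OPT / 12)
      = phaseConst κ Δ₀ b * (144 * (I.evalCoeff Th / I.OPT ^ 2) +
          12 * (I.proxCoeff Tc Tprox / I.OPT + I.sampleCoeff / I.OPT)) := by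
        rw [phaseBound]
        field_simp
        ring
    _ ≤ phaseConst κ Δ₀ b * (144 * (I.evalCoeff Th / I.OPT +
          I.proxCoeff Tc Tprox * Real.logb 2 (I.n + I.lam * I.k) + I.sampleCoeff / I.OPT)) := by
        gcongr
        linarith [div_nonneg hprox (one_pos.trans_le hOPT).le]
    _ = 144 * phaseConst κ Δ₀ b *
          I.timeBound Th Tc Tprox (I.ε / (3 * (2 * I.n ^ 2 * I.Lh + 2 * I.lam * I.Lc))) := by
        rw [timeBound, ← L_add_L, ← div_div, evalCoeff, proxCoeff, sampleCoeff, logCover]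
        field_simp

theorem log_mul_covering_le {r : ℝ} (hr : 0 < r) :
    Real.log (I.n ^ I.ℓ * I.covering r) ≤ (1 + Real.logb 2 (ballCovering d)) *
      Real.log (I.n ^ I.ℓ * I.covering (3 * r)) := by
  have hn := two_pos.trans_le A.two_le_n_rpow
  have hcov := A.one_le_covering hr
  have hcov' := A.one_le_covering (mul_pos three_pos hr)
  have hball : (1 : ℝ) ≤ ballCovering d := Nat.one_le_cast.2 (one_le_ballCovering d)
  have hlog : Real.log 2 ≤ Real.log (I.n ^ I.ℓ * I.covering (3 * r)) :=
    Real.log_le_log two_pos (A.two_le_n_rpow.trans (le_mul_of_one_le_right hn.le hcov'))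
  calc Real.log (I.n ^ I.ℓ * I.covering r)
      ≤ Real.log (ballCovering d * (I.n ^ I.ℓ * I.covering (3 * r))) := by
        refine Real.log_le_log (by positivity) ?_
        rw [mul_left_comm]
        gcongr
        exact A.covering_le_ballCovering_mul hr
    _ = Real.log (I.n ^ I.ℓ * I.covering (3 * r)) +
          Real.logb 2 (ballCovering d) * Real.log 2 := by
        rw [Real.log_mul (by positivity) (by positivity), Real.logb,
          div_mul_cancel₀ _ (Real.log_pos one_lt_two).ne', add_comm]
    _ ≤ (1 + Real.logb 2 (ballCovering d)) * Real.log (I.n ^ I.ℓ * I.covering (3 * r)) := by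
        rw [add_mul, one_mul]
        gcongr
        exact Real.logb_nonneg one_lt_two hball

theorem timeBound_le_of_log_le [Nonempty V] {C r r' : ℝ} (hC : 1 ≤ C)
    (h : Real.log (I.n ^ I.ℓ * I.covering r) ≤ C * Real.log (I.n ^ I.ℓ * I.covering r')) :
    I.timeBound Th Tc Tprox r ≤ C * I.timeBound Th Tc Tprox r' := by
  have hOPT := A.one_le_OPT
  have hε := A.ε_pos
  have hβ := A.βh_nonneg
  have hn := I.n_nonneg
  have hmoment₁ := I.rrMoment_nonneg 1
  have hmoment₂ := I.rrMoment_nonneg 2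
  have hmoment₃ := I.rrMoment_nonneg 3
  have hlogb := zero_le_one.trans A.one_le_logb
  unfold timeBound
  rw [mul_add C, mul_add C]
  gcongr ?_ + ?_ + ?_
  · calc I.n ^ 2 * (I.rrMoment 2 * I.βh + I.rrMoment 3 * I.Lh ^ 2) *
          Real.log (I.n ^ I.ℓ * I.covering r) / (I.ε ^ 3 * I.OPT) * (1 + Th)
        ≤ I.n ^ 2 * (I.rrMoment 2 * I.βh + I.rrMoment 3 * I.Lh ^ 2) *
          (C * Real.log (I.n ^ I.ℓ * I.covering r')) / (I.ε ^ 3 * I.OPT) * (1 + Th) := by gcongr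
      _ = C * (I.n ^ 2 * (I.rrMoment 2 * I.βh + I.rrMoment 3 * I.Lh ^ 2) *
          Real.log (I.n ^ I.ℓ * I.covering r') / (I.ε ^ 3 * I.OPT) * (1 + Th)) := by ring
  · exact le_mul_of_one_le_left (by positivity) hC
  · calc (I.numEdges + I.n) * Real.log (I.n ^ I.ℓ * I.covering r) / I.ε ^ 2
        ≤ (I.numEdges + I.n) * (C * Real.log (I.n ^ I.ℓ * I.covering r')) / I.ε ^ 2 := by gcongr
      _ = C * ((I.numEdges + I.n) * Real.log (I.n ^ I.ℓ * I.covering r') / I.ε ^ 2) := by ring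

section ExpTime

variable [Nonempty V] (hκ : 0 ≤ κ) (hb : 0 < b) (hbI : b ≤ I.βh + I.Lh ^ 2) (hΔ : I.Δ ≤ Δ₀)

include hκ hb hbI hΔ

theorem expTime_le : I.proxGradRIS.expTime ≤ ENNReal.ofReal (2016 * phaseConst κ Δ₀ b *
    I.timeBound Th Tc Tprox (I.ε / (3 * (2 * I.n ^ 2 * I.Lh + 2 * I.lam * I.Lc)))) := by
  rw [expTime_proxGradRIS]
  refine (A.totalTime_le hκ hb hbI hΔ I.numRounds 1 le_rfl (add_comm _ _)).trans
    (ENNReal.ofReal_le_ofReal ?_)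
  linarith [A.remainingCost_guess_one_le (A.isScaleCost_phaseBound (Δ₀ := Δ₀) hκ hb),
    A.phaseBound_OPT_div_le (Δ₀ := Δ₀) hκ hb]

theorem expTime_le_ballCovering : I.proxGradRIS.expTime ≤
    ENNReal.ofReal (2016 * phaseConst κ Δ₀ b * (1 + Real.logb 2 (ballCovering d)) *
      I.timeBound Th Tc Tprox (I.ε / (2 * I.n ^ 2 * I.Lh + 2 * I.lam * I.Lc))) := by
  set r := I.ε / (3 * (2 * I.n ^ 2 * I.Lh + 2 * I.lam * I.Lc)) with hr
  have hr_eq : I.ε / (2 * I.n ^ 2 * I.Lh + 2 * I.lam * I.Lc) = 3 * r := by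
    rw [hr, ← mul_div_assoc, mul_div_mul_left _ _ three_ne_zero]
  have hr_pos : 0 < r := by
    rw [hr, ← L_add_L, ← div_div]
    exact A.radius_pos
  have hball : 0 ≤ Real.logb 2 (ballCovering d) :=
    Real.logb_nonneg one_lt_two (Nat.one_le_cast.2 (one_le_ballCovering d))
  refine (A.expTime_le hκ hb hbI hΔ).trans (ENNReal.ofReal_le_ofReal ?_)
  rw [hr_eq, mul_assoc (2016 * _)]
  exact mul_le_mul_of_nonneg_left
    (A.timeBound_le_of_log_le (le_add_of_nonneg_right hball) (A.log_mul_covering_le hr_pos))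
    (mul_nonneg (by norm_num) (phaseConst_nonneg hκ hb))

end ExpTime

end Assumptions

end Problem

end CIMBS

end

theorem theorem8 (κ Δ₀ b : ℝ) (hκ : 0 ≤ κ) (hΔ₀ : 0 < Δ₀) (hb : 0 < b) :
    (∃ C : ℝ, ∀ (d : ℕ) (V : Type) [Fintype V] [DecidableEq V] [Nonempty V]
      (I : CIMBS.Problem V d) (Th Tc Tprox : ℕ), I.Assumptions κ Th Tc Tprox →
      I.Δ ≤ Δ₀ → b ≤ I.βh + I.Lh ^ 2 →
      I.proxGradRIS.expTime ≤ ENNReal.ofReal (C * I.timeBound Th Tc Tprox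
        (I.ε / (3 * (2 * I.n ^ 2 * I.Lh + 2 * I.lam * I.Lc))))) ∧
    (∀ d : ℕ, ∃ C : ℝ, ∀ (V : Type) [Fintype V] [DecidableEq V] [Nonempty V]
      (I : CIMBS.Problem V d) (Th Tc Tprox : ℕ), I.Assumptions κ Th Tc Tprox →
      I.Δ ≤ Δ₀ → b ≤ I.βh + I.Lh ^ 2 →
      I.proxGradRIS.expTime ≤ ENNReal.ofReal (C * I.timeBound Th Tc Tprox
        (I.ε / (2 * I.n ^ 2 * I.Lh + 2 * I.lam * I.Lc)))) := by
  refine ⟨⟨2016 * CIMBS.Problem.phaseConst κ Δ₀ b, ?_⟩, fun d =>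
    ⟨2016 * CIMBS.Problem.phaseConst κ Δ₀ b * (1 + Real.logb 2 (CIMBS.ballCovering d)), ?_⟩⟩
  · intro d V _ _ _ I Th Tc Tprox A hΔ hbI
    exact A.expTime_le hκ hb hbI hΔ
  · intro V _ _ _ I Th Tc Tprox A hΔ hbI
    exact A.expTime_le_ballCovering hκ hb hbI hΔ
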